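/- **Setting.** *Cutoffs.* A smooth characteristic function of $[1,\infty)$ is a nondecreasing $F\in C^\infty(\mathbb R)$ with $F(\lambda)=0$ for $\lambda\le\frac12$ and $F(\lambda)=1$ for $\lambda\ge1$. We write $F(\frac{|x|}{t^\alpha}\ge1)$ for $F(|x|/t^\alpha)$, and similarly with $\langle x\rangle$. *Smoothed modulus and $\gamma$.* Fix $\rho\in C^\infty(\mathbb R)$, $\rho\ge0$, $\{\rho\neq0\}=(1,2)$, $\int_1^2\rho=1$. Put $\langle x\rangle=\beta(|x|)$ for $x\in\mathbb R^3$, where $\beta(r)=r$ for $r\ge2$, $\beta(r)=C_0+\int_1^r\int_1^s\rho(\tau)\,d\tau\,ds$ for $1\le r\le2$, $\beta(r)=C_0$ for $0\le r\le1$, with $C_0=2-\int_1^2\int_1^s\rho(\tau)\,d\tau\,ds$. The smoothed radial momentum is $$\gamma=\tfrac12\big(\nabla\langle x\rangle\cdot\mathbf p+\mathbf p\cdot\nabla\langle x\rangle\big),\qquad \mathbf p=-i\nabla .$$ *Solutions.* Let $\mathcal N=\mathcal N(|\phi|,|x|,t)$ be a (real- or complex-valued) function and let $\phi$ be a global spherically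 symmetric solution of $$i\partial_t\phi+\Delta\phi=\mathcal N(|\phi|,|x|,t)\,\phi\ \text{ on } [0,\infty)\times\mathbb R^3,\qquad \phi(0)=\phi_0\in H^1_{rad}(\mathbb R^3)\cap L^2_{rad}(\mathbb R^3,|x|^{1/2}dx),$$ that is: $\phi(t)\in H^1(\mathbb R^3)$ is radial for every $t\ge0$, $t\mapsto\phi(t)\in L^2(\mathbb R^3)$ is continuous, $\mathcal N(|\phi|,|x|,t)\phi$ is locally integrable on $[0,\infty)\times\mathbb R^3$, and the equation holds in the sense of distributions, i.e. for all $\eta\in C_c^\infty(\mathbb R^3)$ and $t\ge0$ $$i\int(\phi(t)-\phi_0)\,\eta\,dx+\int_0^t\!\!\int\phi\,\Delta\eta\,dx\,ds=\int_0^t\!\!\int\mathcal N(|\phi|,|x|,s)\,\phi\,\eta\,dx\,ds .$$ For such $\phi$ and an operator $A$, let $\langle A\rangle_t=(A\phi(t),\phi(t))$ denote the expectation of $A$ in the state $\phi(t)$; $\langle\sqrt{FF'}\gamma^2\sqrt{FF'}\rangle_t$ is understood as the quadratic form $\|\gamma\sqrt{FF'}\,\phi(t)\|_{L^2}^2$,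 with $FF'$ evaluated at $\langle x\rangle/t^\alpha$. *Assumptions.* (H1) $\sup_{t\ge0}\|\phi(t)\|_{H^1(\mathbb R^3)}<\infty$. For $\alpha\in(\frac13,1)$ and a smooth characteristic function $F$ of $[1,\infty)$ we say that (H2) holds for the pair $(\alpha,F)$ if there are $\beta_0>1$ and $C$ (depending on $\alpha$, $F$, $\phi$) with $$\Big|F\Big(\frac{|x|}{t^\alpha}\ge1\Big)\,\mathcal N(|\phi(t,x)|,|x|,t)\Big|\le C\,t^{-\beta_0}\qquad\text{for all } t\ge1 \text{ and almost every } x\in\mathbb R^3 .$$ **Theorem (Existence of the $\gamma$ limit).** Assume (H1), and assume that (H2) holds for some pair $(\alpha_0,F_0)$, $\alpha_0\in(\frac13,1)$. Let $\alpha\in(\frac13,1)$ and let $F$ be a smooth characteristic function of $[1,\infty)$ such that either $(\alpha,F)=(\alpha_0,F_0)$, or $\alpha>\alpha_0$ (and $F$ is arbitrary). Then the limit $$\Gamma=\lim_{T\to+\infty}\Big\langle F\Big(\frac{\langle x\rangle}{t^\alpha}\ge1\Big)\,\gamma\,F\Big(\frac{\langle x\rangle}{t^\alpha}\ge1\Big)\Big\rangle_{t=T}$$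 exists and is a finite real number, and moreover $$\int_1^\infty t^{-\alpha}\,\Big\langle\sqrt{FF'}\,\gamma^2\sqrt{FF'}\Big\rangle_t\,dt<\infty .$$ In particular, if (H2) holds for every pair $(\alpha,F)$, then both conclusions hold for every $\alpha\in(\frac13,1)$ and every smooth characteristic function $F$ of $[1,\infty)$; and if (H2) holds for one $\alpha$ and every $F$, then both hold for this $\alpha$ and every $F$. -/

import Mathlib

open MeasureTheory Set Filter Topology
open scoped ContDiff ENNReal

noncomputable section

namespace NLSGamma

/-- Three-dimensional Euclidean space. -/
abbrev E3 : Type := EuclideanSpace ℝ (Fin 3)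

/-! ### The smoothed modulus `⟨x⟩` -/

/-- The profile from which `⟨x⟩` is built: a smooth nonnegative function with support `(1,2)` and
total integral one. -/
structure IsBump (ρ : ℝ → ℝ) : Prop where
  smooth : ContDiff ℝ ∞ ρ
  nonneg : ∀ r, 0 ≤ ρ r
  support_eq : Function.support ρ = Ioo 1 2
  integral_eq_one : ∫ r in (1 : ℝ)..2, ρ r = 1

/-- The constant value `C` of `⟨x⟩` near the origin, chosen so that the two outer pieces of
`beta` match. -/
def betaConst (ρ : ℝ → ℝ) : ℝ := 2 - ∫ s in (1 : ℝ)..2, ∫ τ in (1 : ℝ)..s, ρ τ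

/-- The function `β` with `β r = r` for `r ≥ 2`, `β r = C` for `r ≤ 1`, and
`β r = C + ∫_1^r ∫_1^s ρ(τ) dτ ds` for `1 ≤ r ≤ 2`. -/
def beta (ρ : ℝ → ℝ) (r : ℝ) : ℝ :=
  if 2 ≤ r then r
  else if 1 ≤ r then (∫ s in (1 : ℝ)..r, ∫ τ in (1 : ℝ)..s, ρ τ) + betaConst ρ
  else betaConst ρ

/-- `⟨x⟩ = β(|x|)`. -/
def jap (ρ : ℝ → ℝ) (x : E3) : ℝ := beta ρ ‖x‖

/-! ### Weak derivatives and the space `H¹(ℝ³)` -/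

/-- The classical `j`-th partial derivative. -/
def partialDeriv {V : Type*} [NormedAddCommGroup V] [NormedSpace ℝ V]
    (j : Fin 3) (f : E3 → V) (x : E3) : V :=
  fderiv ℝ f x (EuclideanSpace.single j 1)

/-- Test functions on `ℝ³`: complex-valued, smooth, compactly supported. -/
def IsTest (η : E3 → ℂ) : Prop := ContDiff ℝ ∞ η ∧ HasCompactSupport η

/-- `v` is the weak `j`-th partial derivative of `u`. -/
def HasWeakPartial (j : Fin 3) (u v : E3 → ℂ) : Prop :=
  LocallyIntegrable u ∧ LocallyIntegrable v ∧
    ∀ η : E3 → ℂ, IsTest η → ∫ x, u x * partialDeriv j η x = -∫ x, v x * η x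

open Classical in
/-- The weak `j`-th partial derivative of `u` (unique up to null sets if it exists; the value `0`
is used if it does not exist). -/
def weakPartial (j : Fin 3) (u : E3 → ℂ) : E3 → ℂ :=
  if h : ∃ v, HasWeakPartial j u v then h.choose else 0

/-- `u ∈ H¹(ℝ³)`. -/
def MemH1 (u : E3 → ℂ) : Prop :=
  MemLp u 2 ∧ ∀ j, ∃ v, HasWeakPartial j u v ∧ MemLp v 2

/-- The square of the `H¹` norm, `‖u‖²_{L²} + ‖∇u‖²_{L²}`. -/
def h1NormSq (u : E3 → ℂ) : ℝ≥0∞ :=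
  (∫⁻ x, ‖u x‖ₑ ^ 2) + ∑ j, ∫⁻ x, ‖weakPartial j u x‖ₑ ^ 2

/-- `u` is radial (as a class modulo null sets). -/
def IsRadial (u : E3 → ℂ) : Prop := ∃ f : ℝ → ℂ, ∀ᵐ x : E3, u x = f ‖x‖

/-! ### The equation -/

/-- The interaction term `𝐍(φ)(t,x) = 𝒩(|φ(t,x)|, |x|, t) φ(t,x)`. -/
def interaction (N : ℝ → ℝ → ℝ → ℂ) (φ : ℝ → E3 → ℂ) (t : ℝ) (x : E3) : ℂ :=
  N ‖φ t x‖ ‖x‖ t * φ t x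

/-- `φ` is a global, spherically symmetric solution of
`i ∂_t φ + Δ φ = 𝒩(|φ|,|x|,t) φ`, `φ(0) = φ₀`, on `[0,∞) × ℝ³`: it takes values in `H¹`, is
continuous in time with values in `L²`, the interaction term is locally integrable on
`[0,∞) × ℝ³`, and the equation holds in the sense of distributions (tested with `η(x)` and
integrated in time from `0` to `t`). The initial datum is in `H¹_rad ∩ L²_rad(|x|^{1/2} dx)`. -/
structure IsGlobalSolution (N : ℝ → ℝ → ℝ → ℂ) (φ₀ : E3 → ℂ) (φ : ℝ → E3 → ℂ) : Prop where
  data_memH1 : MemH1 φ₀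
  data_radial : IsRadial φ₀
  data_weight : (∫⁻ x, ENNReal.ofReal (‖x‖ ^ (1 / 2 : ℝ)) * ‖φ₀ x‖ₑ ^ 2) < ⊤
  init : φ 0 =ᵐ[volume] φ₀
  memH1 : ∀ t, 0 ≤ t → MemH1 (φ t)
  radial : ∀ t, 0 ≤ t → IsRadial (φ t)
  continuous_L2 : ∀ s, 0 ≤ s →
    Tendsto (fun t => eLpNorm (φ t - φ s) 2 volume) (𝓝[Ici 0] s) (𝓝 0)
  locInt : LocallyIntegrableOn (fun p : ℝ × E3 => interaction N φ p.1 p.2) (Ici 0 ×ˢ univ)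
  equation : ∀ η : E3 → ℂ, IsTest η → ∀ t, 0 ≤ t →
    Complex.I * ((∫ x, φ t x * η x) - ∫ x, φ 0 x * η x)
        + ∫ s in (0 : ℝ)..t, ∫ x, φ s x * Laplacian.laplacian η x
      = ∫ s in (0 : ℝ)..t, ∫ x, interaction N φ s x * η x

/-- The global `H¹` bound. -/
def GlobalH1Bound (φ : ℝ → E3 → ℂ) : Prop :=
  (⨆ t ∈ Ici (0 : ℝ), h1NormSq (φ t)) < ⊤

/-- Smooth characteristic functions `F(λ ≥ 1)` of `[1,∞)`. -/
structure IsSmoothChar (F : ℝ → ℝ) : Prop where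
  smooth : ContDiff ℝ ∞ F
  mono : Monotone F
  eq_zero : ∀ l, l ≤ 1 / 2 → F l = 0
  eq_one : ∀ l, 1 ≤ l → F l = 1

/-- Uniform decay of the interaction, for the exponent `α` and the cutoff `F`:
`|F(|x|/t^α ≥ 1) 𝒩(|φ|,|x|,t)| ≤ C t^{-β₀}` for all `t ≥ 1`, with some `β₀ > 1`. -/
def InteractionDecay (N : ℝ → ℝ → ℝ → ℂ) (φ : ℝ → E3 → ℂ) (α : ℝ) (F : ℝ → ℝ) : Prop :=
  ∃ β₀ C : ℝ, 1 < β₀ ∧ ∀ t, 1 ≤ t → ∀ᵐ x : E3,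
    ‖(F (‖x‖ / t ^ α) : ℂ) * N ‖φ t x‖ ‖x‖ t‖ ≤ C * t ^ (-β₀)

/-! ### The operator `γ` and the propagation observable -/

/-- `γ = ½ (∇⟨x⟩ · p + p · ∇⟨x⟩)`, `p = -i∇`, with weak derivatives. -/
def gammaOp (ρ : ℝ → ℝ) (u : E3 → ℂ) (x : E3) : ℂ :=
  (1 / 2) * ∑ j, (((partialDeriv j (jap ρ) x : ℝ) : ℂ) * (-Complex.I * weakPartial j u x)
    + -Complex.I * weakPartial j (fun y => ((partialDeriv j (jap ρ) y : ℝ) : ℂ) * u y) x)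

/-- Multiplication by `G(⟨x⟩ / t^α)`. -/
def cutoff (ρ : ℝ → ℝ) (α : ℝ) (G : ℝ → ℝ) (t : ℝ) (u : E3 → ℂ) (x : E3) : ℂ :=
  (G (jap ρ x / t ^ α) : ℂ) * u x

/-- The expectation `(A u, u)`, where `(f, g) = ∫ g f̄ dx`. -/
def expectation (A : (E3 → ℂ) → E3 → ℂ) (u : E3 → ℂ) : ℂ :=
  ∫ x, u x * (starRingEnd ℂ) (A u x)

/-- The observable `F(⟨x⟩/t^α ≥ 1) γ F(⟨x⟩/t^α ≥ 1)`. -/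
def observable (ρ : ℝ → ℝ) (α : ℝ) (F : ℝ → ℝ) (t : ℝ) (u : E3 → ℂ) : E3 → ℂ :=
  cutoff ρ α F t (gammaOp ρ (cutoff ρ α F t u))

/-- The function `√(F F')`. -/
def sqrtFF' (F : ℝ → ℝ) (l : ℝ) : ℝ := √(F l * deriv F l)

/-- The quadratic form `⟨√(FF') γ² √(FF')⟩ = ‖γ √(FF') u‖²_{L²}` (with `FF'` evaluated at
`⟨x⟩/t^α`), which is defined for `u ∈ H¹`. -/
def propagationForm (ρ : ℝ → ℝ) (α : ℝ) (F : ℝ → ℝ) (t : ℝ) (u : E3 → ℂ) : ℝ≥0∞ :=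
  ∫⁻ x, ‖gammaOp ρ (cutoff ρ α (sqrtFF' F) t u) x‖ₑ ^ 2

end NLSGamma

end

/-! The method is that of a monotone propagation observable. Put `T = t ^ α`, let `F` and its
derivatives be evaluated at `⟨x⟩ / T`, and write `γ u = -i q` with `q = ∇⟨x⟩ · ∇u + ½ (Δ⟨x⟩) u`.
Formally, the time derivative of `B(t) = (F φ, γ F φ)` has four contributions. (1) The commutator of
`-Δ` with `γ`, in the state `F φ`. This state lives far from the origin, where `∇⟨x⟩ = x/|x|`, the
Hessian of `|x|` is nonnegative and its trace `2/|x|` is harmonic in dimension three. The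
contribution is nonnegative and is discarded (`commutator_nonneg`). (2) The commutator of `Δ` with
the cutoff. It produces `4 T⁻¹ ∫ F F' |q|²`, a cross term that one integration by parts reduces to
size `T⁻³` (`abs_cross_term_le`), and a remainder of the same size. (3) The time derivative of the
cutoff. Completing a square absorbs it into one of the four copies of `T⁻¹ ∫ F F' |q|²`, at the
price of `T / t²` (`pointwise_flux`, `flux_ge`). (4) The interaction, of size `t ^ (-β₀)` on the
support of the cutoff. The errors `t ^ (-3α)`, `t ^ (α - 2)` and `t ^ (-β₀)` are integrable because
`α > 1/3`, `α < 1` and `β₀ > 1`. Hence `B` minus a decaying power is nondecreasing. Since `B` is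
bounded by the `H¹` bound, it converges, and its total increase controls `∫ T⁻¹ ∫ F F' |q|² dx dt`
(`tendsto_and_lintegral_lt_top`). Finally, up to the phase `-i`, `γ √(FF') φ` differs from `√(FF')
q` by `O(1/T)` in `L²`, which costs another `t ^ (-3α)` (`propagationForm_le`).

The solution is only in `H¹` and continuous in `L²`, so `B` cannot be differentiated directly. It is
replaced by `(w, γ w)`, where `w` is obtained from `F φ` by a spatial truncation at scale `n + 1`
and a mollification at scale `1/(n + 1)`. For fixed `n` this quantity is Lipschitz in time
(`lipschitz_mreg`), and wherever its derivative exists it is bounded below by terms that converge as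
`n → ∞` (`le_deriv_mreg`, `tendsto_flux`). Fatou's lemma transfers the inequality to the increments
of `B` (`lintegral_le_of_liminf_deriv`). A one-sided bound is all that monotonicity requires, and
for this reason the nonnegative commutator never has to converge. -/

noncomputable section
namespace NLSGamma

/-! ### The space `L²(ℝ³)` at the level of functions -/

/-- The `L²` pairing `∫ f ḡ`. -/
def ip (f g : E3 → ℂ) : ℂ := ∫ x, f x * (starRingEnd ℂ) (g x)

/-- The `L²` norm as a real number. -/
def nn (f : E3 → ℂ) : ℝ := (eLpNorm f 2 volume).toReal

/-- Square integrability. -/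
abbrev L2 (f : E3 → ℂ) : Prop := MemLp f 2 (volume : Measure E3)

lemma L2.add {f g : E3 → ℂ} (hf : L2 f) (hg : L2 g) : L2 (fun x => f x + g x) :=
  MemLp.add hf hg

lemma L2.sub {f g : E3 → ℂ} (hf : L2 f) (hg : L2 g) : L2 (fun x => f x - g x) :=
  MemLp.sub hf hg

lemma L2.smul (c : ℂ) {f : E3 → ℂ} (hf : L2 f) : L2 (fun x => c * f x) :=
  MemLp.const_mul hf c

lemma L2.sum {ι : Type*} (s : Finset ι) {f : ι → E3 → ℂ} (hf : ∀ i, L2 (f i)) :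
    L2 (fun x => ∑ i ∈ s, f i x) :=
  memLp_finsetSum s fun i _ => hf i

lemma nn_nonneg (f : E3 → ℂ) : 0 ≤ nn f := ENNReal.toReal_nonneg

lemma nn_eq_norm {f : E3 → ℂ} (hf : L2 f) : nn f = ‖hf.toLp f‖ := by
  rw [Lp.norm_toLp, nn]

lemma ip_eq_inner {f g : E3 → ℂ} (hf : L2 f) (hg : L2 g) :
    ip f g = inner ℂ (hg.toLp g) (hf.toLp f) := by
  rw [L2.inner_def, ip]
  apply integral_congr_ae
  filter_upwards [hf.coeFn_toLp, hg.coeFn_toLp] with x h1 h2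
  rw [h1, h2, RCLike.inner_apply]

lemma ip_integrable {f g : E3 → ℂ} (hf : L2 f) (hg : L2 g) :
    Integrable (fun x => f x * (starRingEnd ℂ) (g x)) := by
  refine (L2.integrable_inner (𝕜 := ℂ) (hg.toLp g) (hf.toLp f)).congr ?_
  filter_upwards [hf.coeFn_toLp, hg.coeFn_toLp] with x h1 h2
  rw [h1, h2, RCLike.inner_apply]

lemma norm_ip_le {f g : E3 → ℂ} (hf : L2 f) (hg : L2 g) : ‖ip f g‖ ≤ nn f * nn g := by
  rw [ip_eq_inner hf hg, nn_eq_norm hf, nn_eq_norm hg, mul_comm]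
  exact norm_inner_le_norm _ _

lemma ip_self {f : E3 → ℂ} (hf : L2 f) : ip f f = ((nn f ^ 2 : ℝ) : ℂ) := by
  rw [ip_eq_inner hf hf, nn_eq_norm hf, inner_self_eq_norm_sq_to_K]
  norm_cast

lemma nn_sq {f : E3 → ℂ} (hf : L2 f) : nn f ^ 2 = ∫ x, ‖f x‖ ^ 2 := by
  have h := ip_self hf
  have h2 : ip f f = ((∫ x, ‖f x‖ ^ 2 : ℝ) : ℂ) := by
    rw [ip, ← integral_complex_ofReal]
    congr 1; ext x
    rw [Complex.mul_conj, Complex.normSq_eq_norm_sq]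
  rw [h] at h2
  exact_mod_cast h2

lemma lintegral_enorm_sq {f : E3 → ℂ} (hf : L2 f) :
    ∫⁻ x, ‖f x‖ₑ ^ 2 = ENNReal.ofReal (nn f ^ 2) := by
  rw [nn_sq hf, ofReal_integral_eq_lintegral_ofReal
    ((memLp_two_iff_integrable_sq_norm hf.1).1 hf) (Eventually.of_forall fun x => by positivity)]
  congr 1; ext x
  rw [ENNReal.ofReal_pow (norm_nonneg _), ofReal_norm]

lemma ip_conj (f g : E3 → ℂ) : (starRingEnd ℂ) (ip f g) = ip g f := by
  rw [ip, ip, ← integral_conj]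
  congr 1; ext x
  rw [map_mul, Complex.conj_conj, mul_comm]

lemma nn_congr {f g : E3 → ℂ} (h : f =ᵐ[volume] g) : nn f = nn g := by
  rw [nn, nn, eLpNorm_congr_ae h]

lemma ip_add_left {f f' g : E3 → ℂ} (hf : L2 f) (hf' : L2 f') (hg : L2 g) :
    ip (fun x => f x + f' x) g = ip f g + ip f' g := by
  rw [ip, ip, ip, ← integral_add (ip_integrable hf hg) (ip_integrable hf' hg)]
  congr 1; ext x; ring

lemma ip_sub_left {f f' g : E3 → ℂ} (hf : L2 f) (hf' : L2 f') (hg : L2 g) :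
    ip (fun x => f x - f' x) g = ip f g - ip f' g := by
  rw [ip, ip, ip, ← integral_sub (ip_integrable hf hg) (ip_integrable hf' hg)]
  congr 1; ext x; ring

lemma ip_add_right {f f' g : E3 → ℂ} (hf : L2 f) (hf' : L2 f') (hg : L2 g) :
    ip g (fun x => f x + f' x) = ip g f + ip g f' := by
  rw [← ip_conj, ip_add_left hf hf' hg, map_add, ip_conj, ip_conj]

lemma ip_sub_right {f f' g : E3 → ℂ} (hf : L2 f) (hf' : L2 f') (hg : L2 g) :
    ip g (fun x => f x - f' x) = ip g f - ip g f' := by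
  rw [← ip_conj, ip_sub_left hf hf' hg, map_sub, ip_conj, ip_conj]

lemma ip_sum_left {ι : Type*} (s : Finset ι) {f : ι → E3 → ℂ} {g : E3 → ℂ}
    (hf : ∀ i, L2 (f i)) (hg : L2 g) :
    ip (fun x => ∑ i ∈ s, f i x) g = ∑ i ∈ s, ip (f i) g := by
  simp only [ip]
  rw [← integral_finsetSum s (fun i _ => ip_integrable (hf i) hg)]
  congr 1; ext x; rw [Finset.sum_mul]

lemma ip_smul_left (c : ℂ) (f g : E3 → ℂ) : ip (fun x => c * f x) g = c * ip f g := by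
  rw [ip, ip, ← integral_const_mul]
  congr 1; ext x; ring

lemma ip_real_mul (a : E3 → ℝ) (f g : E3 → ℂ) :
    ip (fun x => (a x : ℂ) * f x) g = ip f (fun x => (a x : ℂ) * g x) := by
  rw [ip, ip]
  congr 1; ext x; rw [map_mul, Complex.conj_ofReal]; ring

lemma nn_add_le {f g : E3 → ℂ} (hf : L2 f) (hg : L2 g) :
    nn (fun x => f x + g x) ≤ nn f + nn g := by
  have : L2 (fun x => f x + g x) := hf.add hg
  rw [nn_eq_norm this, nn_eq_norm hf, nn_eq_norm hg]
  exact norm_add_le (hf.toLp f) (hg.toLp g)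

lemma nn_sub_le {f g : E3 → ℂ} (hf : L2 f) (hg : L2 g) :
    nn (fun x => f x - g x) ≤ nn f + nn g := by
  have : L2 (fun x => f x - g x) := hf.sub hg
  rw [nn_eq_norm this, nn_eq_norm hf, nn_eq_norm hg]
  exact norm_sub_le (hf.toLp f) (hg.toLp g)

lemma nn_sum_le {ι : Type*} (s : Finset ι) {f : ι → E3 → ℂ} (hf : ∀ i, L2 (f i)) :
    nn (fun x => ∑ i ∈ s, f i x) ≤ ∑ i ∈ s, nn (f i) := by
  classical
  induction s using Finset.induction_on with
  | empty => simp [nn]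
  | insert a s ha ih =>
    simp only [Finset.sum_insert ha]
    exact (nn_add_le (hf a) (memLp_finsetSum s fun i _ => hf i)).trans (by gcongr)

/-- Square integrability of `g` cannot be dropped: `nn g` takes the default value `0` when the norm
is infinite. -/
lemma nn_le_of_le {f g : E3 → ℂ} {C : ℝ} (hC : 0 ≤ C) (hg : L2 g)
    (h : ∀ᵐ x, ‖f x‖ ≤ C * ‖g x‖) : nn f ≤ C * nn g := by
  have := eLpNorm_le_mul_eLpNorm_of_ae_le_mul h 2
  rw [nn, nn, ← ENNReal.toReal_ofReal hC, ← ENNReal.toReal_mul]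
  exact ENNReal.toReal_mono (ENNReal.mul_ne_top ENNReal.ofReal_ne_top hg.2.ne) this

lemma nn_smul (c : ℂ) {f : E3 → ℂ} : nn (fun x => c * f x) = ‖c‖ * nn f := by
  have := eLpNorm_const_smul (μ := (volume : Measure E3)) c f 2
  rw [nn, nn, show (fun x => c * f x) = c • f from rfl, this, ENNReal.toReal_mul]
  simp

lemma nn_sub_comm (f g : E3 → ℂ) : nn (fun x => f x - g x) = nn (fun x => g x - f x) := by
  have := nn_smul (-1) (f := fun x => f x - g x)
  simpa using this.symm

/-- Multiplication by a bounded measurable function preserves `L²`. -/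
lemma L2.bdd_mul {f : E3 → ℂ} {a : E3 → ℂ} {C : ℝ} (hf : L2 f)
    (ha : AEStronglyMeasurable a volume) (h : ∀ x, ‖a x‖ ≤ C) : L2 (fun x => a x * f x) := by
  refine MemLp.of_le_mul (c := C) hf (ha.mul hf.1) (Eventually.of_forall fun x => ?_)
  rw [norm_mul]
  exact mul_le_mul_of_nonneg_right (h x) (norm_nonneg _)

lemma nn_bdd_mul_le {f : E3 → ℂ} {a : E3 → ℂ} {C : ℝ} (hf : L2 f) (h : ∀ x, ‖a x‖ ≤ C) :
    nn (fun x => a x * f x) ≤ C * nn f := by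
  have hC : 0 ≤ C := (norm_nonneg _).trans (h 0)
  refine nn_le_of_le hC hf (Eventually.of_forall fun x => ?_)
  rw [norm_mul]
  exact mul_le_mul_of_nonneg_right (h x) (norm_nonneg _)

/-- Convergence in `L²`, for functions. -/
def L2Tendsto {ι : Type*} (f : ι → E3 → ℂ) (l : Filter ι) (g : E3 → ℂ) : Prop :=
  Tendsto (fun i => nn (fun x => f i x - g x)) l (𝓝 0)

section
variable {ι : Type*} {l : Filter ι}

lemma L2Tendsto.congr {f f' : ι → E3 → ℂ} {g g' : E3 → ℂ} (h : L2Tendsto f l g)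
    (hf : ∀ᶠ i in l, f i =ᵐ[volume] f' i) (hg : g =ᵐ[volume] g') : L2Tendsto f' l g' := by
  refine Tendsto.congr' ?_ h
  filter_upwards [hf] with i hi
  apply nn_congr
  filter_upwards [hi, hg] with x h1 h2
  rw [h1, h2]

lemma L2Tendsto.of_le {f : ι → E3 → ℂ} {g : E3 → ℂ} {u : ι → ℝ} (hu : Tendsto u l (𝓝 0))
    (h : ∀ᶠ i in l, nn (fun x => f i x - g x) ≤ u i) : L2Tendsto f l g :=
  tendsto_of_tendsto_of_tendsto_of_le_of_le' tendsto_const_nhds hu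
    (Eventually.of_forall fun _ => nn_nonneg _) h

lemma L2Tendsto.add {f f' : ι → E3 → ℂ} {g g' : E3 → ℂ} (h : L2Tendsto f l g)
    (h' : L2Tendsto f' l g') (hf : ∀ i, L2 (f i)) (hf' : ∀ i, L2 (f' i)) (hg : L2 g)
    (hg' : L2 g') : L2Tendsto (fun i x => f i x + f' i x) l (fun x => g x + g' x) := by
  have hu := Tendsto.add h h'
  rw [add_zero] at hu
  refine L2Tendsto.of_le hu (Eventually.of_forall fun i => ?_)
  refine le_trans (le_of_eq ?_) (nn_add_le ((hf i).sub hg) ((hf' i).sub hg'))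
  exact congrArg nn (by ext x; ring)

lemma L2Tendsto.sum {κ : Type*} (s : Finset κ) {f : κ → ι → E3 → ℂ} {g : κ → E3 → ℂ}
    (h : ∀ k, L2Tendsto (f k) l (g k)) (hf : ∀ k i, L2 (f k i)) (hg : ∀ k, L2 (g k)) :
    L2Tendsto (fun i x => ∑ k ∈ s, f k i x) l (fun x => ∑ k ∈ s, g k x) := by
  have hu := tendsto_finsetSum s (fun k _ => h k)
  rw [Finset.sum_const_zero] at hu
  refine L2Tendsto.of_le hu (Eventually.of_forall fun i => ?_)
  simp only [← Finset.sum_sub_distrib]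
  exact nn_sum_le s (fun k => (hf k i).sub (hg k))

lemma L2Tendsto.bdd_mul {f : ι → E3 → ℂ} {g : E3 → ℂ} {a : E3 → ℂ} {C : ℝ} (h : L2Tendsto f l g)
    (hf : ∀ i, L2 (f i)) (hg : L2 g) (ha : ∀ x, ‖a x‖ ≤ C) :
    L2Tendsto (fun i x => a x * f i x) l (fun x => a x * g x) := by
  have hu := Tendsto.const_mul C h
  rw [mul_zero] at hu
  refine L2Tendsto.of_le hu (Eventually.of_forall fun i => ?_)
  refine le_trans (le_of_eq ?_) (nn_bdd_mul_le ((hf i).sub hg) ha)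
  exact congrArg nn (by ext x; ring)

lemma L2Tendsto.nn_bdd {f : ι → E3 → ℂ} {g : E3 → ℂ} (h : L2Tendsto f l g)
    (hf : ∀ i, L2 (f i)) (hg : L2 g) : ∀ᶠ i in l, nn (f i) ≤ nn g + 1 := by
  have := h.eventually (gt_mem_nhds zero_lt_one)
  filter_upwards [this] with i hi
  have h2 := nn_add_le ((hf i).sub hg) hg
  simp only [sub_add_cancel] at h2
  change nn (f i) ≤ _ at h2
  linarith

lemma L2Tendsto.ip {f f' : ι → E3 → ℂ} {g g' : E3 → ℂ} (h : L2Tendsto f l g)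
    (h' : L2Tendsto f' l g') (hf : ∀ i, L2 (f i)) (hf' : ∀ i, L2 (f' i)) (hg : L2 g)
    (hg' : L2 g') : Tendsto (fun i => ip (f i) (f' i)) l (𝓝 (ip g g')) := by
  rw [tendsto_iff_norm_sub_tendsto_zero]
  have hu : Tendsto (fun i => nn (fun x => f i x - g x) * (nn g' + 1)
      + nn g * nn (fun x => f' i x - g' x)) l (𝓝 0) := by
    have := (Tendsto.mul_const (nn g' + 1) h).add (Tendsto.const_mul (nn g) h')
    simpa using this
  refine tendsto_of_tendsto_of_tendsto_of_le_of_le' tendsto_const_nhds hu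
    (Eventually.of_forall fun _ => norm_nonneg _) ?_
  filter_upwards [h'.nn_bdd hf' hg'] with i hi
  have e : NLSGamma.ip (f i) (f' i) - NLSGamma.ip g g'
      = NLSGamma.ip (fun x => f i x - g x) (f' i) + NLSGamma.ip g (fun x => f' i x - g' x) := by
    rw [ip_sub_left (hf i) hg (hf' i), ip_sub_right (hf' i) hg' hg]; ring
  rw [e]
  refine (norm_add_le _ _).trans (add_le_add ?_ ?_)
  · exact (norm_ip_le ((hf i).sub hg) (hf' i)).trans
      (mul_le_mul_of_nonneg_left hi (nn_nonneg _))
  · exact norm_ip_le hg ((hf' i).sub hg')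

lemma L2Tendsto.const {g : E3 → ℂ} : L2Tendsto (fun _ : ι => g) l g := by
  simp [L2Tendsto, nn, tendsto_const_nhds]

/-- Dominated convergence for multipliers. -/
lemma L2Tendsto.of_multiplier [l.IsCountablyGenerated] {a : ι → E3 → ℂ} {b f : E3 → ℂ} {C : ℝ}
    (hf : L2 f) (ha : ∀ i, AEStronglyMeasurable (a i) volume) (hC : ∀ i x, ‖a i x‖ ≤ C)
    (hl : ∀ x, Tendsto (fun i => a i x) l (𝓝 (b x))) :
    L2Tendsto (fun i x => a i x * f x) l (fun x => b x * f x) := by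
  rcases l.eq_or_neBot with rfl | hne
  · exact tendsto_bot
  have hbC : ∀ x, ‖b x‖ ≤ C := fun x =>
    le_of_tendsto (hl x).norm (Eventually.of_forall fun i => hC i x)
  have hbm : AEStronglyMeasurable b volume :=
    aestronglyMeasurable_of_tendsto_ae l ha (Eventually.of_forall hl)
  have hm : ∀ i, L2 (fun x => a i x * f x - b x * f x) := fun i =>
    (L2.bdd_mul hf (ha i) (hC i)).sub (L2.bdd_mul hf hbm hbC)
  have hI : Tendsto (fun i => ∫ x, ‖a i x * f x - b x * f x‖ ^ 2) l (𝓝 (∫ _ : E3, (0 : ℝ))) := by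
    refine tendsto_integral_filter_of_dominated_convergence (fun x => (2 * C) ^ 2 * ‖f x‖ ^ 2)
      (Eventually.of_forall fun i => ((hm i).1.norm.pow 2)) ?_ ?_ ?_
    · refine Eventually.of_forall fun i => Eventually.of_forall fun x => ?_
      rw [← sub_mul, norm_mul, norm_pow, norm_mul, norm_norm, norm_norm, mul_pow]
      gcongr
      linarith [norm_sub_le (a i x) (b x), hC i x, hbC x]
    · exact ((memLp_two_iff_integrable_sq_norm hf.1).1 hf).const_mul _
    · refine Eventually.of_forall fun x => ?_
      have := ((((hl x).mul_const (f x)).sub_const (b x * f x)).norm).pow 2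
      simpa using this
  rw [integral_zero] at hI
  have := (Real.continuous_sqrt.tendsto 0).comp hI
  rw [Real.sqrt_zero] at this
  refine this.congr fun i => ?_
  rw [Function.comp_apply, ← nn_sq (hm i), Real.sqrt_sq (nn_nonneg _)]

end

/-! ### Calculus of partial derivatives and test functions -/

section Partial
variable {V : Type*} [NormedAddCommGroup V] [NormedSpace ℝ V]

lemma contDiff_partialDeriv {f : E3 → V} (hf : ContDiff ℝ ∞ f) (j : Fin 3) :
    ContDiff ℝ ∞ (partialDeriv j f) :=
  (hf.fderiv_right (m := ∞) (by simp)).clm_apply contDiff_const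

lemma partialDeriv_mul {f g : E3 → ℂ} {x : E3} (hf : DifferentiableAt ℝ f x)
    (hg : DifferentiableAt ℝ g x) (j : Fin 3) :
    partialDeriv j (fun y => f y * g y) x = partialDeriv j f x * g x + f x * partialDeriv j g x := by
  have := hf.hasFDerivAt.mul hg.hasFDerivAt
  simp only [partialDeriv]
  rw [HasFDerivAt.fderiv (f := fun y => f y * g y) this]
  simp; ring

lemma partialDeriv_mul_real {f g : E3 → ℝ} {x : E3} (hf : DifferentiableAt ℝ f x)
    (hg : DifferentiableAt ℝ g x) (j : Fin 3) :
    partialDeriv j (fun y => f y * g y) x = partialDeriv j f x * g x + f x * partialDeriv j g x := by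
  have := hf.hasFDerivAt.mul hg.hasFDerivAt
  simp only [partialDeriv]
  rw [HasFDerivAt.fderiv (f := fun y => f y * g y) this]
  simp; ring

lemma partialDeriv_add {f g : E3 → V} {x : E3} (hf : DifferentiableAt ℝ f x)
    (hg : DifferentiableAt ℝ g x) (j : Fin 3) :
    partialDeriv j (fun y => f y + g y) x = partialDeriv j f x + partialDeriv j g x := by
  simp only [partialDeriv]
  rw [HasFDerivAt.fderiv (f := fun y => f y + g y) (hf.hasFDerivAt.add hg.hasFDerivAt)]
  simp

lemma partialDeriv_sum {ι : Type*} (s : Finset ι) {f : ι → E3 → V} {x : E3}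
    (hf : ∀ i, DifferentiableAt ℝ (f i) x) (j : Fin 3) :
    partialDeriv j (fun y => ∑ i ∈ s, f i y) x = ∑ i ∈ s, partialDeriv j (f i) x := by
  simp only [partialDeriv]
  rw [fderiv_fun_sum (fun i _ => hf i)]
  simp

lemma partialDeriv_conj {f : E3 → ℂ} {x : E3} (hf : DifferentiableAt ℝ f x) (j : Fin 3) :
    partialDeriv j (fun y => (starRingEnd ℂ) (f y)) x = (starRingEnd ℂ) (partialDeriv j f x) := by
  have := (Complex.conjCLE : ℂ →L[ℝ] ℂ).hasFDerivAt.comp x hf.hasFDerivAt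
  simp only [partialDeriv]
  rw [HasFDerivAt.fderiv (f := fun y => (starRingEnd ℂ) (f y)) this]
  rfl

lemma partialDeriv_ofReal {f : E3 → ℝ} {x : E3} (hf : DifferentiableAt ℝ f x) (j : Fin 3) :
    partialDeriv j (fun y => (f y : ℂ)) x = ((partialDeriv j f x : ℝ) : ℂ) := by
  have := Complex.ofRealCLM.hasFDerivAt.comp x hf.hasFDerivAt
  simp only [partialDeriv]
  rw [HasFDerivAt.fderiv (f := fun y => (f y : ℂ)) this]
  rfl

lemma partialDeriv_comp_real {f : E3 → ℝ} {G : ℝ → ℝ} {x : E3} (hG : DifferentiableAt ℝ G (f x))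
    (hf : DifferentiableAt ℝ f x) (j : Fin 3) :
    partialDeriv j (fun y => G (f y)) x = deriv G (f x) * partialDeriv j f x := by
  have := hG.hasDerivAt.comp_hasFDerivAt x hf.hasFDerivAt
  simp only [partialDeriv]
  rw [HasFDerivAt.fderiv (f := fun y => G (f y)) this]
  simp

lemma partialDeriv_congr {f g : E3 → V} {x : E3} (h : f =ᶠ[𝓝 x] g) (j : Fin 3) :
    partialDeriv j f x = partialDeriv j g x := by
  simp only [partialDeriv, h.fderiv_eq]

lemma partialDeriv_const_mul (c : ℂ) {f : E3 → ℂ} {x : E3} (hf : DifferentiableAt ℝ f x)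
    (j : Fin 3) : partialDeriv j (fun y => c * f y) x = c * partialDeriv j f x := by
  simp only [partialDeriv]
  rw [fderiv_const_mul hf]
  simp

lemma partialDeriv_sub {f g : E3 → V} {x : E3} (hf : DifferentiableAt ℝ f x)
    (hg : DifferentiableAt ℝ g x) (j : Fin 3) :
    partialDeriv j (fun y => f y - g y) x = partialDeriv j f x - partialDeriv j g x := by
  simp only [partialDeriv]
  rw [HasFDerivAt.fderiv (f := fun y => f y - g y) (hf.hasFDerivAt.sub hg.hasFDerivAt)]
  simp

/-- The Laplacian is the sum of the second partial derivatives. -/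
lemma laplacian_eq_sum {f : E3 → ℂ} (hf : ContDiff ℝ ∞ f) (x : E3) :
    Laplacian.laplacian f x = ∑ j, partialDeriv j (partialDeriv j f) x := by
  have h := InnerProductSpace.laplacian_eq_iteratedFDeriv_orthonormalBasis f
    (EuclideanSpace.basisFun (Fin 3) ℝ)
  rw [h]
  refine Finset.sum_congr rfl fun j _ => ?_
  rw [iteratedFDeriv_two_apply]
  simp only [partialDeriv, EuclideanSpace.basisFun_apply, Matrix.cons_val_zero,
    Matrix.cons_val_one]
  have hd : DifferentiableAt ℝ (fderiv ℝ f) x :=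
    ((hf.fderiv_right (m := ∞) (by simp)).differentiable (by simp)) x
  change _ = fderiv ℝ (fun y => fderiv ℝ f y (EuclideanSpace.single j 1)) x
    (EuclideanSpace.single j 1)
  rw [fderiv_clm_apply hd (differentiableAt_const _)]
  simp

end Partial

/-! ### Test functions and weak derivatives. -/

lemma IsTest.continuous {η : E3 → ℂ} (h : IsTest η) : Continuous η := h.1.continuous

lemma IsTest.differentiable {η : E3 → ℂ} (h : IsTest η) : Differentiable ℝ η :=
  h.1.differentiable (by simp)

lemma IsTest.memLp {η : E3 → ℂ} (h : IsTest η) : L2 η := h.continuous.memLp_of_hasCompactSupport h.2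

lemma IsTest.integrable {η : E3 → ℂ} (h : IsTest η) : Integrable η :=
  h.continuous.integrable_of_hasCompactSupport h.2

lemma IsTest.partialDeriv {η : E3 → ℂ} (h : IsTest η) (j : Fin 3) :
    IsTest (NLSGamma.partialDeriv j η) := by
  refine ⟨contDiff_partialDeriv h.1 j, ?_⟩
  exact (h.2.fderiv ℝ).comp_left (g := fun L : E3 →L[ℝ] ℂ => L (EuclideanSpace.single j 1)) (by simp)

lemma IsTest.conj {η : E3 → ℂ} (h : IsTest η) : IsTest (fun x => (starRingEnd ℂ) (η x)) :=
  ⟨(Complex.conjCLE : ℂ →L[ℝ] ℂ).contDiff.comp h.1, h.2.comp_left (g := starRingEnd ℂ) (by simp)⟩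

lemma IsTest.mul_left {η a : E3 → ℂ} (h : IsTest η) (ha : ContDiff ℝ ∞ a) :
    IsTest (fun x => a x * η x) := ⟨ha.mul h.1, h.2.mul_left⟩

lemma IsTest.add {η a : E3 → ℂ} (h : IsTest η) (ha : IsTest a) :
    IsTest (fun x => η x + a x) := ⟨h.1.add ha.1, h.2.add ha.2⟩

lemma IsTest.sum {ι : Type*} (s : Finset ι) {η : ι → E3 → ℂ} (h : ∀ i, IsTest (η i)) :
    IsTest (fun x => ∑ i ∈ s, η i x) := by
  classical
  induction s using Finset.induction_on with
  | empty =>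
    simp only [Finset.sum_empty]
    exact ⟨contDiff_const, HasCompactSupport.zero⟩
  | insert a s ha ih => simp only [Finset.sum_insert ha]; exact (h a).add ih

lemma IsTest.sub {η a : E3 → ℂ} (h : IsTest η) (ha : IsTest a) :
    IsTest (fun x => η x - a x) := ⟨h.1.sub ha.1, by
      have := h.2.add (ha.2.neg)
      simpa [sub_eq_add_neg, Pi.add_def, Pi.neg_def] using this⟩

lemma IsTest.hasWeakPartial {η : E3 → ℂ} (h : IsTest η) (j : Fin 3) :
    HasWeakPartial j η (NLSGamma.partialDeriv j η) := by
  refine ⟨h.continuous.locallyIntegrable, (h.partialDeriv j).continuous.locallyIntegrable,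
    fun θ hθ => ?_⟩
  exact integral_mul_fderiv_eq_neg_fderiv_mul_of_integrable
    (hθ.mul_left (h.partialDeriv j).1).integrable
    ((hθ.partialDeriv j).mul_left h.1).integrable (hθ.mul_left h.1).integrable
    (fun x _ => h.differentiable x) (fun x _ => hθ.differentiable x)

/-- The integral of a derivative of a compactly supported function vanishes. -/
lemma integral_partialDeriv_eq_zero {f : E3 → ℝ} (hf : ContDiff ℝ ∞ f) (hc : HasCompactSupport f)
    (j : Fin 3) : ∫ x, partialDeriv j f x = 0 := by
  have hpc : HasCompactSupport (partialDeriv j f) :=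
    (hc.fderiv ℝ).comp_left (g := fun L : E3 →L[ℝ] ℝ => L (EuclideanSpace.single j 1)) (by simp)
  have h1 : Integrable (fun x => (1 : ℝ) * partialDeriv j f x) := by
    simpa using (contDiff_partialDeriv hf j).continuous.integrable_of_hasCompactSupport hpc
  have := integral_mul_fderiv_eq_neg_fderiv_mul_of_integrable (μ := (volume : Measure E3))
    (f := fun _ => (1 : ℝ)) (g := f) (v := EuclideanSpace.single j 1) (by simp) h1
    (by simpa using hf.continuous.integrable_of_hasCompactSupport hc) (by simp)
    (fun x _ => hf.differentiable (by simp) x)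
  simp only [one_mul, fderiv_fun_const, Pi.zero_apply, zero_apply, zero_mul,
    integral_zero, neg_zero] at this
  exact this

/-- The fundamental lemma of the calculus of variations. Real test functions are enough, and they
are complex test functions after coercion. -/
lemma weakPartial_unique {j : Fin 3} {u v v' : E3 → ℂ} (h : HasWeakPartial j u v)
    (h' : HasWeakPartial j u v') : v =ᵐ[volume] v' := by
  refine ae_eq_of_integral_contDiff_smul_eq h.2.1 h'.2.1 fun g hg hgc => ?_
  have ht : IsTest (fun x => (g x : ℂ)) :=
    ⟨Complex.ofRealCLM.contDiff.comp hg, hgc.comp_left (g := Complex.ofReal) (by simp)⟩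
  have e := (h.2.2 _ ht).symm.trans (h'.2.2 _ ht)
  simpa [mul_comm, Complex.real_smul] using e

lemma weakPartial_spec {j : Fin 3} {u v : E3 → ℂ} (h : HasWeakPartial j u v) :
    HasWeakPartial j u (weakPartial j u) := by
  have hex : ∃ v, HasWeakPartial j u v := ⟨v, h⟩
  rw [weakPartial, dif_pos hex]
  exact hex.choose_spec

lemma weakPartial_ae_eq {j : Fin 3} {u v : E3 → ℂ} (h : HasWeakPartial j u v) :
    weakPartial j u =ᵐ[volume] v :=
  weakPartial_unique (weakPartial_spec h) h

lemma L2.locallyIntegrable {f : E3 → ℂ} (hf : L2 f) : LocallyIntegrable f :=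
  MemLp.locallyIntegrable hf (by norm_num)

/-- The weak derivative in terms of the `L²` pairing. -/
lemma HasWeakPartial.ip_eq {j : Fin 3} {u v η : E3 → ℂ} (h : HasWeakPartial j u v)
    (hη : IsTest η) : ip u (NLSGamma.partialDeriv j η) = - ip v η := by
  have := h.2.2 _ hη.conj
  rw [ip, ip, ← this]
  congr 1; ext x
  rw [partialDeriv_conj (hη.differentiable x)]

/-! ### Mollification -/

/-- Convolution of a function with a kernel. -/
def conv (f k : E3 → ℂ) : E3 → ℂ :=
  convolution f k (ContinuousLinearMap.mul ℝ ℂ) volume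

lemma conv_apply (f k : E3 → ℂ) (x : E3) : conv f k x = ∫ t, f t * k (x - t) := rfl

lemma contDiff_conv {f k : E3 → ℂ} (hf : LocallyIntegrable f) (hk : IsTest k) :
    ContDiff ℝ ∞ (conv f k) :=
  hk.2.contDiff_convolution_right (n := ⊤) _ hf hk.1

lemma conv_exists {f k : E3 → ℂ} (hf : LocallyIntegrable f) (hk : IsTest k) (x : E3) :
    Integrable (fun t => f t * k (x - t)) :=
  hk.2.convolutionExists_right (ContinuousLinearMap.mul ℝ ℂ) hf hk.continuous x

lemma conv_sub {f g k : E3 → ℂ} (hf : LocallyIntegrable f) (hg : LocallyIntegrable g)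
    (hk : IsTest k) (x : E3) : conv (fun y => f y - g y) k x = conv f k x - conv g k x := by
  rw [conv_apply, conv_apply, conv_apply, ← integral_sub (conv_exists hf hk x)
    (conv_exists hg hk x)]
  congr 1; ext t; ring

lemma partialDeriv_conv {f k : E3 → ℂ} (hf : LocallyIntegrable f) (hk : IsTest k) (j : Fin 3)
    (x : E3) : partialDeriv j (conv f k) x = conv f (partialDeriv j k) x := by
  have h := hk.2.hasFDerivAt_convolution_right (ContinuousLinearMap.mul ℝ ℂ) hf
    (hk.1.of_le (by simp)) x
  rw [partialDeriv, conv, h.fderiv]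
  exact convolution_precompR_apply (ContinuousLinearMap.mul ℝ ℂ) hf (hk.2.fderiv ℝ)
    (hk.1.continuous_fderiv (by simp)) x _

lemma IsTest.comp_sub {k : E3 → ℂ} (hk : IsTest k) (x : E3) : IsTest (fun t => k (x - t)) := by
  refine ⟨hk.1.comp (contDiff_const.sub contDiff_id), ?_⟩
  exact hk.2.comp_homeomorph (Homeomorph.subLeft x)

lemma partialDeriv_comp_sub {k : E3 → ℂ} (hk : IsTest k) (j : Fin 3) (x t : E3) :
    partialDeriv j (fun t => k (x - t)) t = - partialDeriv j k (x - t) := by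
  have := (hk.differentiable (x - t)).hasFDerivAt.comp t ((hasFDerivAt_id t).const_sub x)
  rw [partialDeriv, HasFDerivAt.fderiv (f := fun t => k (x - t)) this]
  simp [partialDeriv]

/-- Mollification commutes with weak derivatives. -/
lemma partialDeriv_conv_of_weak {f v k : E3 → ℂ} {j : Fin 3} (h : HasWeakPartial j f v)
    (hk : IsTest k) (x : E3) : partialDeriv j (conv f k) x = conv v k x := by
  rw [partialDeriv_conv h.1 hk, conv_apply, conv_apply]
  have := h.2.2 _ (hk.comp_sub x)
  simp only [partialDeriv_comp_sub hk, mul_neg, integral_neg, neg_inj] at this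
  exact this

lemma integrable_norm_sq {f : E3 → ℂ} (hf : L2 f) : Integrable (fun x => ‖f x‖ ^ 2) :=
  (memLp_two_iff_integrable_sq_norm hf.1).1 hf

/-- **Young's inequality**, pointwise form. -/
lemma conv_norm_sq_le {f k : E3 → ℂ} (hf : L2 f) (hk : IsTest k) (x : E3) :
    (∫ t, ‖f t‖ * ‖k (x - t)‖) ^ 2 ≤ (∫ t, ‖k t‖) * ∫ t, ‖f t‖ ^ 2 * ‖k (x - t)‖ := by
  have hcs : Continuous (fun t : E3 => √ ‖k (x - t)‖) := by
    have := hk.continuous; fun_prop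
  obtain ⟨M, hM⟩ := hk.continuous.bounded_above_of_compact_support hk.2
  -- Cauchy–Schwarz is applied to the splitting of `|f| |k|` as `(√|k| |f|) · √|k|`, so that one
  -- factor integrates to the `L¹` norm of the kernel.
  have hF : L2 (fun t => ((√ ‖k (x - t)‖ : ℝ) : ℂ) * ((‖f t‖ : ℝ) : ℂ)) := by
    refine L2.bdd_mul (C := √ M) ?_ (Complex.continuous_ofReal.comp hcs).aestronglyMeasurable fun t => ?_
    · refine hf.of_le ?_ (Eventually.of_forall fun x => by simp)
      exact (Complex.continuous_ofReal.comp_aestronglyMeasurable hf.1.norm)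
    · simp only [Complex.norm_real, Real.norm_eq_abs, abs_of_nonneg (Real.sqrt_nonneg _)]
      exact Real.sqrt_le_sqrt (hM _)
  have hG : L2 (fun t => ((√ ‖k (x - t)‖ : ℝ) : ℂ)) := by
    refine Continuous.memLp_of_hasCompactSupport (by fun_prop) ?_
    exact (hk.comp_sub x).2.comp_left (g := fun z : ℂ => ((√ ‖z‖ : ℝ) : ℂ)) (by simp)
  have h := norm_ip_le hF hG
  have e : ip (fun t => ((√ ‖k (x - t)‖ : ℝ) : ℂ) * ((‖f t‖ : ℝ) : ℂ))
      (fun t => ((√ ‖k (x - t)‖ : ℝ) : ℂ)) = ((∫ t, ‖f t‖ * ‖k (x - t)‖ : ℝ) : ℂ) := by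
    rw [ip, ← integral_complex_ofReal]
    congr 1; ext t
    rw [Complex.conj_ofReal]
    norm_cast
    rw [mul_right_comm, Real.mul_self_sqrt (norm_nonneg _), mul_comm]
  have h0 : 0 ≤ ∫ t, ‖f t‖ * ‖k (x - t)‖ := integral_nonneg fun t => by positivity
  rw [e, Complex.norm_real, Real.norm_of_nonneg h0] at h
  have h2 := pow_le_pow_left₀ h0 h 2
  rw [mul_pow, nn_sq hF, nn_sq hG] at h2
  refine h2.trans (le_of_eq ?_)
  rw [mul_comm]
  congr 1
  · rw [← integral_sub_left_eq_self (fun t => ‖k t‖) volume x]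
    congr 1; ext t
    rw [Complex.norm_real, Real.norm_of_nonneg (Real.sqrt_nonneg _), Real.sq_sqrt (norm_nonneg _)]
  · congr 1; ext t
    rw [norm_mul, Complex.norm_real, Real.norm_of_nonneg (Real.sqrt_nonneg _), mul_pow,
      Real.sq_sqrt (norm_nonneg _), Complex.norm_real, norm_norm, mul_comm]

/-- The inner integral is the convolution of the two `L¹` functions `|f|²` and `|k|`, so Fubini
applies. -/
lemma integrable_conv_norm_sq {f k : E3 → ℂ} (hf : L2 f) (hk : IsTest k) :
    Integrable (fun x => ∫ t, ‖f t‖ ^ 2 * ‖k (x - t)‖) ∧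
    ∫ x, ∫ t, ‖f t‖ ^ 2 * ‖k (x - t)‖ = (∫ t, ‖f t‖ ^ 2) * ∫ t, ‖k t‖ := by
  have h1 := (integrable_norm_sq hf)
  have h2 := hk.integrable.norm
  constructor
  · exact h1.integrable_convolution (ContinuousLinearMap.mul ℝ ℝ) h2
  · exact integral_convolution (ContinuousLinearMap.mul ℝ ℝ) h1 h2

lemma L2_conv_norm {f k : E3 → ℂ} (hf : L2 f) (hk : IsTest k) :
    MemLp (fun x => ∫ t, ‖f t‖ * ‖k (x - t)‖) 2 ∧
      ∫ x, (∫ t, ‖f t‖ * ‖k (x - t)‖) ^ 2 ≤ ((∫ t, ‖k t‖) * nn f) ^ 2 := by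
  have hcont : Continuous (fun x => ∫ t, ‖f t‖ * ‖k (x - t)‖) :=
    hk.2.norm.continuous_convolution_right (ContinuousLinearMap.mul ℝ ℝ)
      ((MemLp.norm hf).locallyIntegrable (by norm_num)) hk.continuous.norm
  obtain ⟨hi, he⟩ := integrable_conv_norm_sq hf hk
  have hi2 : Integrable (fun x => (∫ t, ‖f t‖ * ‖k (x - t)‖) ^ 2) :=
    (hi.const_mul (∫ t, ‖k t‖)).mono' (hcont.pow 2).aestronglyMeasurable (Eventually.of_forall fun x => by
      rw [Real.norm_of_nonneg (sq_nonneg _)]; exact conv_norm_sq_le hf hk x)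
  refine ⟨(memLp_two_iff_integrable_sq hcont.aestronglyMeasurable).2 hi2, ?_⟩
  refine (integral_mono hi2 (hi.const_mul _) (conv_norm_sq_le hf hk)).trans (le_of_eq ?_)
  rw [integral_const_mul, he, ← nn_sq hf]; ring

lemma norm_conv_le (f k : E3 → ℂ) (x : E3) : ‖conv f k x‖ ≤ ∫ t, ‖f t‖ * ‖k (x - t)‖ := by
  rw [conv_apply]
  refine (norm_integral_le_integral_norm _).trans (le_of_eq ?_)
  simp only [norm_mul]

lemma L2_conv {f k : E3 → ℂ} (hf : L2 f) (hk : IsTest k) : L2 (conv f k) :=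
  (L2_conv_norm hf hk).1.of_le
    (contDiff_conv hf.locallyIntegrable hk).continuous.aestronglyMeasurable
    (Eventually.of_forall fun x => (norm_conv_le f k x).trans (le_abs_self _))

/-- **Young's inequality**. -/
lemma nn_conv_le {f k : E3 → ℂ} (hf : L2 f) (hk : IsTest k) :
    nn (conv f k) ≤ (∫ t, ‖k t‖) * nn f := by
  have h0 : 0 ≤ (∫ t, ‖k t‖) * nn f :=
    mul_nonneg (integral_nonneg fun t => norm_nonneg _) (nn_nonneg _)
  refine le_of_sq_le_sq ?_ h0
  rw [nn_sq (L2_conv hf hk)]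
  refine le_trans (integral_mono (integrable_norm_sq (L2_conv hf hk))
    (L2_conv_norm hf hk).1.integrable_sq fun x => ?_) (L2_conv_norm hf hk).2
  exact pow_le_pow_left₀ (norm_nonneg _) (norm_conv_le f k x) 2

/-- Convolution with an even real kernel is symmetric. -/
lemma ip_conv_comm {f g k : E3 → ℂ} (hf : L2 f) (hg : L2 g) (hk : IsTest k)
    (hsym : ∀ x, (starRingEnd ℂ) (k (-x)) = k x) : ip (conv f k) g = ip f (conv g k) := by
  have hmeas : AEStronglyMeasurable (Function.uncurry fun x t : E3 =>
      f t * k (x - t) * (starRingEnd ℂ) (g x)) (volume.prod volume) := by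
    refine AEStronglyMeasurable.mul (AEStronglyMeasurable.mul hf.1.comp_snd ?_) ?_
    · exact (hk.continuous.comp (continuous_fst.sub continuous_snd)).aestronglyMeasurable
    · exact Complex.continuous_conj.comp_aestronglyMeasurable hg.1.comp_fst
  have hint : Integrable (Function.uncurry fun x t : E3 =>
      f t * k (x - t) * (starRingEnd ℂ) (g x)) (volume.prod volume) := by
    rw [integrable_prod_iff hmeas]
    refine ⟨Eventually.of_forall fun x =>
      (conv_exists hf.locallyIntegrable hk x).mul_const ((starRingEnd ℂ) (g x)), ?_⟩
    have := (L2_conv_norm hf hk).1.integrable_mul (hg.norm)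
    refine this.congr (Eventually.of_forall fun x => ?_)
    simp only [Function.uncurry_apply_pair, norm_mul, RCLike.norm_conj, Pi.mul_apply]
    rw [integral_mul_const]
  have h1 : ip (conv f k) g = ∫ x, ∫ t, f t * k (x - t) * (starRingEnd ℂ) (g x) := by
    simp only [ip, conv_apply, integral_mul_const]
  have h2 : ip f (conv g k) = ∫ t, ∫ x, f t * k (x - t) * (starRingEnd ℂ) (g x) := by
    simp only [ip, conv_apply, ← integral_conj]
    congr 1; ext t
    rw [← integral_const_mul]
    congr 1; ext x
    have := hsym (x - t)
    rw [neg_sub] at this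
    rw [map_mul, this]; ring
  rw [h1, h2, integral_integral_swap hint]

lemma conv_eq_zero {f k : E3 → ℂ} {δ : ℝ} (hk : ∀ y, δ ≤ ‖y‖ → k y = 0) {x : E3}
    (hf : ∀ t, ‖x - t‖ < δ → f t = 0) : conv f k x = 0 := by
  rw [conv_apply]
  refine integral_eq_zero_of_ae (Eventually.of_forall fun t => ?_)
  rcases lt_or_ge ‖x - t‖ δ with h | h
  · simp [hf t h]
  · simp [hk _ h]

lemma IsTest.conv {f k : E3 → ℂ} (hf : LocallyIntegrable f) (hc : HasCompactSupport f)
    (hk : IsTest k) : IsTest (conv f k) :=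
  ⟨contDiff_conv hf hk, hc.convolution _ hk.2⟩

/-- A sequence of bump functions shrinking to the origin. -/
def bump (n : ℕ) : ContDiffBump (0 : E3) where
  rIn := 1 / (2 * (n + 1))
  rOut := 1 / (n + 1)
  rIn_pos := by positivity
  rIn_lt_rOut := by
    rw [div_lt_div_iff₀ (by positivity) (by positivity)]
    have : (0 : ℝ) ≤ n := Nat.cast_nonneg n
    linarith

/-- The mollifying kernels. -/
def kappa (n : ℕ) (x : E3) : ℂ := ((bump n).normed volume x : ℂ)

lemma isTest_kappa (n : ℕ) : IsTest (kappa n) :=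
  ⟨Complex.ofRealCLM.contDiff.comp (bump n).contDiff_normed,
    (bump n).hasCompactSupport_normed.comp_left (g := Complex.ofReal) (by simp)⟩

lemma kappa_symm (n : ℕ) (x : E3) : (starRingEnd ℂ) (kappa n (-x)) = kappa n x := by
  rw [kappa, kappa, (bump n).normed_neg, Complex.conj_ofReal]

lemma integral_norm_kappa (n : ℕ) : ∫ x, ‖kappa n x‖ = 1 := by
  rw [← (bump n).integral_normed (μ := volume)]
  congr 1; ext x
  rw [kappa, Complex.norm_real, Real.norm_of_nonneg ((bump n).nonneg_normed x)]

lemma kappa_eq_zero (n : ℕ) (y : E3) (hy : 1 / ((n : ℝ) + 1) ≤ ‖y‖) : kappa n y = 0 := by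
  have h : y ∉ Function.support ((bump n).normed volume) := by
    rw [(bump n).support_normed_eq, Metric.mem_ball, dist_zero_right]
    exact not_lt.2 hy
  rw [kappa, Function.notMem_support.1 h, Complex.ofReal_zero]

/-- The `n`-th mollification. -/
def moll (n : ℕ) (f : E3 → ℂ) : E3 → ℂ := conv f (kappa n)

lemma L2_moll (n : ℕ) {f : E3 → ℂ} (hf : L2 f) : L2 (moll n f) := L2_conv hf (isTest_kappa n)

lemma nn_moll_le (n : ℕ) {f : E3 → ℂ} (hf : L2 f) : nn (moll n f) ≤ nn f := by
  have := nn_conv_le hf (isTest_kappa n)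
  rwa [integral_norm_kappa, one_mul] at this

lemma ip_moll (n : ℕ) {f g : E3 → ℂ} (hf : L2 f) (hg : L2 g) : ip (moll n f) g = ip f (moll n g) :=
  ip_conv_comm hf hg (isTest_kappa n) (kappa_symm n)

lemma moll_sub (n : ℕ) {f g : E3 → ℂ} (hf : L2 f) (hg : L2 g) (x : E3) :
    moll n (fun y => f y - g y) x = moll n f x - moll n g x :=
  conv_sub hf.locallyIntegrable hg.locallyIntegrable (isTest_kappa n) x

/-- Uniform continuity gives uniform convergence. All kernels have radius at most one, so every
mollification is supported in one compact set `K` of finite measure, and there uniform convergence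
implies `L²` convergence. -/
lemma L2Tendsto_moll_of_continuous {g : E3 → ℂ} (hg : Continuous g) (hc : HasCompactSupport g) :
    L2Tendsto (fun n => moll n g) atTop g := by
  have hu : UniformContinuous g := hc.uniformContinuous_of_continuous hg
  set K := Metric.cthickening 1 (tsupport g) with hK
  have hKc : IsCompact K := hc.isCompact.cthickening
  have h1 : L2 (K.indicator fun _ => (1 : ℂ)) :=
    memLp_indicator_const 2 hKc.measurableSet 1 (Or.inr hKc.measure_lt_top.ne)
  rw [L2Tendsto, Metric.tendsto_atTop]
  intro ε hε
  set M := nn (K.indicator fun _ => (1 : ℂ)) with hM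
  have hM0 : 0 ≤ M := nn_nonneg _
  obtain ⟨δ, hδ, hd⟩ := Metric.uniformContinuous_iff.1 hu (ε / (2 * (M + 1))) (by positivity)
  obtain ⟨n₀, hn₀⟩ := exists_nat_one_div_lt hδ
  refine ⟨n₀, fun n hn => ?_⟩
  rw [Real.dist_eq, sub_zero, abs_of_nonneg (nn_nonneg _)]
  have hr : (bump n).rOut < δ := lt_of_le_of_lt (by
    change 1 / ((n : ℝ) + 1) ≤ 1 / ((n₀ : ℝ) + 1)
    gcongr) hn₀
  have hr1 : (bump n).rOut ≤ 1 := by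
    change 1 / ((n : ℝ) + 1) ≤ 1
    rw [div_le_one (by positivity)]
    linarith [(Nat.cast_nonneg n : (0 : ℝ) ≤ n)]
  have hb : ∀ x, ‖moll n g x - g x‖ ≤ ε / (2 * (M + 1)) := by
    intro x
    have h2 := (bump n).dist_normed_convolution_le (μ := volume) (g := g) (x₀ := x)
      (ε := ε / (2 * (M + 1))) hg.aestronglyMeasurable 
      (fun y hy => (hd ((Metric.mem_ball.1 hy).trans hr)).le)
    rw [dist_eq_norm] at h2
    have e : moll n g x
        = convolution ((bump n).normed volume) g (ContinuousLinearMap.lsmul ℝ ℝ) volume x := by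
      rw [convolution_lsmul_swap, moll, conv_apply]
      congr 1; ext t
      rw [kappa, Complex.real_smul, mul_comm]
    rwa [e]
  have hle : nn (fun x => moll n g x - g x) ≤ ε / (2 * (M + 1)) * M := by
    refine nn_le_of_le (by positivity) h1 (Eventually.of_forall fun x => ?_)
    by_cases hx : x ∈ K
    · simpa [hx] using hb x
    · have hx1 : ∀ t, ‖x - t‖ < 1 → g t = 0 := by
        intro t ht
        by_contra hgt
        refine hx (Metric.mem_cthickening_of_dist_le x t 1 _ (subset_tsupport g hgt) ?_)
        rw [dist_eq_norm]; exact ht.le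
      have hz : moll n g x = 0 := conv_eq_zero (δ := (bump n).rOut) (kappa_eq_zero n)
        fun t ht => hx1 t (ht.trans_le hr1)
      simp [hx, hz, hx1 x (by simp)]
  refine hle.trans_lt ?_
  rw [div_mul_eq_mul_div, div_lt_iff₀ (by positivity)]
  nlinarith

/-- Mollifications of an `L²`-convergent sequence converge in `L²`. -/
lemma L2Tendsto_moll {f : ℕ → E3 → ℂ} {g : E3 → ℂ} (hf : ∀ n, L2 (f n)) (hg : L2 g)
    (h : L2Tendsto f atTop g) : L2Tendsto (fun n => moll n (f n)) atTop g := by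
  rw [L2Tendsto, Metric.tendsto_atTop]
  intro ε hε
  obtain ⟨u, huc, hu1, hucont, hu2⟩ := hg.exists_hasCompactSupport_eLpNorm_sub_le (p := 2)
    (by simp) (ε := ENNReal.ofReal (ε / 5)) (by simpa using hε)
  have hug : nn (fun x => g x - u x) ≤ ε / 5 :=
    ENNReal.toReal_le_of_le_ofReal (by positivity) hu1
  have e1 := (L2Tendsto_moll_of_continuous hucont huc).eventually (gt_mem_nhds (show 0 < ε / 5 by positivity))
  have e2 := h.eventually (gt_mem_nhds (show 0 < ε / 5 by positivity))
  obtain ⟨n₀, hn₀⟩ := eventually_atTop.1 (e1.and e2)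
  refine ⟨n₀, fun n hn => ?_⟩
  obtain ⟨h1, h2⟩ := hn₀ n hn
  rw [Real.dist_eq, sub_zero, abs_of_nonneg (nn_nonneg _)]
  have hfg : L2 (fun x => f n x - g x) := (hf n).sub hg
  have hgu : L2 (fun x => g x - u x) := hg.sub hu2
  have hmu : L2 (fun x => moll n u x - u x) := (L2_moll n hu2).sub hu2
  -- Mollification contracts `L²`, so the error splits into four pieces of size at most `ε / 5`: `f
  -- n - g` mollified, `g - u` mollified, the error for the continuous function `u`, and `g - u`
  -- itself.
  have e : (fun x => moll n (f n) x - g x) = fun x =>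
      (moll n (fun y => f n y - g y) x + moll n (fun y => g y - u y) x)
        + ((moll n u x - u x) - (g x - u x)) := by
    ext x
    rw [moll_sub n (hf n) hg, moll_sub n hg hu2]; ring
  rw [e]
  have b1 := nn_add_le ((L2_moll n hfg).add (L2_moll n hgu)) (hmu.sub hgu)
  have b2 := nn_add_le (L2_moll n hfg) (L2_moll n hgu)
  have b3 := nn_sub_le hmu hgu
  have b4 := nn_moll_le n hfg
  have b5 := nn_moll_le n hgu
  beta_reduce at h1
  linarith

/-! ### The smoothed modulus -/

section Modulus
variable {ρ : ℝ → ℝ}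

lemma IsBump.eq_zero (hρ : IsBump ρ) {s : ℝ} (hs : s ≤ 1 ∨ 2 ≤ s) : ρ s = 0 := by
  have : s ∉ Function.support ρ := by
    rw [hρ.support_eq, mem_Ioo, not_and_or, not_lt, not_lt]; exact hs
  exact Function.notMem_support.1 this

/-- The derivative of `beta`. -/
def betaDeriv (ρ : ℝ → ℝ) (s : ℝ) : ℝ := ∫ τ in (1 : ℝ)..s, ρ τ

lemma hasDerivAt_betaDeriv (hρ : IsBump ρ) (s : ℝ) : HasDerivAt (betaDeriv ρ) (ρ s) s :=
  intervalIntegral.integral_hasDerivAt_right (hρ.smooth.continuous.intervalIntegrable _ _)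
    (hρ.smooth.continuous.stronglyMeasurableAtFilter _ _) hρ.smooth.continuous.continuousAt

lemma contDiff_betaDeriv (hρ : IsBump ρ) : ContDiff ℝ ∞ (betaDeriv ρ) := by
  refine contDiff_infty_iff_deriv.2 ⟨fun s => (hasDerivAt_betaDeriv hρ s).differentiableAt, ?_⟩
  rw [show deriv (betaDeriv ρ) = ρ from funext fun s => (hasDerivAt_betaDeriv hρ s).deriv]
  exact hρ.smooth

lemma betaDeriv_eq_zero (hρ : IsBump ρ) {s : ℝ} (hs : s ≤ 1) : betaDeriv ρ s = 0 := by
  rw [betaDeriv, intervalIntegral.integral_congr (g := fun _ => (0 : ℝ))]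
  · simp
  · intro τ hτ
    rw [uIcc_of_ge hs] at hτ
    exact hρ.eq_zero (Or.inl hτ.2)

lemma betaDeriv_eq_one (hρ : IsBump ρ) {s : ℝ} (hs : 2 ≤ s) : betaDeriv ρ s = 1 := by
  have hi : ∀ a b, IntervalIntegrable ρ volume a b :=
    fun a b => hρ.smooth.continuous.intervalIntegrable a b
  rw [betaDeriv, ← intervalIntegral.integral_add_adjacent_intervals (hi 1 2) (hi 2 s),
    hρ.integral_eq_one, intervalIntegral.integral_congr (a := 2) (g := fun _ => (0 : ℝ))]
  · simp
  · intro τ hτ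
    rw [uIcc_of_le hs] at hτ
    exact hρ.eq_zero (Or.inr hτ.1)

lemma betaDeriv_nonneg (hρ : IsBump ρ) (s : ℝ) : 0 ≤ betaDeriv ρ s := by
  rcases le_total s 1 with h | h
  · exact (betaDeriv_eq_zero hρ h).ge
  · exact intervalIntegral.integral_nonneg h fun τ _ => hρ.nonneg τ

/-- One formula covers the three pieces, since `betaDeriv` is `0` to the left of `1` and `1` to the
right of `2`, and `betaConst` is adjusted so that the value at `2` is `2`. Smoothness across the
junctions then needs no case analysis. -/
lemma beta_eq (hρ : IsBump ρ) (r : ℝ) :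
    beta ρ r = betaConst ρ + ∫ s in (1 : ℝ)..r, betaDeriv ρ s := by
  have hc := (contDiff_betaDeriv hρ).continuous
  have hi : ∀ a b, IntervalIntegrable (betaDeriv ρ) volume a b :=
    fun a b => hc.intervalIntegrable a b
  rw [beta]
  split_ifs with h2 h1
  · rw [← intervalIntegral.integral_add_adjacent_intervals (hi 1 2) (hi 2 r),
      intervalIntegral.integral_congr (a := 2) (g := fun _ => (1 : ℝ))]
    · simp only [betaConst, intervalIntegral.integral_const, smul_eq_mul, mul_one]
      change r = 2 - (∫ s in (1 : ℝ)..2, betaDeriv ρ s) + _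
      ring
    · intro τ hτ
      rw [uIcc_of_le h2] at hτ
      exact betaDeriv_eq_one hρ hτ.1
  · rw [add_comm]; rfl
  · rw [intervalIntegral.integral_congr (g := fun _ => (0 : ℝ))]
    · simp
    · intro τ hτ
      rw [uIcc_of_ge (not_le.1 h1).le] at hτ
      exact betaDeriv_eq_zero hρ hτ.2

lemma hasDerivAt_beta (hρ : IsBump ρ) (r : ℝ) : HasDerivAt (beta ρ) (betaDeriv ρ r) r := by
  have hc := (contDiff_betaDeriv hρ).continuous
  rw [show beta ρ = fun r => betaConst ρ + ∫ s in (1 : ℝ)..r, betaDeriv ρ s from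
    funext (beta_eq hρ)]
  exact (intervalIntegral.integral_hasDerivAt_right (hc.intervalIntegrable _ _)
    (hc.stronglyMeasurableAtFilter _ _) hc.continuousAt).const_add _

lemma contDiff_beta (hρ : IsBump ρ) : ContDiff ℝ ∞ (beta ρ) := by
  refine contDiff_infty_iff_deriv.2 ⟨fun s => (hasDerivAt_beta hρ s).differentiableAt, ?_⟩
  rw [show deriv (beta ρ) = betaDeriv ρ from funext fun s => (hasDerivAt_beta hρ s).deriv]
  exact contDiff_betaDeriv hρ

/-- The norm fails to be smooth only at the origin, and near it the profile is constant. -/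
lemma contDiff_jap (hρ : IsBump ρ) : ContDiff ℝ ∞ (jap ρ) := by
  rw [contDiff_iff_contDiffAt]
  intro x
  rcases lt_or_ge ‖x‖ 1 with h | h
  · have : jap ρ =ᶠ[𝓝 x] fun _ => betaConst ρ := by
      filter_upwards [continuous_norm.continuousAt.eventually (gt_mem_nhds h)] with y hy
      rw [jap, beta, if_neg (by linarith), if_neg (by linarith)]
    exact contDiffAt_const.congr_of_eventuallyEq this
  · have hx : x ≠ 0 := by rintro rfl; simp at h; linarith
    exact (contDiff_beta hρ).contDiffAt.comp x (contDiffAt_norm ℝ hx)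

lemma jap_eq_norm {x : E3} (hx : 2 ≤ ‖x‖) : jap ρ x = ‖x‖ := by
  rw [jap, beta, if_pos hx]

lemma jap_le_two (hρ : IsBump ρ) {x : E3} (hx : ‖x‖ ≤ 2) : jap ρ x ≤ 2 := by
  have hm : Monotone (beta ρ) := monotone_of_deriv_nonneg
    ((contDiff_beta hρ).differentiable (by simp)) fun r => by
      rw [(hasDerivAt_beta hρ r).deriv]; exact betaDeriv_nonneg hρ r
  have := hm hx
  rwa [show beta ρ 2 = 2 by simp [beta]] at this

/-- The vector field `∇⟨x⟩`. -/
def bvec (ρ : ℝ → ℝ) (j : Fin 3) (x : E3) : ℝ := partialDeriv j (jap ρ) x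

/-- Half of the divergence of `∇⟨x⟩`. -/
def cfun (ρ : ℝ → ℝ) (x : E3) : ℝ := (1 / 2) * ∑ j, partialDeriv j (bvec ρ j) x

lemma contDiff_bvec (hρ : IsBump ρ) (j : Fin 3) : ContDiff ℝ ∞ (bvec ρ j) :=
  contDiff_partialDeriv (contDiff_jap hρ) j

lemma contDiff_cfun (hρ : IsBump ρ) : ContDiff ℝ ∞ (cfun ρ) :=
  contDiff_const.mul (ContDiff.sum fun j _ => contDiff_partialDeriv (contDiff_bvec hρ j) j)

lemma eventually_norm_gt {x : E3} {R : ℝ} (hx : R < ‖x‖) : ∀ᶠ y in 𝓝 x, R < ‖y‖ :=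
  continuous_norm.continuousAt.eventually (lt_mem_nhds hx)

lemma partialDeriv_coord (i j : Fin 3) (x : E3) :
    partialDeriv j (fun y : E3 => y i) x = if i = j then 1 else 0 := by
  have : HasFDerivAt (fun y : E3 => y i) (EuclideanSpace.proj (𝕜 := ℝ) i : E3 →L[ℝ] ℝ) x :=
    (EuclideanSpace.proj (𝕜 := ℝ) i : E3 →L[ℝ] ℝ).hasFDerivAt
  rw [partialDeriv, this.fderiv]
  simp

lemma sum_coord_sq (x : E3) : ∑ j, x j ^ 2 = ‖x‖ ^ 2 := by
  rw [EuclideanSpace.norm_sq_eq]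
  simp

lemma partialDeriv_norm {x : E3} (hx : x ≠ 0) (j : Fin 3) :
    partialDeriv j (fun y : E3 => ‖y‖) x = x j / ‖x‖ := by
  have hn : ‖x‖ ≠ 0 := norm_ne_zero_iff.2 hx
  have h := ((hasStrictFDerivAt_norm_sq x).hasFDerivAt).sqrt (by positivity)
  have e : (fun y : E3 => √ (‖y‖ ^ 2)) = fun y => ‖y‖ :=
    funext fun y => Real.sqrt_sq (norm_nonneg y)
  rw [e] at h
  rw [partialDeriv, h.fderiv, Real.sqrt_sq (norm_nonneg x)]
  simp [EuclideanSpace.inner_single_right]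
  field_simp

lemma partialDeriv_radial {G : ℝ → ℝ} {x : E3} (hx : x ≠ 0) (hG : DifferentiableAt ℝ G ‖x‖)
    (j : Fin 3) : partialDeriv j (fun y : E3 => G ‖y‖) x = deriv G ‖x‖ * (x j / ‖x‖) := by
  rw [partialDeriv_comp_real (f := fun y : E3 => ‖y‖) hG
    ((contDiffAt_norm ℝ hx).differentiableAt (n := 1) (by simp)), partialDeriv_norm hx]

lemma ne_zero_of_norm_gt {x : E3} (hx : 2 < ‖x‖) : x ≠ 0 := by
  rintro rfl; simp at hx; linarith

lemma bvec_eq {x : E3} (hx : 2 < ‖x‖) (j : Fin 3) : bvec ρ j x = x j / ‖x‖ := by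
  have : jap ρ =ᶠ[𝓝 x] fun y => ‖y‖ := by
    filter_upwards [eventually_norm_gt hx] with y hy using jap_eq_norm hy.le
  rw [bvec, partialDeriv_congr this, partialDeriv_norm (ne_zero_of_norm_gt hx)]

lemma sum_bvec_sq {x : E3} (hx : 2 < ‖x‖) : ∑ j, bvec ρ j x ^ 2 = 1 := by
  simp only [bvec_eq hx, div_pow, ← Finset.sum_div, sum_coord_sq]
  have : ‖x‖ ≠ 0 := by linarith
  field_simp

lemma differentiableAt_coord (i : Fin 3) (x : E3) : DifferentiableAt ℝ (fun y : E3 => y i) x :=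
  (EuclideanSpace.proj (𝕜 := ℝ) i : E3 →L[ℝ] ℝ).differentiableAt

lemma differentiableAt_radial {G : ℝ → ℝ} {x : E3} (hx : x ≠ 0)
    (hG : DifferentiableAt ℝ G ‖x‖) : DifferentiableAt ℝ (fun y : E3 => G ‖y‖) x :=
  hG.comp x ((contDiffAt_norm ℝ hx).differentiableAt (n := 1) (by simp))

/-- This is the Hessian of `|x|`: the projection orthogonal to `x`, divided by `|x|`. Its
nonnegativity is the source of the positive commutator. -/
lemma partialDeriv_bvec {x : E3} (hx : 2 < ‖x‖) (j k : Fin 3) :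
    partialDeriv j (bvec ρ k) x = ((if k = j then 1 else 0) - bvec ρ j x * bvec ρ k x) / ‖x‖ := by
  have hx0 := ne_zero_of_norm_gt hx
  have hn : ‖x‖ ≠ 0 := by linarith
  have : bvec ρ k =ᶠ[𝓝 x] fun y => y k * (fun r : ℝ => r⁻¹) ‖y‖ := by
    filter_upwards [eventually_norm_gt hx] with y hy using by rw [bvec_eq hy, div_eq_mul_inv]
  have hd : DifferentiableAt ℝ (fun r : ℝ => r⁻¹) ‖x‖ := differentiableAt_inv hn
  rw [partialDeriv_congr this, partialDeriv_mul_real (differentiableAt_coord k x)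
    (differentiableAt_radial hx0 hd), partialDeriv_coord, partialDeriv_radial hx0 hd, deriv_inv,
    bvec_eq hx, bvec_eq hx]
  field_simp
  ring

/-- Half the trace of the Hessian. The orthogonal projection has rank `2` in dimension three, hence
the coefficient `1`. -/
lemma cfun_eq {x : E3} (hx : 2 < ‖x‖) : cfun ρ x = 1 / ‖x‖ := by
  have h := sum_bvec_sq (ρ := ρ) hx
  simp only [cfun, partialDeriv_bvec hx, if_true, ← Finset.sum_div, Finset.sum_sub_distrib,
    ← pow_two, h]
  simp
  ring

lemma partialDeriv_cfun {x : E3} (hx : 2 < ‖x‖) (j : Fin 3) :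
    partialDeriv j (cfun ρ) x = - (x j * ‖x‖⁻¹ ^ 3) := by
  have hx0 := ne_zero_of_norm_gt hx
  have hn : ‖x‖ ≠ 0 := by linarith
  have : cfun ρ =ᶠ[𝓝 x] fun y => (fun r : ℝ => r⁻¹) ‖y‖ := by
    filter_upwards [eventually_norm_gt hx] with y hy using by rw [cfun_eq hy, one_div]
  have hd : DifferentiableAt ℝ (fun r : ℝ => r⁻¹) ‖x‖ := differentiableAt_inv hn
  rw [partialDeriv_congr this, partialDeriv_radial hx0 hd, deriv_inv]
  field_simp

/-- `1/|x|` is harmonic away from the origin in dimension three. This eliminates the zeroth-order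
term `Δ²⟨x⟩` from the commutator of `-Δ` with `γ`. -/
lemma sum_partialDeriv_cfun {x : E3} (hx : 2 < ‖x‖) :
    ∑ j, partialDeriv j (partialDeriv j (cfun ρ)) x = 0 := by
  have hx0 := ne_zero_of_norm_gt hx
  have hn : ‖x‖ ≠ 0 := by linarith
  have hd : DifferentiableAt ℝ (fun r : ℝ => -(r⁻¹ ^ 3)) ‖x‖ :=
    ((differentiableAt_inv hn).pow 3).neg
  have hder : deriv (fun r : ℝ => -(r⁻¹ ^ 3)) ‖x‖ = 3 * ‖x‖⁻¹ ^ 4 := by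
    have := ((hasDerivAt_inv hn).pow 3).neg
    rw [show (fun r : ℝ => -(r⁻¹ ^ 3)) = -(fun r : ℝ => r⁻¹) ^ 3 from rfl, this.deriv]
    push_cast; field_simp
  have h : ∀ j, partialDeriv j (partialDeriv j (cfun ρ)) x
      = - (‖x‖⁻¹ ^ 3) + 3 * ‖x‖⁻¹ ^ 5 * x j ^ 2 := by
    intro j
    have : partialDeriv j (cfun ρ) =ᶠ[𝓝 x] fun y => y j * (fun r : ℝ => -(r⁻¹ ^ 3)) ‖y‖ := by
      filter_upwards [eventually_norm_gt hx] with y hy using by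
        rw [partialDeriv_cfun hy]; ring
    rw [partialDeriv_congr this, partialDeriv_mul_real (differentiableAt_coord j x)
      (differentiableAt_radial hx0 hd), partialDeriv_coord, partialDeriv_radial hx0 hd, hder]
    simp
    field_simp
  simp only [h, Finset.sum_add_distrib, ← Finset.mul_sum, sum_coord_sq]
  simp
  field_simp
  norm_num

lemma bounded_of_outside {f : E3 → ℝ} (hf : Continuous f) {M : ℝ}
    (hM : ∀ x : E3, 2 < ‖x‖ → |f x| ≤ M) : ∃ C, ∀ x, |f x| ≤ C := by
  obtain ⟨C, hC⟩ := (isCompact_closedBall (0 : E3) 2).exists_bound_of_continuousOn hf.continuousOn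
  refine ⟨max C M, fun x => ?_⟩
  rcases le_or_gt ‖x‖ 2 with h | h
  · exact (hC x (by simpa using h)).trans (le_max_left _ _)
  · exact (hM x h).trans (le_max_right _ _)

lemma abs_bvec_le_one {x : E3} (hx : 2 < ‖x‖) (j : Fin 3) : |bvec ρ j x| ≤ 1 := by
  have h := sum_bvec_sq (ρ := ρ) hx
  have h2 := Finset.single_le_sum (f := fun j => bvec ρ j x ^ 2) (fun i _ => sq_nonneg _)
    (Finset.mem_univ j)
  rw [h] at h2
  exact (sq_le_one_iff_abs_le_one _).1 h2

/-- A common bound for the coefficients of `γ`. -/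
lemma exists_coeff_bound (hρ : IsBump ρ) : ∃ B : ℝ, 0 ≤ B ∧ (∀ j x, |bvec ρ j x| ≤ B) ∧
    (∀ x, |cfun ρ x| ≤ B) ∧ ∀ j k x, |partialDeriv j (bvec ρ k) x| ≤ B := by
  have h1 : ∀ j, ∃ C, ∀ x, |bvec ρ j x| ≤ C := fun j =>
    bounded_of_outside (contDiff_bvec hρ j).continuous fun x hx => abs_bvec_le_one hx j
  have h2 : ∃ C, ∀ x, |cfun ρ x| ≤ C :=
    bounded_of_outside (M := 1) (contDiff_cfun hρ).continuous fun x hx => by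
      rw [cfun_eq hx, abs_of_nonneg (by positivity), div_le_one (by linarith)]; linarith
  have h3 : ∀ j k, ∃ C, ∀ x, |partialDeriv j (bvec ρ k) x| ≤ C := fun j k =>
    bounded_of_outside (M := 2) (contDiff_partialDeriv (contDiff_bvec hρ k) j).continuous
      fun x hx => by
        rw [partialDeriv_bvec hx, abs_div, abs_of_pos (show 0 < ‖x‖ by linarith),
          div_le_iff₀ (by linarith)]
        have := abs_bvec_le_one (ρ := ρ) hx j
        have := abs_bvec_le_one (ρ := ρ) hx k
        have e1 : |(if k = j then (1 : ℝ) else 0)| ≤ 1 := by split_ifs <;> simp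
        have e2 : |bvec ρ j x * bvec ρ k x| ≤ 1 := by
          rw [abs_mul]; exact mul_le_one₀ (by assumption) (abs_nonneg _) (by assumption)
        have := abs_sub (if k = j then (1 : ℝ) else 0) (bvec ρ j x * bvec ρ k x)
        linarith
  choose C1 hC1 using h1
  obtain ⟨C2, hC2⟩ := h2
  choose C3 hC3 using h3
  refine ⟨∑ j, |C1 j| + |C2| + ∑ j, ∑ k, |C3 j k|, by positivity, fun j x => ?_, fun x => ?_,
    fun j k x => ?_⟩
  · have := Finset.single_le_sum (f := fun j => |C1 j|) (fun i _ => abs_nonneg _)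
      (Finset.mem_univ j)
    have h3 : 0 ≤ ∑ j, ∑ k, |C3 j k| := by positivity
    linarith [hC1 j x, le_abs_self (C1 j), abs_nonneg C2]
  · have h3 : 0 ≤ ∑ j, ∑ k, |C3 j k| := by positivity
    have h4 : 0 ≤ ∑ j, |C1 j| := by positivity
    linarith [hC2 x, le_abs_self C2]
  · have h4 : 0 ≤ ∑ j, |C1 j| := by positivity
    have h5 := Finset.single_le_sum (f := fun k => |C3 j k|) (fun i _ => abs_nonneg _)
      (Finset.mem_univ k)
    have h6 := Finset.single_le_sum (f := fun j => ∑ k, |C3 j k|) (fun i _ => by positivity)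
      (Finset.mem_univ j)
    beta_reduce at h5 h6
    linarith [hC3 j k x, le_abs_self (C3 j k), abs_nonneg C2]

end Modulus

/-! ### Product rules for weak derivatives -/

lemma contDiff_ofReal_comp {a : E3 → ℝ} (ha : ContDiff ℝ ∞ a) :
    ContDiff ℝ ∞ (fun x => (a x : ℂ)) :=
  Complex.ofRealCLM.contDiff.comp ha

lemma integrable_mul_test {u η : E3 → ℂ} (hu : LocallyIntegrable u) (hη : IsTest η) :
    Integrable (fun x => u x * η x) := by
  have := hu.integrable_smul_right_of_hasCompactSupport hη.continuous hη.2
  exact this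

/-- Product rule for a smooth factor. -/
lemma HasWeakPartial.mul_smooth {j : Fin 3} {u v : E3 → ℂ} (h : HasWeakPartial j u v)
    {a : E3 → ℝ} (ha : ContDiff ℝ ∞ a) :
    HasWeakPartial j (fun x => (a x : ℂ) * u x)
      (fun x => (a x : ℂ) * v x + ((partialDeriv j a x : ℝ) : ℂ) * u x) := by
  have hac := contDiff_ofReal_comp ha
  have hdc := contDiff_ofReal_comp (contDiff_partialDeriv ha j)
  have l1 : LocallyIntegrable (fun x => (a x : ℂ) * u x) := by
    simpa using h.1.continuous_mul hac.continuous
  have l2 : LocallyIntegrable (fun x => (a x : ℂ) * v x) := by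
    simpa using h.2.1.continuous_mul hac.continuous
  have l3 : LocallyIntegrable (fun x => ((partialDeriv j a x : ℝ) : ℂ) * u x) := by
    simpa using h.1.continuous_mul hdc.continuous
  refine ⟨l1, l2.add l3, fun η hη => ?_⟩
  have e := h.2.2 _ (hη.mul_left hac)
  have e1 : ∀ x, u x * partialDeriv j (fun y => (a y : ℂ) * η y) x
      = (a x : ℂ) * u x * partialDeriv j η x + ((partialDeriv j a x : ℝ) : ℂ) * u x * η x := by
    intro x
    rw [partialDeriv_mul (hac.differentiable (by simp) x) (hη.differentiable x),
      partialDeriv_ofReal (ha.differentiable (by simp) x)]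
    ring
  simp only [e1] at e
  rw [integral_add (integrable_mul_test l1 (hη.partialDeriv j)) (integrable_mul_test l3 hη)] at e
  have e2 : ∀ x, ((a x : ℂ) * v x + ((partialDeriv j a x : ℝ) : ℂ) * u x) * η x
      = v x * ((a x : ℂ) * η x) + ((partialDeriv j a x : ℝ) : ℂ) * u x * η x := fun x => by ring
  simp only [e2]
  rw [integral_add (integrable_mul_test h.2.1 (hη.mul_left hac)) (integrable_mul_test l3 hη)]
  linear_combination e

/-- `a` is a bounded pointwise limit of smooth functions whose gradients are uniformly bounded and
converge pointwise to `a'`. -/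
def IsMultiplier (a : E3 → ℝ) (a' : Fin 3 → E3 → ℝ) : Prop :=
  ∃ (s : ℕ → E3 → ℝ) (C : ℝ), (∀ n, ContDiff ℝ ∞ (s n)) ∧ (∀ n x, |s n x| ≤ C) ∧
    (∀ n j x, |partialDeriv j (s n) x| ≤ C) ∧
    (∀ x, Tendsto (fun n => s n x) atTop (𝓝 (a x))) ∧
    ∀ j x, Tendsto (fun n => partialDeriv j (s n) x) atTop (𝓝 (a' j x))

lemma IsMultiplier.of_contDiff {a : E3 → ℝ} {C : ℝ} (ha : ContDiff ℝ ∞ a) (h0 : ∀ x, |a x| ≤ C)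
    (h1 : ∀ j x, |partialDeriv j a x| ≤ C) : IsMultiplier a (fun j x => partialDeriv j a x) :=
  ⟨fun _ => a, C, fun _ => ha, fun _ => h0, fun _ => h1, fun _ => tendsto_const_nhds,
    fun _ _ => tendsto_const_nhds⟩

/-- Needed because the second half of `γ` differentiates the product of `∂ⱼ⟨x⟩`, the multiplier and
the function. -/
lemma IsMultiplier.mul {a b : E3 → ℝ} {a' b' : Fin 3 → E3 → ℝ} (ha : IsMultiplier a a')
    (hb : IsMultiplier b b') :
    IsMultiplier (fun x => b x * a x) (fun j x => b' j x * a x + b x * a' j x) := by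
  obtain ⟨s, C, hs, h0, h1, h2, h3⟩ := ha
  obtain ⟨r, D, hr, k0, k1, k2, k3⟩ := hb
  have hC : 0 ≤ C := (abs_nonneg _).trans (h0 0 0)
  have hD : 0 ≤ D := (abs_nonneg _).trans (k0 0 0)
  have e : ∀ n j x, partialDeriv j (fun x => r n x * s n x) x
      = partialDeriv j (r n) x * s n x + r n x * partialDeriv j (s n) x := fun n j x =>
    partialDeriv_mul_real ((hr n).differentiable (by simp) x) ((hs n).differentiable (by simp) x) j
  refine ⟨fun n x => r n x * s n x, 2 * (C * D), fun n => (hr n).mul (hs n), fun n x => ?_,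
    fun n j x => ?_, fun x => (k2 x).mul (h2 x), fun j x => ?_⟩
  · rw [abs_mul]
    have := mul_le_mul (k0 n x) (h0 n x) (abs_nonneg _) hD
    nlinarith
  · rw [e]
    refine (abs_add_le _ _).trans ?_
    rw [abs_mul, abs_mul]
    have := mul_le_mul (k1 n j x) (h0 n x) (abs_nonneg _) hD
    have := mul_le_mul (k0 n x) (h1 n j x) (abs_nonneg _) hD
    nlinarith
  · simp only [e]
    exact ((k3 j x).mul (h2 x)).add ((k2 x).mul (h3 j x))

lemma IsMultiplier.measurable {a : E3 → ℝ} {a' : Fin 3 → E3 → ℝ} (h : IsMultiplier a a') :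
    Measurable a ∧ ∀ j, Measurable (a' j) := by
  obtain ⟨s, C, hs, h0, h1, h2, h3⟩ := h
  exact ⟨measurable_of_tendsto_metrizable (fun n => (hs n).continuous.measurable)
      (tendsto_pi_nhds.2 h2), fun j =>
    measurable_of_tendsto_metrizable (fun n => (contDiff_partialDeriv (hs n) j).continuous.measurable)
      (tendsto_pi_nhds.2 (h3 j))⟩

lemma IsMultiplier.bounded {a : E3 → ℝ} {a' : Fin 3 → E3 → ℝ} (h : IsMultiplier a a') :
    ∃ C, (∀ x, |a x| ≤ C) ∧ ∀ j x, |a' j x| ≤ C := by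
  obtain ⟨s, C, hs, h0, h1, h2, h3⟩ := h
  exact ⟨C, fun x => le_of_tendsto (h2 x).abs (Eventually.of_forall fun n => h0 n x),
    fun j x => le_of_tendsto (h3 j x).abs (Eventually.of_forall fun n => h1 n j x)⟩

lemma LocallyIntegrable.bdd_mul_real {u : E3 → ℂ} (hu : LocallyIntegrable u) {a : E3 → ℝ} {C : ℝ}
    (ha : Measurable a) (hC : ∀ x, |a x| ≤ C) : LocallyIntegrable (fun x => (a x : ℂ) * u x) := by
  have h2 : LocallyIntegrable (fun x => (C : ℂ) * u x) := hu.smul (C : ℂ)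
  refine h2.mono ((Complex.measurable_ofReal.comp ha).aestronglyMeasurable.mul
    hu.aestronglyMeasurable) (Eventually.of_forall fun x => ?_)
  rw [norm_mul, norm_mul, Complex.norm_real, Complex.norm_real]
  exact mul_le_mul_of_nonneg_right ((hC x).trans (le_abs_self C)) (norm_nonneg _)

lemma tendsto_integral_multiplier {f η : E3 → ℂ} (hf : LocallyIntegrable f) (hη : IsTest η)
    {s : ℕ → E3 → ℝ} {a : E3 → ℝ} {C : ℝ} (hs : ∀ n, Continuous (s n)) (h0 : ∀ n x, |s n x| ≤ C)
    (hl : ∀ x, Tendsto (fun n => s n x) atTop (𝓝 (a x))) :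
    Tendsto (fun n => ∫ x, (s n x : ℂ) * f x * η x) atTop (𝓝 (∫ x, (a x : ℂ) * f x * η x)) := by
  have hi := (integrable_mul_test hf hη)
  refine tendsto_integral_of_dominated_convergence (fun x => C * ‖f x * η x‖) (fun n => ?_)
    (hi.norm.const_mul C) (fun n => Eventually.of_forall fun x => ?_)
    (Eventually.of_forall fun x => ?_)
  · exact (((Complex.continuous_ofReal.comp (hs n)).aestronglyMeasurable).mul
      hf.aestronglyMeasurable).mul hη.continuous.aestronglyMeasurable
  · rw [mul_assoc, norm_mul, Complex.norm_real]
    exact mul_le_mul_of_nonneg_right (h0 n x) (norm_nonneg _)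
  · exact (((Complex.continuous_ofReal.tendsto _).comp (hl x)).mul_const _).mul_const _

/-- Product rule for a multiplier. -/
lemma HasWeakPartial.mul_multiplier {j : Fin 3} {u v : E3 → ℂ} (h : HasWeakPartial j u v)
    {a : E3 → ℝ} {a' : Fin 3 → E3 → ℝ} (ha : IsMultiplier a a') :
    HasWeakPartial j (fun x => (a x : ℂ) * u x)
      (fun x => (a x : ℂ) * v x + (a' j x : ℂ) * u x) := by
  obtain ⟨m1, m2⟩ := ha.measurable
  obtain ⟨D, d1, d2⟩ := ha.bounded
  obtain ⟨s, C, hs, h0, h1, h2, h3⟩ := ha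
  have l1 := LocallyIntegrable.bdd_mul_real h.1 m1 d1
  have l2 := LocallyIntegrable.bdd_mul_real h.2.1 m1 d1
  have l3 := LocallyIntegrable.bdd_mul_real h.1 (m2 j) (d2 j)
  refine ⟨l1, l2.add l3, fun η hη => ?_⟩
  have t1 := tendsto_integral_multiplier h.1 (hη.partialDeriv j) (fun n => (hs n).continuous) h0 h2
  have t2 := tendsto_integral_multiplier h.2.1 hη (fun n => (hs n).continuous) h0 h2
  have t3 := tendsto_integral_multiplier h.1 hη
    (fun n => (contDiff_partialDeriv (hs n) j).continuous) (fun n => h1 n j) (h3 j)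
  have t4 := (t2.add t3).neg
  have e2 : ∀ x, ((a x : ℂ) * v x + (a' j x : ℂ) * u x) * η x
      = (a x : ℂ) * v x * η x + (a' j x : ℂ) * u x * η x := fun x => by ring
  simp only [e2]
  rw [integral_add (integrable_mul_test l2 hη) (integrable_mul_test l3 hη)]
  -- The smooth product rule holds for each approximant, and the three tested integrals converge by
  -- domination, so the weak identity survives in the limit.
  refine tendsto_nhds_unique t1 (t4.congr fun n => ?_)
  have hn := h.mul_smooth (hs n)
  rw [hn.2.2 η hη]
  congr 1
  have i2 : Integrable (fun x => (s n x : ℂ) * v x * η x) := integrable_mul_test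
    (LocallyIntegrable.bdd_mul_real h.2.1 (hs n).continuous.measurable (h0 n)) hη
  have i3 : Integrable (fun x => ((partialDeriv j (s n) x : ℝ) : ℂ) * u x * η x) :=
    integrable_mul_test (LocallyIntegrable.bdd_mul_real h.1
      (contDiff_partialDeriv (hs n) j).continuous.measurable (h1 n j)) hη
  rw [← integral_add i2 i3]
  congr 1; ext x; ring

/-- The function `∇⟨x⟩ · ∇u + ½ Δ⟨x⟩ u`, given the gradient `v` of `u`. -/
def qfun (ρ : ℝ → ℝ) (u : E3 → ℂ) (v : Fin 3 → E3 → ℂ) (x : E3) : ℂ :=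
  (∑ j, (bvec ρ j x : ℂ) * v j x) + (cfun ρ x : ℂ) * u x

lemma isMultiplier_bvec {ρ : ℝ → ℝ} (hρ : IsBump ρ) (k : Fin 3) :
    IsMultiplier (bvec ρ k) (fun j x => partialDeriv j (bvec ρ k) x) := by
  obtain ⟨B, _, h1, _, h3⟩ := exists_coeff_bound hρ
  exact IsMultiplier.of_contDiff (contDiff_bvec hρ k) (h1 k) (fun j => h3 j k)

/-- `γ` on a product of a multiplier and a weakly differentiable function. -/
lemma gammaOp_mul {ρ : ℝ → ℝ} (hρ : IsBump ρ) {u : E3 → ℂ} {v : Fin 3 → E3 → ℂ}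
    (h : ∀ j, HasWeakPartial j u (v j)) {a : E3 → ℝ} {a' : Fin 3 → E3 → ℝ}
    (ha : IsMultiplier a a') :
    gammaOp ρ (fun x => (a x : ℂ) * u x) =ᵐ[volume] fun x =>
      -Complex.I * ((a x : ℂ) * qfun ρ u v x + (∑ j, bvec ρ j x * a' j x : ℝ) * u x) := by
  have h1 : ∀ᵐ x : E3, ∀ j, weakPartial j (fun x => (a x : ℂ) * u x) x
      = (a x : ℂ) * v j x + (a' j x : ℂ) * u x :=
    ae_all_iff.2 fun j => weakPartial_ae_eq ((h j).mul_multiplier ha)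
  have h2 : ∀ᵐ x : E3, ∀ j, weakPartial j
      (fun y => ((partialDeriv j (jap ρ) y : ℝ) : ℂ) * ((a y : ℂ) * u y)) x
      = (bvec ρ j x : ℂ) * a x * v j x
        + ((partialDeriv j (bvec ρ j) x * a x + bvec ρ j x * a' j x : ℝ) : ℂ) * u x := by
    refine ae_all_iff.2 fun j => ?_
    have := weakPartial_ae_eq ((h j).mul_multiplier (ha.mul (isMultiplier_bvec hρ j)))
    have e : (fun y => ((partialDeriv j (jap ρ) y : ℝ) : ℂ) * ((a y : ℂ) * u y))
        = fun x => ((bvec ρ j x * a x : ℝ) : ℂ) * u x := by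
      ext y; rw [bvec]; push_cast; ring
    rw [e]
    filter_upwards [this] with x hx
    rw [hx]; push_cast; ring
  filter_upwards [h1, h2] with x e1 e2
  rw [gammaOp]
  simp only [e1, e2, qfun, cfun, bvec, Fin.sum_univ_three]
  push_cast
  ring

/-! ### Approximation by test functions -/

/-- The smooth cutoff of `(-∞, 1]`. -/
def chi (s : ℝ) : ℝ := 1 - Real.smoothTransition (s - 1)

lemma contDiff_chi : ContDiff ℝ ∞ chi :=
  contDiff_const.sub (Real.smoothTransition.contDiff.comp (contDiff_id.sub contDiff_const))

lemma chi_eq_one {s : ℝ} (hs : s ≤ 1) : chi s = 1 := by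
  rw [chi, Real.smoothTransition.zero_of_nonpos (by linarith), sub_zero]

lemma chi_eq_zero {s : ℝ} (hs : 2 ≤ s) : chi s = 0 := by
  rw [chi, Real.smoothTransition.one_of_one_le (by linarith), sub_self]

lemma chi_nonneg (s : ℝ) : 0 ≤ chi s := by
  rw [chi]; linarith [Real.smoothTransition.le_one (s - 1)]

lemma chi_le_one (s : ℝ) : chi s ≤ 1 := by
  rw [chi]; linarith [Real.smoothTransition.nonneg (s - 1)]

lemma exists_bound_of_eq_zero {f : ℝ → ℝ} (hf : Continuous f) {a b : ℝ}
    (h : ∀ s, s < a ∨ b < s → f s = 0) : ∃ C, 0 ≤ C ∧ ∀ s, |f s| ≤ C := by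
  obtain ⟨C, hC⟩ := (isCompact_Icc (a := a) (b := b)).exists_bound_of_continuousOn hf.continuousOn
  refine ⟨|C|, abs_nonneg _, fun s => ?_⟩
  by_cases hs : s ∈ Icc a b
  · exact (hC s hs).trans (le_abs_self C)
  · rw [mem_Icc, not_and_or, not_le, not_le] at hs
    rw [h s hs, abs_zero]; exact abs_nonneg _

lemma deriv_eq_zero_of_eventually {f : ℝ → ℝ} {s c : ℝ} (h : f =ᶠ[𝓝 s] fun _ => c) :
    deriv f s = 0 := by rw [h.deriv_eq, deriv_const]

lemma deriv_chi_eq_zero {s : ℝ} (hs : s < 1 ∨ 2 < s) : deriv chi s = 0 := by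
  rcases hs with h | h
  · refine deriv_eq_zero_of_eventually (c := 1) ?_
    filter_upwards [gt_mem_nhds h] with y hy using chi_eq_one hy.le
  · refine deriv_eq_zero_of_eventually (c := 0) ?_
    filter_upwards [lt_mem_nhds h] with y hy using chi_eq_zero hy.le

lemma partialDeriv_comp_jap {ρ : ℝ → ℝ} (hρ : IsBump ρ) {G : ℝ → ℝ} (hG : Differentiable ℝ G)
    (j : Fin 3) (x : E3) :
    partialDeriv j (fun y => G (jap ρ y)) x = deriv G (jap ρ x) * bvec ρ j x :=
  partialDeriv_comp_real (hG _) ((contDiff_jap hρ).differentiable (by simp) x) j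

/-- Mollifying a truncation approximates the product in `H¹`. -/
lemma moll_approx {u : E3 → ℂ} {v : Fin 3 → E3 → ℂ} (hu : L2 u) (hv : ∀ j, L2 (v j))
    (h : ∀ j, HasWeakPartial j u (v j)) {a : ℕ → E3 → ℝ} {b : E3 → ℝ} {b' : Fin 3 → E3 → ℝ} {C : ℝ}
    (ha : ∀ n, ContDiff ℝ ∞ (a n)) (h0 : ∀ n x, |a n x| ≤ C)
    (h1 : ∀ n j x, |partialDeriv j (a n) x| ≤ C)
    (h2 : ∀ x, Tendsto (fun n => a n x) atTop (𝓝 (b x)))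
    (h3 : ∀ j x, Tendsto (fun n => partialDeriv j (a n) x) atTop (𝓝 (b' j x))) :
    L2Tendsto (fun n => moll n (fun x => (a n x : ℂ) * u x)) atTop (fun x => (b x : ℂ) * u x) ∧
    ∀ j, L2Tendsto (fun n => partialDeriv j (moll n (fun x => (a n x : ℂ) * u x))) atTop
      (fun x => (b x : ℂ) * v j x + (b' j x : ℂ) * u x) := by
  have hm : IsMultiplier b b' := ⟨a, C, ha, h0, h1, h2, h3⟩
  obtain ⟨m1, m2⟩ := hm.measurable
  obtain ⟨D, d1, d2⟩ := hm.bounded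
  have c0 : ∀ n, AEStronglyMeasurable (fun x => (a n x : ℂ)) volume := fun n =>
    (contDiff_ofReal_comp (ha n)).continuous.aestronglyMeasurable
  have c1 : ∀ n j, AEStronglyMeasurable (fun x => ((partialDeriv j (a n) x : ℝ) : ℂ)) volume :=
    fun n j => (contDiff_ofReal_comp
      (contDiff_partialDeriv (ha n) j)).continuous.aestronglyMeasurable
  have n0 : ∀ n x, ‖(a n x : ℂ)‖ ≤ C := fun n x => by rw [Complex.norm_real]; exact h0 n x
  have n1 : ∀ n j x, ‖((partialDeriv j (a n) x : ℝ) : ℂ)‖ ≤ C := fun n j x => by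
    rw [Complex.norm_real]; exact h1 n j x
  have e0 : ∀ x, ‖(b x : ℂ)‖ ≤ D := fun x => by rw [Complex.norm_real]; exact d1 x
  have e1 : ∀ j x, ‖(b' j x : ℂ)‖ ≤ D := fun j x => by rw [Complex.norm_real]; exact d2 j x
  have g0 := (Complex.measurable_ofReal.comp m1).aestronglyMeasurable (μ := (volume : Measure E3))
  have g1 := fun j => (Complex.measurable_ofReal.comp (m2 j)).aestronglyMeasurable
    (μ := (volume : Measure E3))
  have k0 : ∀ x, Tendsto (fun n => (a n x : ℂ)) atTop (𝓝 (b x : ℂ)) := fun x =>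
    (Complex.continuous_ofReal.tendsto _).comp (h2 x)
  have k1 : ∀ j x, Tendsto (fun n => ((partialDeriv j (a n) x : ℝ) : ℂ)) atTop (𝓝 (b' j x : ℂ)) :=
    fun j x => (Complex.continuous_ofReal.tendsto _).comp (h3 j x)
  refine ⟨L2Tendsto_moll (fun n => hu.bdd_mul (c0 n) (n0 n)) (hu.bdd_mul g0 e0)
    (L2Tendsto.of_multiplier hu c0 n0 k0), fun j => ?_⟩
  have t1 := L2Tendsto.of_multiplier (hv j) c0 n0 k0
  have t2 := L2Tendsto.of_multiplier hu (fun n => c1 n j) (fun n => n1 n j) (k1 j)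
  have t3 := t1.add t2 (fun n => (hv j).bdd_mul (c0 n) (n0 n))
    (fun n => hu.bdd_mul (c1 n j) (n1 n j)) ((hv j).bdd_mul g0 e0) (hu.bdd_mul (g1 j) (e1 j))
  -- The gradient of the mollified product is the mollification of its weak gradient, so one
  -- convergence lemma serves both orders of differentiation.
  have t4 := L2Tendsto_moll (fun n => ((hv j).bdd_mul (c0 n) (n0 n)).add
    (hu.bdd_mul (c1 n j) (n1 n j))) (((hv j).bdd_mul g0 e0).add (hu.bdd_mul (g1 j) (e1 j))) t3
  refine t4.congr (Eventually.of_forall fun n => Eventually.of_forall fun x => ?_) ae_eq_rfl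
  exact (partialDeriv_conv_of_weak ((h j).mul_smooth (ha n)) (isTest_kappa n) x).symm

/-- A compactly supported truncation. -/
lemma hasCompactSupport_of_jap {ρ : ℝ → ℝ} {f : E3 → ℂ} {R : ℝ} (hf : ∀ x, R ≤ jap ρ x → f x = 0) :
    HasCompactSupport f := by
  refine HasCompactSupport.intro (isCompact_closedBall (0 : E3) (max R 2)) fun x hx => hf x ?_
  rw [Metric.mem_closedBall, dist_zero_right, not_le, max_lt_iff] at hx
  rw [jap_eq_norm hx.2.le]; exact hx.1.le

/-- Test functions are dense in `H¹`. -/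
lemma exists_test_approx {ρ : ℝ → ℝ} (hρ : IsBump ρ) {u : E3 → ℂ} {v : Fin 3 → E3 → ℂ} (hu : L2 u)
    (hv : ∀ j, L2 (v j)) (h : ∀ j, HasWeakPartial j u (v j)) :
    ∃ w : ℕ → E3 → ℂ, (∀ n, IsTest (w n)) ∧ L2Tendsto w atTop u ∧
      ∀ j, L2Tendsto (fun n => partialDeriv j (w n)) atTop (v j) := by
  obtain ⟨B, hB, hb, _, _⟩ := exists_coeff_bound hρ
  obtain ⟨D, hD, hd⟩ := exists_bound_of_eq_zero (a := 1) (b := 2)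
    (contDiff_chi.continuous_deriv (by simp)) (fun s => deriv_chi_eq_zero)
  -- Cutoffs stretched to scale `n + 1`. Their gradients are `O(1/(n + 1))` and disappear in the
  -- limit.
  set a : ℕ → E3 → ℝ := fun n x => chi (jap ρ x / (n + 1)) with ha
  have hG : ∀ n : ℕ, ContDiff ℝ ∞ (fun r : ℝ => chi (r / (n + 1))) := fun n =>
    contDiff_chi.comp (contDiff_id.div_const _)
  have hac : ∀ n, ContDiff ℝ ∞ (a n) := fun n => (hG n).comp (contDiff_jap hρ)
  have hda : ∀ n j x, partialDeriv j (a n) x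
      = deriv chi (jap ρ x / (n + 1)) * (1 / ((n : ℝ) + 1)) * bvec ρ j x := by
    intro n j x
    have hn : ((n : ℝ) + 1) ≠ 0 := by positivity
    have h1 : HasDerivAt (fun r : ℝ => chi (r / (n + 1)))
        (deriv chi (jap ρ x / (n + 1)) * (1 / ((n : ℝ) + 1))) (jap ρ x) := by
      have := (contDiff_chi.differentiable (by simp) (jap ρ x / (n + 1))).hasDerivAt.comp (jap ρ x)
        ((hasDerivAt_id (jap ρ x)).div_const ((n : ℝ) + 1))
      exact this
    have := partialDeriv_comp_jap hρ ((hG n).differentiable (by simp)) j x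
    rw [h1.deriv] at this
    exact this
  have hdb : ∀ n j x, |partialDeriv j (a n) x| ≤ D * B * (1 / ((n : ℝ) + 1)) := by
    intro n j x
    rw [hda, abs_mul, abs_mul, abs_of_pos (show 0 < 1 / ((n : ℝ) + 1) by positivity)]
    have := mul_le_mul (hd (jap ρ x / (n + 1))) (hb j x) (abs_nonneg _) hD
    have h2 : 0 ≤ 1 / ((n : ℝ) + 1) := by positivity
    nlinarith
  have hone : ∀ n : ℕ, 1 / ((n : ℝ) + 1) ≤ 1 := fun n => by
    rw [div_le_one (by positivity)]; linarith [(Nat.cast_nonneg n : (0 : ℝ) ≤ n)]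
  have key := moll_approx (C := D * B + 1) (b := fun _ => 1) (b' := fun _ _ => 0) hu hv h hac
    (fun n x => by
      rw [abs_of_nonneg (chi_nonneg _)]
      have := chi_le_one (jap ρ x / (n + 1))
      have : 0 ≤ D * B := by positivity
      linarith)
    (fun n j x => (hdb n j x).trans (by
      have := mul_le_mul_of_nonneg_left (hone n) (show 0 ≤ D * B by positivity)
      linarith))
    (fun x => by
      refine tendsto_const_nhds.congr' ?_
      obtain ⟨N, hN⟩ := exists_nat_ge (jap ρ x)
      filter_upwards [eventually_ge_atTop N] with n hn
      rw [ha]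
      refine (chi_eq_one ?_).symm
      rw [div_le_one (by positivity)]
      have : (N : ℝ) ≤ n := by exact_mod_cast hn
      linarith)
    (fun j x => by
      have := (tendsto_one_div_add_atTop_nhds_zero_nat (𝕜 := ℝ)).const_mul (D * B)
      rw [mul_zero] at this
      exact squeeze_zero_norm (fun n => hdb n j x) this)
  refine ⟨fun n => moll n (fun x => (a n x : ℂ) * u x), fun n => ?_, ?_, fun j => ?_⟩
  · have hl : L2 (fun x => (a n x : ℂ) * u x) :=
      hu.bdd_mul (C := 1) (contDiff_ofReal_comp (hac n)).continuous.aestronglyMeasurable fun x => by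
        rw [Complex.norm_real, Real.norm_of_nonneg (chi_nonneg _)]; exact chi_le_one _
    refine IsTest.conv hl.locallyIntegrable (hasCompactSupport_of_jap (ρ := ρ) (R := 2 * (n + 1))
      fun x hx => ?_) (isTest_kappa n)
    have : a n x = 0 := chi_eq_zero (by rw [le_div_iff₀ (by positivity)]; exact hx)
    rw [this]; simp
  · simpa using key.1
  · simpa using key.2 j

/-- Integration by parts for the square of an `H¹` function. -/
lemma ip_mul_gradient {ρ : ℝ → ℝ} (hρ : IsBump ρ) {u : E3 → ℂ} {v : Fin 3 → E3 → ℂ} (hu : L2 u)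
    (hv : ∀ j, L2 (v j)) (h : ∀ j, HasWeakPartial j u (v j)) (j : Fin 3) {c : E3 → ℝ} {C : ℝ}
    (hc : ContDiff ℝ ∞ c) (h0 : ∀ x, |c x| ≤ C) (h1 : ∀ x, |partialDeriv j c x| ≤ C) :
    ip u (fun x => (c x : ℂ) * v j x) + ip (v j) (fun x => (c x : ℂ) * u x)
      = - ip u (fun x => ((partialDeriv j c x : ℝ) : ℂ) * u x) := by
  -- Only one of the two copies of `u` is replaced by test functions. The other keeps its weak
  -- derivative, which is tested against `c w_n`.
  obtain ⟨w, hw, hw1, hw2⟩ := exists_test_approx hρ hu hv h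
  have hcc := contDiff_ofReal_comp hc
  have hdc := contDiff_ofReal_comp (contDiff_partialDeriv hc j)
  have n0 : ∀ x, ‖(c x : ℂ)‖ ≤ C := fun x => by rw [Complex.norm_real]; exact h0 x
  have n1 : ∀ x, ‖((partialDeriv j c x : ℝ) : ℂ)‖ ≤ C := fun x => by
    rw [Complex.norm_real]; exact h1 x
  have m0 := hcc.continuous.aestronglyMeasurable (μ := (volume : Measure E3))
  have m1 := hdc.continuous.aestronglyMeasurable (μ := (volume : Measure E3))
  have hw' : ∀ n, L2 (w n) := fun n => (hw n).memLp
  have hdw : ∀ n, L2 (partialDeriv j (w n)) := fun n => ((hw n).partialDeriv j).memLp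
  have t1 := L2Tendsto.const.ip (hw1.bdd_mul hw' hu n1) (fun _ => hu)
    (fun n => (hw' n).bdd_mul m1 n1) hu (hu.bdd_mul m1 n1)
  have t2 := L2Tendsto.const.ip ((hw2 j).bdd_mul hdw (hv j) n0) (fun _ => hu)
    (fun n => (hdw n).bdd_mul m0 n0) hu ((hv j).bdd_mul m0 n0)
  have t3 := L2Tendsto.const.ip (hw1.bdd_mul hw' hu n0) (fun _ => hv j)
    (fun n => (hw' n).bdd_mul m0 n0) (hv j) (hu.bdd_mul m0 n0)
  have e : ∀ n, ip u (fun x => ((partialDeriv j c x : ℝ) : ℂ) * w n x)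
      + ip u (fun x => (c x : ℂ) * partialDeriv j (w n) x)
      = - ip (v j) (fun x => (c x : ℂ) * w n x) := by
    intro n
    rw [← (h j).ip_eq ((hw n).mul_left hcc),
      ← ip_add_right ((hw' n).bdd_mul m1 n1) ((hdw n).bdd_mul m0 n0) hu]
    congr 1; ext x
    rw [partialDeriv_mul (hcc.differentiable (by simp) x) ((hw n).differentiable x),
      partialDeriv_ofReal (hc.differentiable (by simp) x)]
  have := tendsto_nhds_unique ((t1.add t2).congr e) t3.neg
  linear_combination this

/-! ### The operator `γ` on test functions -/

/-- The operator `γ` on smooth functions. -/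
def gam (ρ : ℝ → ℝ) (w : E3 → ℂ) (x : E3) : ℂ :=
  -Complex.I * qfun ρ w (fun j => partialDeriv j w) x

lemma IsTest.const_mul {η : E3 → ℂ} (h : IsTest η) (c : ℂ) : IsTest (fun x => c * η x) :=
  h.mul_left contDiff_const

section
variable {ρ : ℝ → ℝ}

lemma IsTest.qfun (hρ : IsBump ρ) {w : E3 → ℂ} (hw : IsTest w) :
    IsTest (qfun ρ w (fun j => NLSGamma.partialDeriv j w)) :=
  (IsTest.sum _ fun j => (hw.partialDeriv j).mul_left
    (contDiff_ofReal_comp (contDiff_bvec hρ j))).add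
    (hw.mul_left (contDiff_ofReal_comp (contDiff_cfun hρ)))

lemma IsTest.gam (hρ : IsBump ρ) {w : E3 → ℂ} (hw : IsTest w) : IsTest (gam ρ w) :=
  (hw.qfun hρ).const_mul _

lemma L2.real_mul_of_bound {f : E3 → ℂ} (hf : L2 f) {a : E3 → ℝ} {C : ℝ} (ha : Measurable a)
    (hC : ∀ x, |a x| ≤ C) : L2 (fun x => (a x : ℂ) * f x) :=
  hf.bdd_mul (C := C) (Complex.measurable_ofReal.comp ha).aestronglyMeasurable fun x => by
    rw [Complex.norm_real]; exact hC x

lemma ip_smul_right (c : ℂ) (f g : E3 → ℂ) :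
    ip f (fun x => c * g x) = (starRingEnd ℂ) c * ip f g := by
  rw [← ip_conj, ip_smul_left, map_mul, ip_conj]

lemma ip_sum_right {ι : Type*} (s : Finset ι) {f : ι → E3 → ℂ} {g : E3 → ℂ}
    (hf : ∀ i, L2 (f i)) (hg : L2 g) :
    ip g (fun x => ∑ i ∈ s, f i x) = ∑ i ∈ s, ip g (f i) := by
  rw [← ip_conj, ip_sum_left s hf hg, map_sum]
  simp only [ip_conj]

/-- `γ` is symmetric. -/
lemma ip_gam_comm (hρ : IsBump ρ) {w d : E3 → ℂ} (hw : IsTest w) (hd : IsTest d) :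
    ip w (gam ρ d) = ip (gam ρ w) d := by
  have hbw : ∀ j, IsTest (fun x => (bvec ρ j x : ℂ) * w x) := fun j =>
    hw.mul_left (contDiff_ofReal_comp (contDiff_bvec hρ j))
  have hb : ∀ j, IsTest (fun x => (bvec ρ j x : ℂ) * partialDeriv j d x) := fun j =>
    (hd.partialDeriv j).mul_left (contDiff_ofReal_comp (contDiff_bvec hρ j))
  have hbw' : ∀ j, IsTest (fun x => (bvec ρ j x : ℂ) * partialDeriv j w x) := fun j =>
    (hw.partialDeriv j).mul_left (contDiff_ofReal_comp (contDiff_bvec hρ j))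
  have hdw : ∀ j, IsTest (fun x => ((partialDeriv j (bvec ρ j) x : ℝ) : ℂ) * w x) := fun j =>
    hw.mul_left (contDiff_ofReal_comp (contDiff_partialDeriv (contDiff_bvec hρ j) j))
  have hc : IsTest (fun x => (cfun ρ x : ℂ) * d x) :=
    hd.mul_left (contDiff_ofReal_comp (contDiff_cfun hρ))
  have hcw : IsTest (fun x => (cfun ρ x : ℂ) * w x) :=
    hw.mul_left (contDiff_ofReal_comp (contDiff_cfun hρ))
  have e1 : ∀ j, ip w (fun x => (bvec ρ j x : ℂ) * partialDeriv j d x)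
      = - (ip (fun x => (bvec ρ j x : ℂ) * partialDeriv j w x) d
        + ip (fun x => ((partialDeriv j (bvec ρ j) x : ℝ) : ℂ) * w x) d) := by
    intro j
    rw [← ip_real_mul, ((hw.hasWeakPartial j).mul_smooth (contDiff_bvec hρ j)).ip_eq hd,
      ip_add_left (hbw' j).memLp (hdw j).memLp hd.memLp]
  -- The divergence of `∇⟨x⟩` is `2 cfun`. Integrating by parts therefore turns `+cfun` into `cfun -
  -- 2 cfun = -cfun`, which makes `qfun` antisymmetric and `γ` symmetric.
  have e2 : ∑ j, ip (fun x => ((partialDeriv j (bvec ρ j) x : ℝ) : ℂ) * w x) d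
      = 2 * ip (fun x => (cfun ρ x : ℂ) * w x) d := by
    rw [← ip_sum_left _ (fun j => (hdw j).memLp) hd.memLp, ← ip_smul_left]
    congr 1; ext x
    rw [cfun, ← Finset.sum_mul]; push_cast; ring
  have e3 : ip w (qfun ρ d fun j => partialDeriv j d)
      = - ip (qfun ρ w fun j => partialDeriv j w) d := by
    have a1 := ip_add_right (IsTest.sum Finset.univ hb).memLp hc.memLp hw.memLp
    have a2 := ip_add_left (IsTest.sum Finset.univ hbw').memLp hcw.memLp hd.memLp
    rw [ip_sum_right _ (fun j => (hb j).memLp) hw.memLp, ← ip_real_mul] at a1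
    rw [ip_sum_left _ (fun j => (hbw' j).memLp) hd.memLp] at a2
    simp only [e1, Finset.sum_neg_distrib, Finset.sum_add_distrib, e2] at a1
    change ip w (qfun ρ d fun j => partialDeriv j d) = _ at a1
    change ip (qfun ρ w fun j => partialDeriv j w) d = _ at a2
    rw [a1, a2]; ring
  have f1 : ip w (gam ρ d) = _ := ip_smul_right (-Complex.I) w (qfun ρ d fun j => partialDeriv j d)
  have f2 : ip (gam ρ w) d = _ := ip_smul_left (-Complex.I) (qfun ρ w fun j => partialDeriv j w) d
  rw [f1, f2, e3, map_neg, Complex.conj_I]; ring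

lemma partialDeriv_comm {f : E3 → ℂ} (hf : ContDiff ℝ ∞ f) (j k : Fin 3) (x : E3) :
    partialDeriv j (partialDeriv k f) x = partialDeriv k (partialDeriv j f) x := by
  have hd : DifferentiableAt ℝ (fderiv ℝ f) x :=
    ((hf.fderiv_right (m := ∞) (by simp)).differentiable (by simp)) x
  have e : ∀ j k, partialDeriv j (partialDeriv k f) x
      = fderiv ℝ (fderiv ℝ f) x (EuclideanSpace.single j 1) (EuclideanSpace.single k 1) := by
    intro j k
    change fderiv ℝ (fun y => fderiv ℝ f y (EuclideanSpace.single k 1)) x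
      (EuclideanSpace.single j 1) = _
    rw [fderiv_clm_apply hd (differentiableAt_const _)]
    simp
  rw [e, e]
  exact (hf.contDiffAt.isSymmSndFDerivAt (by simpa using ENat.LEInfty.out)).eq _ _

lemma partialDeriv_norm_sq {f : E3 → ℂ} {x : E3} (hf : DifferentiableAt ℝ f x) (j : Fin 3) :
    partialDeriv j (fun y => ‖f y‖ ^ 2) x
      = 2 * (partialDeriv j f x * (starRingEnd ℂ) (f x)).re := by
  have := hf.hasFDerivAt.norm_sq
  rw [partialDeriv, this.fderiv]
  simp [partialDeriv, Complex.inner]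
  ring

lemma contDiff_norm_sq_comp {f : E3 → ℂ} (hf : ContDiff ℝ ∞ f) :
    ContDiff ℝ ∞ (fun x => ‖f x‖ ^ 2) := hf.norm_sq ℝ

/-- Pure algebra at one point, with `p` the gradient and `P` the Hessian of `w`, `c = 1/|x|`, `d =
∇c`, and `∂ⱼbₖ = c (δⱼₖ - bⱼbₖ)` inserted. The first summand on the right is the angular energy. The
remaining ones are, because `div b = 2c` and `Δc = 0`, halves of the divergences of `b |∇w|²` and
`∇c |w|²`. -/
lemma commutator_identity (b d : Fin 3 → ℝ) (c : ℝ) (p : Fin 3 → ℂ) (P : Fin 3 → Fin 3 → ℂ) (w : ℂ)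
    (hP : ∀ j k, P j k = P k j) :
    (∑ j, p j * (starRingEnd ℂ) ((∑ k, (((c * ((if k = j then 1 else 0) - b j * b k) : ℝ) : ℂ) * p k
      + (b k : ℂ) * P j k)) + ((d j : ℂ) * w + (c : ℂ) * p j))).re
    = c * (∑ j, ‖p j‖ ^ 2 - ‖∑ j, (b j : ℂ) * p j‖ ^ 2)
      + (∑ k, b k * ∑ j, (P k j * (starRingEnd ℂ) (p j)).re + c * ∑ j, ‖p j‖ ^ 2)
      + ∑ j, d j * (p j * (starRingEnd ℂ) w).re := by
  have h1 := hP 0 1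
  have h2 := hP 0 2
  have h3 := hP 1 2
  simp only [← Complex.normSq_eq_norm_sq, Complex.normSq_apply, Fin.sum_univ_three, map_add,
    map_mul, Complex.conj_ofReal, Complex.add_re, Complex.mul_re, Complex.add_im, Complex.mul_im,
    Complex.ofReal_re, Complex.ofReal_im, Complex.conj_re, Complex.conj_im, h1, h2, h3]
  simp
  ring

/-- Positivity of the commutator `i[-Δ, γ]` outside a large ball. -/
lemma commutator_nonneg (hρ : IsBump ρ) {w : E3 → ℂ} (hw : IsTest w)
    (h0 : ∀ x, ‖x‖ < 3 → w x = 0) :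
    0 ≤ (-Complex.I * ∑ j, ip (partialDeriv j w) (partialDeriv j (gam ρ w))).re := by
  set Z := qfun ρ w (fun j => partialDeriv j w) with hZ
  have hZt : IsTest Z := hw.qfun hρ
  set S : E3 → ℝ := fun x => ∑ j, ‖partialDeriv j w x‖ ^ 2 with hS
  have hSc : ContDiff ℝ ∞ S := ContDiff.sum fun j _ => contDiff_norm_sq_comp (hw.partialDeriv j).1
  have hM : ContDiff ℝ ∞ (fun x => ‖w x‖ ^ 2) := contDiff_norm_sq_comp hw.1
  have hp : ∀ j, Differentiable ℝ (partialDeriv j w) := fun j => (hw.partialDeriv j).differentiable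
  have hb : ∀ k, ContDiff ℝ ∞ (bvec ρ k) := contDiff_bvec hρ
  have hc := contDiff_cfun hρ
  have hdc : ∀ j, ContDiff ℝ ∞ (partialDeriv j (cfun ρ)) := fun j => contDiff_partialDeriv hc j
  have hev : ∀ x, ‖x‖ < 3 → w =ᶠ[𝓝 x] fun _ => 0 := fun x hx => by
    filter_upwards [continuous_norm.continuousAt.eventually (gt_mem_nhds hx)] with y hy
      using h0 y hy
  have hpz : ∀ j x, ‖x‖ < 3 → partialDeriv j w x = 0 := fun j x hx => by
    rw [partialDeriv_congr (hev x hx)]; simp [partialDeriv]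
  -- the flux terms
  set A : Fin 3 → E3 → ℝ := fun k x => bvec ρ k x * S x with hA
  set D : Fin 3 → E3 → ℝ := fun k x => partialDeriv k (cfun ρ) x * ‖w x‖ ^ 2 with hD
  have hSupp : HasCompactSupport S := by
    have : ∀ j, HasCompactSupport (fun x => ‖partialDeriv j w x‖ ^ 2) := fun j =>
      (hw.partialDeriv j).2.comp_left (g := fun z : ℂ => ‖z‖ ^ 2) (by simp)
    have h := ((this 0).add (this 1)).add (this 2)
    simpa [hS, Fin.sum_univ_three, Pi.add_def] using h
  have hMs : HasCompactSupport (fun x => ‖w x‖ ^ 2) :=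
    hw.2.comp_left (g := fun z : ℂ => ‖z‖ ^ 2) (by simp)
  have hAc : ∀ k, ContDiff ℝ ∞ (A k) := fun k => (hb k).mul hSc
  have hDc : ∀ k, ContDiff ℝ ∞ (D k) := fun k => (hdc k).mul hM
  have hAs : ∀ k, HasCompactSupport (A k) := fun k => hSupp.mul_left
  have hDs : ∀ k, HasCompactSupport (D k) := fun k => hMs.mul_left
  have hA0 := fun k => integral_partialDeriv_eq_zero (hAc k) (hAs k) k
  have hD0 := fun k => integral_partialDeriv_eq_zero (hDc k) (hDs k) k
  have hcs : ∀ {f : E3 → ℝ} (j : Fin 3), HasCompactSupport f → HasCompactSupport (partialDeriv j f) :=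
    fun j hf => (hf.fderiv ℝ).comp_left
      (g := fun L : E3 →L[ℝ] ℝ => L (EuclideanSpace.single j 1)) (by simp)
  have hAi : ∀ k, Integrable (partialDeriv k (A k)) := fun k =>
    (contDiff_partialDeriv (hAc k) k).continuous.integrable_of_hasCompactSupport (hcs k (hAs k))
  have hDi : ∀ k, Integrable (partialDeriv k (D k)) := fun k =>
    (contDiff_partialDeriv (hDc k) k).continuous.integrable_of_hasCompactSupport (hcs k (hDs k))
  have hdA : ∀ k x, partialDeriv k (A k) x = partialDeriv k (bvec ρ k) x * S x
      + bvec ρ k x * ∑ j, 2 * (partialDeriv k (partialDeriv j w) x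
        * (starRingEnd ℂ) (partialDeriv j w x)).re := by
    intro k x
    rw [hA, partialDeriv_mul_real ((hb k).differentiable (by simp) x)
      (hSc.differentiable (by simp) x), hS, partialDeriv_sum _ (fun j =>
        (contDiff_norm_sq_comp (hw.partialDeriv j).1).differentiable (by simp) x)]
    simp only [partialDeriv_norm_sq (hp _ x)]
  have hdD : ∀ k x, partialDeriv k (D k) x = partialDeriv k (partialDeriv k (cfun ρ)) x * ‖w x‖ ^ 2
      + partialDeriv k (cfun ρ) x * (2 * (partialDeriv k w x * (starRingEnd ℂ) (w x)).re) := by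
    intro k x
    rw [hD, partialDeriv_mul_real ((hdc k).differentiable (by simp) x)
      (hM.differentiable (by simp) x), partialDeriv_norm_sq (hw.differentiable x)]
  have hdZ : ∀ j x, partialDeriv j Z x
      = (∑ k, (((partialDeriv j (bvec ρ k) x : ℝ) : ℂ) * partialDeriv k w x
        + (bvec ρ k x : ℂ) * partialDeriv j (partialDeriv k w) x))
        + (((partialDeriv j (cfun ρ) x : ℝ) : ℂ) * w x + (cfun ρ x : ℂ) * partialDeriv j w x) := by
    intro j x
    have d1 : ∀ k, DifferentiableAt ℝ (fun x => (bvec ρ k x : ℂ)) x := fun k =>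
      (contDiff_ofReal_comp (hb k)).differentiable (by simp) x
    have d2 : DifferentiableAt ℝ (fun x => (cfun ρ x : ℂ)) x :=
      (contDiff_ofReal_comp hc).differentiable (by simp) x
    have := partialDeriv_add (f := fun y => ∑ k, (bvec ρ k y : ℂ) * partialDeriv k w y)
      (g := fun y => (cfun ρ y : ℂ) * w y)
      (DifferentiableAt.fun_sum fun k _ => (d1 k).mul (hp k x)) (d2.mul (hw.differentiable x)) j
    rw [partialDeriv_sum (f := fun k y => (bvec ρ k y : ℂ) * partialDeriv k w y) _
      (fun k => (d1 k).mul (hp k x)),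
      partialDeriv_mul d2 (hw.differentiable x),
      partialDeriv_ofReal (hc.differentiable (by simp) x)] at this
    simp only [partialDeriv_mul (d1 _) (hp _ x),
      partialDeriv_ofReal ((hb _).differentiable (by simp) x)] at this
    exact this
  -- Pointwise, the integrand exceeds two exact divergences by `c (|∇w|² - |b · ∇w|²)`, which
  -- Cauchy–Schwarz makes nonnegative. The divergences integrate to zero.
  have hpt : ∀ x, (1 / 2 : ℝ) * ∑ k, partialDeriv k (A k) x + (1 / 2) * ∑ k, partialDeriv k (D k) x
      ≤ (∑ j, partialDeriv j w x * (starRingEnd ℂ) (partialDeriv j Z x)).re := by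
    intro x
    rcases lt_or_ge ‖x‖ 3 with hx | hx
    -- Where `⟨x⟩` is not the modulus, `w` vanishes together with its gradient and both sides are
    -- zero.
    · have hS0 : S x = 0 := by simp [hS, hpz _ x hx]
      simp [hdA, hdD, hpz _ x hx, h0 x hx, hS0]
    · have hx2 : 2 < ‖x‖ := by linarith
      have hcx : cfun ρ x = 1 / ‖x‖ := cfun_eq hx2
      have key := commutator_identity (fun j => bvec ρ j x) (fun j => partialDeriv j (cfun ρ) x)
        (cfun ρ x) (fun j => partialDeriv j w x)
        (fun j k => partialDeriv j (partialDeriv k w) x) (w x)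
        (fun j k => partialDeriv_comm hw.1 j k x)
      have e : ∀ j k, partialDeriv j (bvec ρ k) x
          = cfun ρ x * ((if k = j then 1 else 0) - bvec ρ j x * bvec ρ k x) := fun j k => by
        rw [partialDeriv_bvec hx2, hcx]; ring
      simp only [hdZ, e]
      rw [key]
      -- Harmonicity of `1/|x|` removes the `|w|²` part of this divergence.
      have hD2 : ∑ k, partialDeriv k (D k) x
          = 2 * ∑ j, partialDeriv j (cfun ρ) x * (partialDeriv j w x * (starRingEnd ℂ) (w x)).re := by
        simp only [hdD, Finset.sum_add_distrib, ← Finset.sum_mul, sum_partialDeriv_cfun hx2]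
        rw [zero_mul, zero_add, Finset.mul_sum]
        refine Finset.sum_congr rfl fun j _ => by ring
      have hA2 : ∑ k, partialDeriv k (A k) x = 2 * (cfun ρ x * S x)
          + 2 * ∑ k, bvec ρ k x * ∑ j, (partialDeriv k (partialDeriv j w) x
            * (starRingEnd ℂ) (partialDeriv j w x)).re := by
        simp only [hdA, Finset.sum_add_distrib, ← Finset.sum_mul, ← Finset.mul_sum]
        rw [Finset.mul_sum (a := (2 : ℝ))]
        congr 1
        · rw [cfun]; ring
        · refine Finset.sum_congr rfl fun j _ => by ring
      have hCS : ‖∑ j, (bvec ρ j x : ℂ) * partialDeriv j w x‖ ^ 2 ≤ S x := by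
        have h1 : ‖∑ j, (bvec ρ j x : ℂ) * partialDeriv j w x‖
            ≤ ∑ j, |bvec ρ j x| * ‖partialDeriv j w x‖ := by
          refine (norm_sum_le _ _).trans (le_of_eq ?_)
          refine Finset.sum_congr rfl fun j _ => by rw [norm_mul, Complex.norm_real]; rfl
        have h2 := Finset.sum_mul_sq_le_sq_mul_sq Finset.univ (fun j => |bvec ρ j x|)
          (fun j => ‖partialDeriv j w x‖)
        simp only [sq_abs, sum_bvec_sq hx2, one_mul] at h2
        exact (pow_le_pow_left₀ (norm_nonneg _) h1 2).trans h2
      have hc0 : 0 ≤ cfun ρ x := by rw [hcx]; positivity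
      have := mul_nonneg hc0 (sub_nonneg.2 hCS)
      rw [hD2, hA2]
      simp only [hS] at this ⊢
      linarith
  have hint : ∀ j, Integrable (fun x => partialDeriv j w x * (starRingEnd ℂ) (partialDeriv j Z x)) :=
    fun j => ip_integrable (hw.partialDeriv j).memLp (hZt.partialDeriv j).memLp
  have hsum : Integrable (fun x => ∑ j, partialDeriv j w x * (starRingEnd ℂ) (partialDeriv j Z x)) :=
    integrable_finsetSum _ fun j _ => hint j
  have e1 : -Complex.I * ∑ j, ip (partialDeriv j w) (partialDeriv j (gam ρ w))
      = ∫ x, ∑ j, partialDeriv j w x * (starRingEnd ℂ) (partialDeriv j Z x) := by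
    rw [integral_finsetSum _ (fun j _ => hint j), Finset.mul_sum]
    refine Finset.sum_congr rfl fun j _ => ?_
    have : partialDeriv j (gam ρ w) = fun x => -Complex.I * partialDeriv j Z x := by
      ext x
      exact partialDeriv_const_mul (-Complex.I) (hZt.differentiable x) j
    rw [this, ip_smul_right, map_neg, Complex.conj_I, ip]
    linear_combination (-(∫ x, partialDeriv j w x * (starRingEnd ℂ) (partialDeriv j Z x)))
      * Complex.I_mul_I
  rw [e1]
  have hre : (∫ x, ∑ j, partialDeriv j w x * (starRingEnd ℂ) (partialDeriv j Z x)).re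
      = ∫ x, (∑ j, partialDeriv j w x * (starRingEnd ℂ) (partialDeriv j Z x)).re :=
    (integral_re hsum).symm
  rw [hre]
  have hi1 : Integrable (fun x => (1 / 2 : ℝ) * ∑ k, partialDeriv k (A k) x) :=
    (integrable_finsetSum _ fun k _ => hAi k).const_mul _
  have hi2 : Integrable (fun x => (1 / 2 : ℝ) * ∑ k, partialDeriv k (D k) x) :=
    (integrable_finsetSum _ fun k _ => hDi k).const_mul _
  have := integral_mono (hi1.add hi2) hsum.re hpt
  rw [integral_add' hi1 hi2, integral_const_mul, integral_const_mul,
    integral_finsetSum _ (fun k _ => hAi k), integral_finsetSum _ (fun k _ => hDi k)] at this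
  simpa [hA0, hD0] using this

end

/-! ### The solution as a curve of `H¹` functions -/

/-- The properties of a solution that enter the propagation estimate. -/
structure SolutionCurve (N : ℝ → ℝ → ℝ → ℂ) (φ : ℝ → E3 → ℂ) (v : ℝ → Fin 3 → E3 → ℂ) (M : ℝ) :
    Prop where
  memL2 : ∀ t, 0 ≤ t → L2 (φ t)
  nn_le : ∀ t, 0 ≤ t → nn (φ t) ≤ M
  weak : ∀ t, 0 ≤ t → ∀ j, HasWeakPartial j (φ t) (v t j)
  grad_memL2 : ∀ t, 0 ≤ t → ∀ j, L2 (v t j)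
  grad_nn_le : ∀ t, 0 ≤ t → ∀ j, nn (v t j) ≤ M
  cont : ∀ s, 0 ≤ s → L2Tendsto φ (𝓝[Ici 0] s) (φ s)
  equation : ∀ η : E3 → ℂ, IsTest η → ∀ s t, 0 ≤ s → s ≤ t →
    Complex.I * ((∫ x, φ t x * η x) - ∫ x, φ s x * η x)
        + ∫ τ in s..t, ∫ x, φ τ x * Laplacian.laplacian η x
      = ∫ τ in s..t, ∫ x, interaction N φ τ x * η x

/-- A family of spatial cutoffs supported away from the origin which controls the interaction. -/
structure CutoffFamily (ρ : ℝ → ℝ) (N : ℝ → ℝ → ℝ → ℂ) (φ : ℝ → E3 → ℂ) (T₀ C β₀ : ℝ)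
    (a a' : ℝ → E3 → ℝ) : Prop where
  one_le : 1 ≤ T₀
  nonneg : 0 ≤ C
  decay_pos : 0 ≤ β₀
  smooth : ∀ t, T₀ ≤ t → ContDiff ℝ ∞ (a t)
  vanish : ∀ t, T₀ ≤ t → ∀ x, ‖x‖ < 4 → a t x = 0
  supp : ∃ R, ∀ t, T₀ ≤ t → ∀ x, R ≤ jap ρ x → a t x = 0
  abs_le : ∀ t, T₀ ≤ t → ∀ x, |a t x| ≤ 1
  partial_le : ∀ t, T₀ ≤ t → ∀ j x, |partialDeriv j (a t) x| ≤ C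
  partial2_le : ∀ t, T₀ ≤ t → ∀ j x, |partialDeriv j (partialDeriv j (a t)) x| ≤ C
  time : ∀ t, T₀ ≤ t → ∀ x, HasDerivAt (fun s => a s x) (a' t x) t
  time_le : ∀ t, T₀ ≤ t → ∀ x, |a' t x| ≤ C
  time_meas : ∀ t, T₀ ≤ t → Measurable (a' t)
  -- Two times occur: the cutoff at the later time `t` controls the interaction at the earlier time
  -- `s`. This is the form needed when the equation on `[s, t]` is tested with the cutoff frozen at
  -- `t`.
  interaction : ∀ s t, T₀ ≤ s → s ≤ t → ∀ᵐ x : E3,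
    ‖(a t x : ℂ) * N ‖φ s x‖ ‖x‖ s‖ ≤ C * s ^ (-β₀)

section
variable {ρ : ℝ → ℝ} {N : ℝ → ℝ → ℝ → ℂ} {φ : ℝ → E3 → ℂ} {v : ℝ → Fin 3 → E3 → ℂ} {M : ℝ}

lemma laplacian_test {η : E3 → ℂ} (hη : IsTest η) : IsTest (Laplacian.laplacian η) := by
  have : Laplacian.laplacian η = fun x => ∑ j, partialDeriv j (partialDeriv j η) x :=
    funext fun x => laplacian_eq_sum hη.1 x
  rw [this]
  exact IsTest.sum _ fun j => (hη.partialDeriv j).partialDeriv j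

lemma laplacian_conj {η : E3 → ℂ} (hη : IsTest η) (x : E3) :
    Laplacian.laplacian (fun y => (starRingEnd ℂ) (η y)) x
      = (starRingEnd ℂ) (Laplacian.laplacian η x) := by
  rw [laplacian_eq_sum hη.conj.1, laplacian_eq_sum hη.1, map_sum]
  refine Finset.sum_congr rfl fun j _ => ?_
  have : partialDeriv j (fun y => (starRingEnd ℂ) (η y))
      = fun y => (starRingEnd ℂ) (partialDeriv j η y) :=
    funext fun y => partialDeriv_conj (hη.differentiable y) j
  rw [this, partialDeriv_conj ((hη.partialDeriv j).differentiable x)]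

namespace SolutionCurve

lemma M_nonneg (h : SolutionCurve N φ v M) : 0 ≤ M := (nn_nonneg _).trans (h.nn_le 0 le_rfl)

/-- The equation in terms of the `L²` pairing. -/
lemma ip_equation (h : SolutionCurve N φ v M) {η : E3 → ℂ} (hη : IsTest η) {s t : ℝ} (hs : 0 ≤ s)
    (hst : s ≤ t) : ip (φ t) η - ip (φ s) η
      = Complex.I * (∫ τ in s..t, ip (φ τ) (Laplacian.laplacian η)) - Complex.I * ∫ τ in s..t, ip (interaction N φ τ) η := by
  have e := h.equation _ hη.conj s t hs hst
  simp only [laplacian_conj hη] at e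
  simp only [ip]
  linear_combination (-Complex.I) * e
    + ((∫ x, φ t x * (starRingEnd ℂ) (η x)) - ∫ x, φ s x * (starRingEnd ℂ) (η x)) * Complex.I_mul_I

lemma ip_laplacian (h : SolutionCurve N φ v M) {η : E3 → ℂ} (hη : IsTest η) {t : ℝ} (ht : 0 ≤ t) :
    ip (φ t) (Laplacian.laplacian η) = - ∑ j, ip (v t j) (partialDeriv j η) := by
  have : Laplacian.laplacian η = fun x => ∑ j, partialDeriv j (partialDeriv j η) x :=
    funext fun x => laplacian_eq_sum hη.1 x
  rw [this, ip_sum_right _ (fun j => ((hη.partialDeriv j).partialDeriv j).memLp) (h.memL2 t ht),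
    ← Finset.sum_neg_distrib]
  exact Finset.sum_congr rfl fun j _ => (h.weak t ht j).ip_eq (hη.partialDeriv j)

/-- One derivative of the Laplacian is moved to the solution, whose gradient is bounded in `L²`.
Only first derivatives of the test function then enter. -/
lemma norm_ip_laplacian_le (h : SolutionCurve N φ v M) {η : E3 → ℂ} (hη : IsTest η) {t : ℝ}
    (ht : 0 ≤ t) :
    ‖ip (φ t) (Laplacian.laplacian η)‖ ≤ M * ∑ j, nn (partialDeriv j η) := by
  rw [h.ip_laplacian hη ht, norm_neg, Finset.mul_sum]
  refine (norm_sum_le _ _).trans (Finset.sum_le_sum fun j _ => ?_)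
  exact (norm_ip_le (h.grad_memL2 t ht j) (hη.partialDeriv j).memLp).trans
    (mul_le_mul_of_nonneg_right (h.grad_nn_le t ht j) (nn_nonneg _))

lemma continuousOn_ip (h : SolutionCurve N φ v M) {η : E3 → ℂ} (hη : L2 η) :
    ContinuousOn (fun t => ip (φ t) η) (Ici 0) := by
  intro s hs
  rw [ContinuousWithinAt, tendsto_iff_norm_sub_tendsto_zero]
  have hu := Tendsto.mul_const (nn η) (h.cont s hs)
  rw [zero_mul] at hu
  refine tendsto_of_tendsto_of_tendsto_of_le_of_le' tendsto_const_nhds hu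
    (Eventually.of_forall fun _ => norm_nonneg _) ?_
  filter_upwards [self_mem_nhdsWithin] with t ht
  rw [← ip_sub_left (h.memL2 t ht) (h.memL2 s hs) hη]
  exact norm_ip_le ((h.memL2 t ht).sub (h.memL2 s hs)) hη

end SolutionCurve

variable {T₀ C β₀ : ℝ} {a a' : ℝ → E3 → ℝ}

/-! ### Time increments of the cutoffs and of the tested equation. -/

namespace CutoffFamily

lemma pos (hc : CutoffFamily ρ N φ T₀ C β₀ a a') {t : ℝ} (ht : T₀ ≤ t) : 0 ≤ t :=
  zero_le_one.trans (hc.one_le.trans ht)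

lemma abs_sub_le (hc : CutoffFamily ρ N φ T₀ C β₀ a a') {s t : ℝ} (hs : T₀ ≤ s) (hst : s ≤ t)
    (x : E3) : |a t x - a s x| ≤ C * (t - s) := by
  have := (convex_Icc s t).norm_image_sub_le_of_norm_hasDerivWithin_le (f := fun τ => a τ x)
    (f' := fun τ => a' τ x) (C := C)
    (fun τ hτ => (hc.time τ (hs.trans hτ.1) x).hasDerivWithinAt)
    (fun τ hτ => hc.time_le τ (hs.trans hτ.1) x) (left_mem_Icc.2 hst) (right_mem_Icc.2 hst)
  simpa [Real.norm_eq_abs, abs_of_nonneg (sub_nonneg.2 hst)] using this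

/-- Estimate for the equation tested against a function dominated by the cutoff. -/
lemma norm_ip_sub_le (hc : CutoffFamily ρ N φ T₀ C β₀ a a') (h : SolutionCurve N φ v M)
    {η θ : E3 → ℂ} (hη : IsTest η) (hθ : L2 θ) {s t : ℝ} (hs : T₀ ≤ s) (hst : s ≤ t)
    (hle : ∀ x, η x = (a t x : ℂ) * θ x) :
    ‖ip (φ t) η - ip (φ s) η - Complex.I * ∫ τ in s..t, ip (φ τ) (Laplacian.laplacian η)‖
      ≤ C * s ^ (-β₀) * M * nn θ * (t - s) := by
  have hs0 : 0 < s := lt_of_lt_of_le one_pos (hc.one_le.trans hs)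
  rw [h.ip_equation hη hs0.le hst, sub_sub_cancel_left, norm_neg, norm_mul, Complex.norm_I, one_mul]
  have := intervalIntegral.norm_integral_le_of_norm_le_const (a := s) (b := t)
    (f := fun τ => ip (NLSGamma.interaction N φ τ) η) (C := C * s ^ (-β₀) * M * nn θ) ?_
  · rwa [abs_of_nonneg (sub_nonneg.2 hst)] at this
  intro τ hτ
  rw [uIoc_of_le hst] at hτ
  have hτ0 : 0 ≤ τ := hs0.le.trans hτ.1.le
  have hφ := h.memL2 τ hτ0
  have hint : Integrable (fun x => ‖φ τ x‖ * ‖θ x‖) := hφ.norm.integrable_mul hθ.norm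
  have h1 : ‖ip (NLSGamma.interaction N φ τ) η‖ ≤ ∫ x, C * τ ^ (-β₀) * (‖φ τ x‖ * ‖θ x‖) := by
    refine norm_integral_le_of_norm_le (hint.const_mul _) ?_
    filter_upwards [hc.interaction τ t (hs.trans hτ.1.le) hτ.2] with x hx
    rw [NLSGamma.interaction, norm_mul, norm_mul, RCLike.norm_conj, hle, norm_mul]
    rw [norm_mul] at hx
    have := mul_le_mul_of_nonneg_right hx (mul_nonneg (norm_nonneg (φ τ x)) (norm_nonneg (θ x)))
    refine le_trans (le_of_eq ?_) this
    ring
  refine h1.trans ?_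
  have hCS : ∫ x, ‖φ τ x‖ * ‖θ x‖ ≤ nn (φ τ) * nn θ := by
    have hφ' : L2 (fun x => ((‖φ τ x‖ : ℝ) : ℂ)) := hφ.norm.ofReal
    have hθ' : L2 (fun x => ((‖θ x‖ : ℝ) : ℂ)) := hθ.norm.ofReal
    have e := norm_ip_le hφ' hθ'
    have e1 : nn (fun x => ((‖φ τ x‖ : ℝ) : ℂ)) ≤ 1 * nn (φ τ) :=
      nn_le_of_le zero_le_one hφ (Eventually.of_forall fun x => by simp)
    have e2 : nn (fun x => ((‖θ x‖ : ℝ) : ℂ)) ≤ 1 * nn θ :=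
      nn_le_of_le zero_le_one hθ (Eventually.of_forall fun x => by simp)
    rw [one_mul] at e1 e2
    have e3 : ip (fun x => ((‖φ τ x‖ : ℝ) : ℂ)) (fun x => ((‖θ x‖ : ℝ) : ℂ))
        = ((∫ x, ‖φ τ x‖ * ‖θ x‖ : ℝ) : ℂ) := by
      rw [ip, ← integral_complex_ofReal]
      congr 1; ext x
      rw [Complex.conj_ofReal]; push_cast; ring
    rw [e3, Complex.norm_real] at e
    exact (le_abs_self _).trans (e.trans (mul_le_mul e1 e2 (nn_nonneg _) (nn_nonneg _)))
  rw [integral_const_mul, mul_assoc _ M]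
  -- The decay rate is evaluated at the left endpoint, where the power is largest on the interval.
  have hpow : τ ^ (-β₀) ≤ s ^ (-β₀) :=
    Real.rpow_le_rpow_of_nonpos hs0 hτ.1.le (neg_nonpos.2 hc.decay_pos)
  have hM := h.M_nonneg
  have hN := h.nn_le τ hτ0
  have hC := hc.nonneg
  have : 0 ≤ τ ^ (-β₀) := Real.rpow_nonneg hτ0 _
  refine mul_le_mul (by gcongr) (hCS.trans (by gcongr; exact nn_nonneg _))
    (integral_nonneg fun x => by positivity) (by positivity)

end CutoffFamily

/-- The mollified truncation of the solution. -/
def trunc (n : ℕ) (a : ℝ → E3 → ℝ) (φ : ℝ → E3 → ℂ) (t : ℝ) : E3 → ℂ :=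
  moll n (fun x => (a t x : ℂ) * φ t x)

/-- The regularised observable. -/
def mreg (ρ : ℝ → ℝ) (n : ℕ) (a : ℝ → E3 → ℝ) (φ : ℝ → E3 → ℂ) (t : ℝ) : ℝ :=
  (ip (trunc n a φ t) (gam ρ (trunc n a φ t))).re

lemma nn_gam_le (hρ : IsBump ρ) {B : ℝ} (hb : ∀ j x, |bvec ρ j x| ≤ B) (hc : ∀ x, |cfun ρ x| ≤ B)
    {w : E3 → ℂ} (hw : IsTest w) :
    nn (gam ρ w) ≤ B * (∑ j, nn (partialDeriv j w) + nn w) := by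
  have h1 : ∀ j, L2 (fun x => (bvec ρ j x : ℂ) * partialDeriv j w x) := fun j =>
    ((hw.partialDeriv j).mul_left (contDiff_ofReal_comp (contDiff_bvec hρ j))).memLp
  have h2 : L2 (fun x => (cfun ρ x : ℂ) * w x) :=
    (hw.mul_left (contDiff_ofReal_comp (contDiff_cfun hρ))).memLp
  have e : nn (gam ρ w) = nn (qfun ρ w fun j => partialDeriv j w) := by
    have := nn_smul (-Complex.I) (f := qfun ρ w fun j => partialDeriv j w)
    rw [norm_neg, Complex.norm_I, one_mul] at this
    exact this
  rw [e, mul_add, Finset.mul_sum]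
  refine (nn_add_le (L2.sum _ h1) h2).trans (add_le_add ?_ ?_)
  · refine (nn_sum_le _ h1).trans (Finset.sum_le_sum fun j _ => ?_)
    exact nn_bdd_mul_le (hw.partialDeriv j).memLp fun x => by
      rw [Complex.norm_real]; exact hb j x
  · exact nn_bdd_mul_le hw.memLp fun x => by rw [Complex.norm_real]; exact hc x

lemma gam_sub {w d : E3 → ℂ} (hw : IsTest w) (hd : IsTest d) :
    gam ρ (fun x => w x - d x) = fun x => gam ρ w x - gam ρ d x := by
  ext x
  simp only [gam, qfun, partialDeriv_sub (hw.differentiable x) (hd.differentiable x), mul_sub,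
    Finset.sum_sub_distrib]
  ring

/-! ### Estimates for the mollified truncations and their time increments. -/

namespace CutoffFamily

lemma memL2_mul (hc : CutoffFamily ρ N φ T₀ C β₀ a a') {t : ℝ} (ht : T₀ ≤ t) {f : E3 → ℂ} (hf : L2 f) : L2 (fun x => (a t x : ℂ) * f x) :=
  hf.real_mul_of_bound (hc.smooth t ht).continuous.measurable (hc.abs_le t ht)

lemma nn_mul_le (hc : CutoffFamily ρ N φ T₀ C β₀ a a') {t : ℝ} (ht : T₀ ≤ t) {f : E3 → ℂ} (hf : L2 f) :
    nn (fun x => (a t x : ℂ) * f x) ≤ nn f := by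
  have := nn_bdd_mul_le (a := fun x => (a t x : ℂ)) (C := 1) hf fun x => by
    rw [Complex.norm_real]; exact hc.abs_le t ht x
  rwa [one_mul] at this

lemma memL2_partial (hc : CutoffFamily ρ N φ T₀ C β₀ a a') {t : ℝ} (ht : T₀ ≤ t) {f : E3 → ℂ} (hf : L2 f) (j : Fin 3) :
    L2 (fun x => ((partialDeriv j (a t) x : ℝ) : ℂ) * f x) :=
  hf.real_mul_of_bound (contDiff_partialDeriv (hc.smooth t ht) j).continuous.measurable
    (hc.partial_le t ht j)

lemma nn_partial_le (hc : CutoffFamily ρ N φ T₀ C β₀ a a') {t : ℝ} (ht : T₀ ≤ t) {f : E3 → ℂ} (hf : L2 f) (j : Fin 3) :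
    nn (fun x => ((partialDeriv j (a t) x : ℝ) : ℂ) * f x) ≤ C * nn f :=
  nn_bdd_mul_le hf fun x => by rw [Complex.norm_real]; exact hc.partial_le t ht j x

lemma memL2_time (hc : CutoffFamily ρ N φ T₀ C β₀ a a') {t : ℝ} (ht : T₀ ≤ t) {f : E3 → ℂ} (hf : L2 f) :
    L2 (fun x => (a' t x : ℂ) * f x) :=
  hf.real_mul_of_bound (hc.time_meas t ht) (hc.time_le t ht)


/-- Truncation supplies compact support and mollification supplies smoothness. Consequently `γ` of a
truncation is an admissible test function for the equation. -/
lemma isTest_trunc (hc : CutoffFamily ρ N φ T₀ C β₀ a a')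
    (h : SolutionCurve N φ v M) (n : ℕ) {t : ℝ} (ht : T₀ ≤ t) : IsTest (trunc n a φ t) := by
  obtain ⟨R, hR⟩ := hc.supp
  refine IsTest.conv (hc.memL2_mul ht (h.memL2 t (hc.pos ht))).locallyIntegrable
    (hasCompactSupport_of_jap (ρ := ρ) (R := R) fun x hx => ?_) (isTest_kappa n)
  rw [hR t ht x hx]; simp

/-- Mollification enlarges the support by at most `1`, which reduces the excluded radius from `4` to
the `3` required by `commutator_nonneg`. -/
lemma trunc_eq_zero (hc : CutoffFamily ρ N φ T₀ C β₀ a a') (n : ℕ) {t : ℝ} (ht : T₀ ≤ t) {x : E3} (hx : ‖x‖ < 3) :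
    trunc n a φ t x = 0 := by
  refine conv_eq_zero (δ := 1 / ((n : ℝ) + 1)) (kappa_eq_zero n) fun y hy => ?_
  have h1 : 1 / ((n : ℝ) + 1) ≤ 1 := by
    rw [div_le_one (by positivity)]; linarith [(Nat.cast_nonneg n : (0 : ℝ) ≤ n)]
  have : ‖y‖ < 4 := by
    have := norm_sub_norm_le y x
    rw [norm_sub_rev] at this
    linarith
  rw [hc.vanish t ht y this]; simp

lemma partialDeriv_trunc (hc : CutoffFamily ρ N φ T₀ C β₀ a a')
    (h : SolutionCurve N φ v M) (n : ℕ) {t : ℝ} (ht : T₀ ≤ t) (j : Fin 3) :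
    partialDeriv j (trunc n a φ t) = moll n (fun x => (a t x : ℂ) * v t j x
      + ((partialDeriv j (a t) x : ℝ) : ℂ) * φ t x) :=
  funext fun x => partialDeriv_conv_of_weak
    ((h.weak t (hc.pos ht) j).mul_smooth (hc.smooth t ht)) (isTest_kappa n) x

/-- The bound does not depend on `n`, because the derivative in `γ` is placed on the solution and
the cutoff rather than on the mollifying kernel. -/
lemma nn_gam_trunc_le (hc : CutoffFamily ρ N φ T₀ C β₀ a a')
    (h : SolutionCurve N φ v M) (hρ : IsBump ρ) {B : ℝ} (hb : ∀ j x, |bvec ρ j x| ≤ B)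
    (hcf : ∀ x, |cfun ρ x| ≤ B) (n : ℕ) {t : ℝ} (ht : T₀ ≤ t) :
    nn (gam ρ (trunc n a φ t)) ≤ B * (3 * (M + C * M) + M) := by
  have ht0 := hc.pos ht
  have hB : 0 ≤ B := (abs_nonneg _).trans (hcf 0)
  have hC := hc.nonneg
  refine (nn_gam_le hρ hb hcf (hc.isTest_trunc h n ht)).trans (mul_le_mul_of_nonneg_left ?_ hB)
  have h1 : ∀ j, nn (partialDeriv j (trunc n a φ t)) ≤ M + C * M := by
    intro j
    have l1 := hc.memL2_mul ht (h.grad_memL2 t ht0 j)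
    have l2 := hc.memL2_partial ht (h.memL2 t ht0) j
    rw [hc.partialDeriv_trunc h n ht]
    refine (nn_moll_le n (l1.add l2)).trans ((nn_add_le l1 l2).trans (add_le_add ?_ ?_))
    · exact (hc.nn_mul_le ht (h.grad_memL2 t ht0 j)).trans (h.grad_nn_le t ht0 j)
    · exact (hc.nn_partial_le ht (h.memL2 t ht0) j).trans
        (mul_le_mul_of_nonneg_left (h.nn_le t ht0) hC)
  have h2 : nn (trunc n a φ t) ≤ M := (nn_moll_le n (hc.memL2_mul ht (h.memL2 t ht0))).trans
    ((hc.nn_mul_le ht (h.memL2 t ht0)).trans (h.nn_le t ht0))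
  rw [Fin.sum_univ_three]
  linarith [h1 0, h1 1, h1 2]

/-- The difference of two truncations, paired with a test function. -/
lemma ip_trunc_sub (hc : CutoffFamily ρ N φ T₀ C β₀ a a')
    (h : SolutionCurve N φ v M) (n : ℕ) {s t : ℝ} (hs : T₀ ≤ s) (ht : T₀ ≤ t) {ζ : E3 → ℂ} (hζ : IsTest ζ) :
    ip (fun x => trunc n a φ t x - trunc n a φ s x) ζ
      = (ip (φ t) (fun x => (a t x : ℂ) * moll n ζ x) - ip (φ s) (fun x => (a t x : ℂ) * moll n ζ x))
        + ip (fun x => ((a t x - a s x : ℝ) : ℂ) * φ s x) (moll n ζ) := by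
  have l1 := hc.memL2_mul ht (h.memL2 t (hc.pos ht))
  have l2 := hc.memL2_mul hs (h.memL2 s (hc.pos hs))
  have l3 := hc.memL2_mul ht (h.memL2 s (hc.pos hs))
  have hm := L2_moll n hζ.memLp
  have e : (fun x => ((a t x - a s x : ℝ) : ℂ) * φ s x)
      = fun x => (a t x : ℂ) * φ s x - (a s x : ℂ) * φ s x := by
    ext x; push_cast; ring
  have e1 : ip (trunc n a φ t) ζ = _ := ip_moll n l1 hζ.memLp
  have e2 : ip (trunc n a φ s) ζ = _ := ip_moll n l2 hζ.memLp
  have e0 : ip (fun x => trunc n a φ t x - trunc n a φ s x) ζ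
      = ip (trunc n a φ t) ζ - ip (trunc n a φ s) ζ :=
    ip_sub_left (L2_moll n l1) (L2_moll n l2) hζ.memLp
  -- The discrete product rule `a_t φ_t - a_s φ_s = a_t (φ_t - φ_s) + (a_t - a_s) φ_s`, after the
  -- symmetric mollifier has been moved to `ζ`.
  rw [e0, e1, e2, ← ip_real_mul, ← ip_real_mul, e, ip_sub_left l3 l2 hm]
  ring

lemma isTest_mul_moll (hc : CutoffFamily ρ N φ T₀ C β₀ a a') (n : ℕ) {t : ℝ} (ht : T₀ ≤ t) {ζ : E3 → ℂ} (hζ : IsTest ζ) :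
    IsTest (fun x => (a t x : ℂ) * moll n ζ x) :=
  (IsTest.conv hζ.memLp.locallyIntegrable hζ.2 (isTest_kappa n)).mul_left
    (contDiff_ofReal_comp (hc.smooth t ht))

lemma nn_time_diff_le (hc : CutoffFamily ρ N φ T₀ C β₀ a a')
    (h : SolutionCurve N φ v M) {s t : ℝ} (hs : T₀ ≤ s) (hst : s ≤ t) :
    L2 (fun x => ((a t x - a s x : ℝ) : ℂ) * φ s x) ∧
      nn (fun x => ((a t x - a s x : ℝ) : ℂ) * φ s x) ≤ C * (t - s) * M := by
  have hC := hc.nonneg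
  refine ⟨(h.memL2 s (hc.pos hs)).real_mul_of_bound (((hc.smooth t (hs.trans hst)).continuous.sub
    (hc.smooth s hs).continuous).measurable) (hc.abs_sub_le hs hst), ?_⟩
  refine (nn_bdd_mul_le (h.memL2 s (hc.pos hs)) (C := C * (t - s)) fun x => ?_).trans ?_
  · rw [Complex.norm_real]; exact hc.abs_sub_le hs hst x
  · exact mul_le_mul_of_nonneg_left (h.nn_le s (hc.pos hs))
      (mul_nonneg hC (sub_nonneg.2 hst))

/-- The truncations are Lipschitz in time with values in `L²`. -/
lemma exists_lipschitz (hc : CutoffFamily ρ N φ T₀ C β₀ a a')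
    (h : SolutionCurve N φ v M) (n : ℕ) : ∃ K, 0 ≤ K ∧ ∀ s t, T₀ ≤ s → s ≤ t →
    nn (fun x => trunc n a φ t x - trunc n a φ s x) ≤ K * (t - s) := by
  have hC := hc.nonneg
  have hM := h.M_nonneg
  -- The `L¹` norms of the gradient of the kernel. They make the Lipschitz constant depend on `n`,
  -- which is harmless because `n` is fixed during differentiation in time.
  set k : Fin 3 → ℝ := fun j => ∫ x, ‖partialDeriv j (kappa n) x‖ with hk
  have hk0 : ∀ j, 0 ≤ k j := fun j => integral_nonneg fun x => norm_nonneg _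
  refine ⟨M * ∑ j, (C + k j) + C * M + C * M, by positivity, fun s t hs hst => ?_⟩
  have ht := hs.trans hst
  set D : E3 → ℂ := fun x => trunc n a φ t x - trunc n a φ s x with hD
  have hDt : IsTest D := (hc.isTest_trunc h n ht).sub (hc.isTest_trunc h n hs)
  have hs1 : 1 ≤ s := hc.one_le.trans hs
  have hst0 := sub_nonneg.2 hst
  have hDn := nn_nonneg D
  -- Duality: the increment `D` is paired with itself. Moving the mollifier and the cutoff to the
  -- other side gives this test function, whose factor `a t` tames the interaction.
  set η : E3 → ℂ := fun x => (a t x : ℂ) * moll n D x with hη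
  have hηt : IsTest η := hc.isTest_mul_moll n ht hDt
  have hmD := L2_moll n hDt.memLp
  have hpD : ∀ j, L2 (partialDeriv j (moll n D)) := fun j =>
    ((IsTest.conv hDt.memLp.locallyIntegrable hDt.2 (isTest_kappa n)).partialDeriv j).memLp
  have b1 : ∀ j, nn (partialDeriv j η) ≤ (C + k j) * nn D := by
    intro j
    have hJd : Differentiable ℝ (moll n D) :=
      (IsTest.conv hDt.memLp.locallyIntegrable hDt.2 (isTest_kappa n)).differentiable
    have e : partialDeriv j η = fun x => ((partialDeriv j (a t) x : ℝ) : ℂ) * moll n D x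
        + (a t x : ℂ) * partialDeriv j (moll n D) x := by
      ext x
      rw [hη, partialDeriv_mul ((contDiff_ofReal_comp (hc.smooth t ht)).differentiable (by simp) x)
        (hJd x),
        partialDeriv_ofReal ((hc.smooth t ht).differentiable (by simp) x)]
    have e2 : nn (partialDeriv j (moll n D)) ≤ k j * nn D := by
      have : partialDeriv j (moll n D) = conv D (partialDeriv j (kappa n)) :=
        funext fun x => partialDeriv_conv hDt.memLp.locallyIntegrable (isTest_kappa n) j x
      rw [this]
      exact nn_conv_le hDt.memLp ((isTest_kappa n).partialDeriv j)
    rw [e, add_mul]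
    refine (nn_add_le (hc.memL2_partial ht hmD j) (hc.memL2_mul ht (hpD j))).trans
      (add_le_add ?_ ((hc.nn_mul_le ht (hpD j)).trans e2))
    exact (hc.nn_partial_le ht hmD j).trans (mul_le_mul_of_nonneg_left (nn_moll_le n hDt.memLp) hC)
  have b2 := hc.norm_ip_sub_le h hηt hmD hs hst (fun x => rfl)
  have b3 : ‖∫ τ in s..t, ip (φ τ) (Laplacian.laplacian η)‖
      ≤ M * (∑ j, (C + k j)) * nn D * (t - s) := by
    have := intervalIntegral.norm_integral_le_of_norm_le_const (a := s) (b := t)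
      (f := fun τ => ip (φ τ) (Laplacian.laplacian η)) (C := M * (∑ j, (C + k j)) * nn D) ?_
    · rwa [abs_of_nonneg hst0] at this
    intro τ hτ
    rw [uIoc_of_le hst] at hτ
    refine (h.norm_ip_laplacian_le hηt (by linarith [hτ.1])).trans ?_
    rw [mul_assoc, Finset.sum_mul]
    exact mul_le_mul_of_nonneg_left (Finset.sum_le_sum fun j _ => b1 j) hM
  obtain ⟨l4, b4⟩ := hc.nn_time_diff_le h hs hst
  have b5 := (norm_ip_le l4 hmD).trans (mul_le_mul b4 (nn_moll_le n hDt.memLp) (nn_nonneg _)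
    (by positivity))
  have hpow : s ^ (-β₀) ≤ 1 := Real.rpow_le_one_of_one_le_of_nonpos hs1 (neg_nonpos.2 hc.decay_pos)
  have hpow0 : 0 ≤ s ^ (-β₀) := Real.rpow_nonneg (by linarith) _
  have b6 : C * s ^ (-β₀) * M * nn (moll n D) * (t - s) ≤ C * M * nn D * (t - s) := by
    have := nn_moll_le n hDt.memLp
    have h1 : C * s ^ (-β₀) ≤ C := mul_le_of_le_one_right hC hpow
    have := nn_nonneg (moll n D)
    gcongr
  have hsq : nn D ^ 2 = ‖ip D D‖ := by
    rw [ip_self hDt.memLp, Complex.norm_real, Real.norm_of_nonneg (sq_nonneg _)]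
  -- The interaction, the Laplacian and the motion of the cutoff each contribute a multiple of `(t -
  -- s) ‖D‖`. One factor `‖D‖` is then cancelled.
  have hmain : nn D ^ 2 ≤ (M * ∑ j, (C + k j) + C * M + C * M) * (t - s) * nn D := by
    rw [hsq, hc.ip_trunc_sub h n hs ht hDt]
    refine (norm_add_le _ _).trans ?_
    have e := norm_add_le (ip (φ t) η - ip (φ s) η
      - Complex.I * ∫ τ in s..t, ip (φ τ) (Laplacian.laplacian η))
      (Complex.I * ∫ τ in s..t, ip (φ τ) (Laplacian.laplacian η))
    rw [sub_add_cancel, norm_mul, Complex.norm_I, one_mul] at e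
    have : (M * ∑ j, (C + k j) + C * M + C * M) * (t - s) * nn D
      = C * M * nn D * (t - s) + M * (∑ j, (C + k j)) * nn D * (t - s) + C * (t - s) * M * nn D := by
      ring
    rw [this]
    exact add_le_add (e.trans (add_le_add (b2.trans b6) b3)) b5
  rcases hDn.eq_or_lt with h0 | h0
  · rw [← h0]; positivity
  · rw [pow_two] at hmain
    exact le_of_mul_le_mul_right hmain h0

/-- Exact expansion of the increments of the regularised observable. -/
lemma mreg_sub (hc : CutoffFamily ρ N φ T₀ C β₀ a a')
    (h : SolutionCurve N φ v M) (hρ : IsBump ρ) (n : ℕ) {s t : ℝ} (hs : T₀ ≤ s) (ht : T₀ ≤ t) :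
    mreg ρ n a φ t - mreg ρ n a φ s
      = 2 * (ip (fun x => trunc n a φ t x - trunc n a φ s x) (gam ρ (trunc n a φ t))).re
        - (ip (fun x => trunc n a φ t x - trunc n a φ s x)
            (fun x => gam ρ (trunc n a φ t) x - gam ρ (trunc n a φ s) x)).re := by
  have hw := hc.isTest_trunc h n ht
  have hz := hc.isTest_trunc h n hs
  have hgw := hw.gam hρ
  have hgz := hz.gam hρ
  -- By symmetry of `γ` the two mixed terms have equal real parts, so the increment is a first-order
  -- term minus a quadratic one in the difference.
  have e1 : (ip (trunc n a φ t) (gam ρ (trunc n a φ s))).re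
      = (ip (trunc n a φ s) (gam ρ (trunc n a φ t))).re := by
    rw [ip_gam_comm hρ hw hz, ← ip_conj, Complex.conj_re]
  rw [ip_sub_right hgw.memLp hgz.memLp (hw.memLp.sub hz.memLp),
    ip_sub_left hw.memLp hz.memLp hgw.memLp, ip_sub_left hw.memLp hz.memLp hgz.memLp]
  simp only [Complex.sub_re, mreg]
  linarith

/-- The constant depends on `n`. It serves only to obtain differentiability almost everywhere and
the fundamental theorem of calculus for each `n`. -/
lemma lipschitz_mreg (hc : CutoffFamily ρ N φ T₀ C β₀ a a')
    (h : SolutionCurve N φ v M) (hρ : IsBump ρ) (n : ℕ) : ∃ K : NNReal, LipschitzOnWith K (mreg ρ n a φ) (Ici T₀) := by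
  obtain ⟨B, hB, hb, hcf, _⟩ := exists_coeff_bound hρ
  obtain ⟨K, hK, hD⟩ := hc.exists_lipschitz h n
  set M₁ := B * (3 * (M + C * M) + M) with hM₁
  have hM := h.M_nonneg
  have hC := hc.nonneg
  have hM₁0 : 0 ≤ M₁ := by positivity
  have key : ∀ s t, T₀ ≤ s → s ≤ t →
      |mreg ρ n a φ t - mreg ρ n a φ s| ≤ 4 * M₁ * K * (t - s) := by
    intro s t hs hst
    have ht := hs.trans hst
    have hw := hc.isTest_trunc h n ht
    have hz := hc.isTest_trunc h n hs
    have g1 := hc.nn_gam_trunc_le h hρ hb hcf n ht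
    have g2 := hc.nn_gam_trunc_le h hρ hb hcf n hs
    have hgw := (hw.gam hρ).memLp
    have hgz := (hz.gam hρ).memLp
    rw [hc.mreg_sub h hρ n hs ht]
    have hDl := hw.memLp.sub hz.memLp
    have i1 := (Complex.abs_re_le_norm _).trans (norm_ip_le hDl hgw)
    have i2 := (Complex.abs_re_le_norm _).trans (norm_ip_le hDl (hgw.sub hgz))
    have i3 := nn_sub_le hgw hgz
    have i4 := hD s t hs hst
    have hn0 := nn_nonneg (fun x => trunc n a φ t x - trunc n a φ s x)
    refine (abs_sub _ _).trans ?_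
    rw [abs_mul, abs_two]
    have j1 := i1.trans (mul_le_mul_of_nonneg_left g1 hn0)
    have j2 := i2.trans (mul_le_mul_of_nonneg_left (i3.trans (add_le_add g1 g2)) hn0)
    have j3 := mul_le_mul_of_nonneg_right i4 hM₁0
    linarith
  refine ⟨⟨4 * M₁ * K, by positivity⟩, LipschitzOnWith.of_dist_le_mul fun t ht s hs => ?_⟩
  rw [Real.dist_eq, Real.dist_eq]
  rcases le_total s t with hst | hst
  · rw [abs_of_nonneg (sub_nonneg.2 hst)]; exact key s t hs hst
  · rw [abs_sub_comm, abs_sub_comm t s, abs_of_nonneg (sub_nonneg.2 hst)]; exact key t s ht hst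

/-- Commuting the Laplacian through the cutoff. -/
lemma sum_ip_grad (hc : CutoffFamily ρ N φ T₀ C β₀ a a')
    (h : SolutionCurve N φ v M) (n : ℕ) {t : ℝ} (ht : T₀ ≤ t) {ζ : E3 → ℂ} (hζ : IsTest ζ) :
    ∑ j, ip (v t j) (partialDeriv j (fun x => (a t x : ℂ) * moll n ζ x))
      = ip (fun x => ∑ j, (2 * ((partialDeriv j (a t) x : ℝ) : ℂ) * v t j x
          + ((partialDeriv j (partialDeriv j (a t)) x : ℝ) : ℂ) * φ t x)) (moll n ζ)
        + ∑ j, ip (partialDeriv j (trunc n a φ t)) (partialDeriv j ζ) := by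
  have ht0 := hc.pos ht
  have ha := hc.smooth t ht
  have hJ : IsTest (moll n ζ) := IsTest.conv hζ.memLp.locallyIntegrable hζ.2 (isTest_kappa n)
  have l1 : ∀ j, L2 (fun x => ((partialDeriv j (a t) x : ℝ) : ℂ) * v t j x) := fun j =>
    hc.memL2_partial ht (h.grad_memL2 t ht0 j) j
  have l2 : ∀ j, L2 (fun x => ((partialDeriv j (partialDeriv j (a t)) x : ℝ) : ℂ) * φ t x) :=
    fun j => (h.memL2 t ht0).real_mul_of_bound
      (contDiff_partialDeriv (contDiff_partialDeriv ha j) j).continuous.measurable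
      (hc.partial2_le t ht j)
  have l3 : ∀ j, L2 (fun x => (a t x : ℂ) * v t j x) := fun j =>
    hc.memL2_mul ht (h.grad_memL2 t ht0 j)
  have l4 : ∀ j, L2 (fun x => ((partialDeriv j (a t) x : ℝ) : ℂ) * φ t x) := fun j =>
    hc.memL2_partial ht (h.memL2 t ht0) j
  have l5 : ∀ j, L2 (fun x => 2 * ((partialDeriv j (a t) x : ℝ) : ℂ) * v t j x
          + ((partialDeriv j (partialDeriv j (a t)) x : ℝ) : ℂ) * φ t x) := fun j => by
    have := ((l1 j).smul 2).add (l2 j)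
    simpa only [mul_assoc] using this
  rw [ip_sum_left _ l5 hJ.memLp, ← Finset.sum_add_distrib]
  refine Finset.sum_congr rfl fun j _ => ?_
  have hpJ : partialDeriv j (moll n ζ) = moll n (partialDeriv j ζ) :=
    funext fun x => partialDeriv_conv_of_weak (hζ.hasWeakPartial j) (isTest_kappa n) x
  have hpζ := (hζ.partialDeriv j).memLp
  have hmp := L2_moll n hpζ
  have e1 : ip (v t j) (partialDeriv j (fun x => (a t x : ℂ) * moll n ζ x))
      = ip (fun x => ((partialDeriv j (a t) x : ℝ) : ℂ) * v t j x) (moll n ζ)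
        + ip (fun x => (a t x : ℂ) * v t j x) (moll n (partialDeriv j ζ)) := by
    rw [ip_real_mul, ip_real_mul,
      ← ip_add_right (hc.memL2_partial ht hJ.memLp j) (hc.memL2_mul ht hmp) (h.grad_memL2 t ht0 j)]
    congr 1; ext x
    rw [partialDeriv_mul ((contDiff_ofReal_comp ha).differentiable (by simp) x)
      (hJ.differentiable x), partialDeriv_ofReal (ha.differentiable (by simp) x), hpJ]
  have e2 : ip (partialDeriv j (trunc n a φ t)) (partialDeriv j ζ)
      = ip (fun x => (a t x : ℂ) * v t j x) (moll n (partialDeriv j ζ))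
        + ip (fun x => ((partialDeriv j (a t) x : ℝ) : ℂ) * φ t x) (moll n (partialDeriv j ζ)) := by
    rw [hc.partialDeriv_trunc h n ht, ip_moll n ((l3 j).add (l4 j)) hpζ,
      ip_add_left (l3 j) (l4 j) hmp]
  -- Weak differentiation with the coefficient `∂ⱼa` exchanges the derivative on the mollified test
  -- function for the second copy of `∂ⱼa ∂ⱼφ` and the term `∂ⱼ²a φ`.
  have e3 := ((h.weak t ht0 j).mul_smooth (contDiff_partialDeriv ha j)).ip_eq hJ
  rw [hpJ, ip_add_left (l1 j) (l2 j) hJ.memLp] at e3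
  have e4 : ip (fun x => 2 * ((partialDeriv j (a t) x : ℝ) : ℂ) * v t j x
          + ((partialDeriv j (partialDeriv j (a t)) x : ℝ) : ℂ) * φ t x) (moll n ζ)
      = 2 * ip (fun x => ((partialDeriv j (a t) x : ℝ) : ℂ) * v t j x) (moll n ζ)
        + ip (fun x => ((partialDeriv j (partialDeriv j (a t)) x : ℝ) : ℂ) * φ t x) (moll n ζ) := by
    rw [← ip_smul_left, ← ip_add_left ((l1 j).smul 2) (l2 j) hJ.memLp]
    simp only [mul_assoc]
  rw [e1, e2, e4, e3]; ring

end CutoffFamily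
end

/-! ### The derivative of the regularised observable -/

section
variable {ρ : ℝ → ℝ} {N : ℝ → ℝ → ℝ → ℂ} {φ : ℝ → E3 → ℂ} {v : ℝ → Fin 3 → E3 → ℂ} {M : ℝ}
  {T₀ C β₀ : ℝ} {a a' : ℝ → E3 → ℝ}

lemma L2Tendsto.comp_tendsto {ι κ : Type*} {l : Filter ι} {l' : Filter κ} {f : ι → E3 → ℂ}
    {g : E3 → ℂ} (h : L2Tendsto f l g) {u : κ → ι} (hu : Tendsto u l' l) :
    L2Tendsto (fun k => f (u k)) l' g :=
  Tendsto.comp (g := fun i => nn (fun x => f i x - g x)) h hu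

lemma tendsto_average {g : ℝ → ℂ} {t : ℝ} (hg : ContinuousOn g (Ioi 0)) (ht : 0 < t) {s : ℕ → ℝ}
    (hs : Tendsto s atTop (𝓝 t)) (hst : ∀ k, s k < t) :
    Tendsto (fun k => ((t - s k)⁻¹ : ℝ) • ∫ τ in (s k)..t, g τ) atTop (𝓝 (g t)) := by
  have hd := intervalIntegral.integral_hasDerivAt_left (f := g) (a := t) (b := t) (by simp)
    (hg.stronglyMeasurableAtFilter isOpen_Ioi t ht) (hg.continuousAt (Ioi_mem_nhds ht))
  have hs' : Tendsto s atTop (𝓝[≠] t) :=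
    tendsto_nhdsWithin_iff.2 ⟨hs, Eventually.of_forall fun k => (hst k).ne⟩
  have := (hd.tendsto_slope.comp hs').neg
  rw [neg_neg] at this
  refine this.congr fun k => ?_
  simp only [Function.comp, slope_def_module, intervalIntegral.integral_same, sub_zero]
  rw [← neg_smul, ← inv_neg, neg_sub]

namespace CutoffFamily

/-- The difference quotients of the cutoff converge pointwise with a uniform bound, while the
solution converges in `L²`. Splitting off `φ(s_k) - φ(t)` leaves a multiplier to which dominated
convergence applies. -/
lemma tendsto_time_diff (hc : CutoffFamily ρ N φ T₀ C β₀ a a') (h : SolutionCurve N φ v M)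
    {t : ℝ} (ht : T₀ ≤ t) {θ : E3 → ℂ} (hθ : L2 θ) {s : ℕ → ℝ}
    (hs : Tendsto s atTop (𝓝 t)) (hs0 : ∀ k, T₀ ≤ s k) (hst : ∀ k, s k < t) :
    Tendsto (fun k => ((t - s k)⁻¹ : ℝ) * (ip (fun x => ((a t x - a (s k) x : ℝ) : ℂ) * φ (s k) x) θ).re)
      atTop (𝓝 (ip (fun x => (a' t x : ℂ) * φ t x) θ).re) := by
  set m : ℕ → E3 → ℝ := fun k x => (t - s k)⁻¹ * (a t x - a (s k) x) with hm
  have hpos : ∀ k, 0 < t - s k := fun k => sub_pos.2 (hst k)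
  have hmC : ∀ k x, |m k x| ≤ C := by
    intro k x
    rw [hm, abs_mul, abs_of_nonneg (inv_nonneg.2 (hpos k).le), inv_mul_le_iff₀ (hpos k), mul_comm]
    exact hc.abs_sub_le (hs0 k) (hst k).le x
  have hmm : ∀ k, Measurable (m k) := fun k =>
    ((((hc.smooth t ht).continuous.sub (hc.smooth _ (hs0 k)).continuous)).measurable).const_mul _
  have hs' : Tendsto s atTop (𝓝[≠] t) :=
    tendsto_nhdsWithin_iff.2 ⟨hs, Eventually.of_forall fun k => (hst k).ne⟩
  have hlim : ∀ x, Tendsto (fun k => m k x) atTop (𝓝 (a' t x)) := by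
    intro x
    refine ((hc.time t ht x).tendsto_slope.comp hs').congr fun k => ?_
    simp only [Function.comp, slope_def_field, hm]
    rw [← neg_div_neg_eq, neg_sub, neg_sub, div_eq_inv_mul]
  have ht0 := hc.pos ht
  have hφt := h.memL2 t ht0
  have hφs : ∀ k, L2 (φ (s k)) := fun k => h.memL2 _ (hc.pos (hs0 k))
  have hcontφ : L2Tendsto (fun k => φ (s k)) atTop (φ t) :=
    (h.cont t ht0).comp_tendsto (tendsto_nhdsWithin_iff.2
      ⟨hs, Eventually.of_forall fun k => hc.pos (hs0 k)⟩)
  have hA : L2Tendsto (fun k x => (m k x : ℂ) * φ t x) atTop (fun x => (a' t x : ℂ) * φ t x) := by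
    refine L2Tendsto.of_multiplier (C := C) hφt
      (fun k => (Complex.measurable_ofReal.comp (hmm k)).aestronglyMeasurable) (fun k x => ?_)
      fun x => (Complex.continuous_ofReal.tendsto _).comp (hlim x)
    rw [Complex.norm_real]; exact hmC k x
  have hB : L2Tendsto (fun k x => (m k x : ℂ) * φ (s k) x) atTop
      (fun x => (a' t x : ℂ) * φ t x) := by
    have hu := (Tendsto.const_mul C hcontφ).add hA
    rw [mul_zero, add_zero] at hu
    refine L2Tendsto.of_le hu (Eventually.of_forall fun k => ?_)
    have l1 := ((hφs k).sub hφt).real_mul_of_bound (hmm k) (hmC k)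
    have l2 := (hφt.real_mul_of_bound (hmm k) (hmC k)).sub (hc.memL2_time ht hφt)
    have e : (fun x => (m k x : ℂ) * φ (s k) x - (a' t x : ℂ) * φ t x)
        = fun x => (m k x : ℂ) * (φ (s k) x - φ t x)
          + ((m k x : ℂ) * φ t x - (a' t x : ℂ) * φ t x) := by
      ext x; ring
    rw [e]
    refine (nn_add_le l1 l2).trans (add_le_add ?_ le_rfl)
    exact nn_bdd_mul_le ((hφs k).sub hφt) fun x => by rw [Complex.norm_real]; exact hmC k x
  have := hB.ip L2Tendsto.const (fun k => (hφs k).real_mul_of_bound (hmm k) (hmC k))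
    (fun _ => hθ) (hc.memL2_time ht hφt) hθ
  refine ((Complex.continuous_re.tendsto _).comp this).congr fun k => ?_
  have e : (fun x => (m k x : ℂ) * φ (s k) x) = fun x => (((t - s k)⁻¹ : ℝ) : ℂ)
      * (((a t x - a (s k) x : ℝ) : ℂ) * φ (s k) x) := by
    ext x; simp only [hm]; push_cast; ring
  simp only [Function.comp]
  rw [e, ip_smul_left, Complex.re_ofReal_mul]

/-- For fixed `n` the derivative in `γ` can fall on the kernel, so `L²` continuity suffices.
Together with the Lipschitz bound this makes the quadratic term of `mreg_sub` of order `o(t - s)`.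
-/
lemma tendsto_nn_gam_sub (hc : CutoffFamily ρ N φ T₀ C β₀ a a') (h : SolutionCurve N φ v M)
    (hρ : IsBump ρ) (n : ℕ) {t : ℝ} (ht : T₀ ≤ t) {s : ℕ → ℝ}
    (hs : Tendsto s atTop (𝓝 t)) (hs0 : ∀ k, T₀ ≤ s k) (hst : ∀ k, s k < t) :
    Tendsto (fun k => nn (gam ρ (fun x => trunc n a φ t x - trunc n a φ (s k) x))) atTop (𝓝 0) := by
  obtain ⟨B, hB, hb, hcf, _⟩ := exists_coeff_bound hρ
  set κ : Fin 3 → ℝ := fun j => ∫ x, ‖partialDeriv j (kappa n) x‖ with hκ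
  have ht0 := hc.pos ht
  have hφt := h.memL2 t ht0
  have hφs : ∀ k, L2 (φ (s k)) := fun k => h.memL2 _ (hc.pos (hs0 k))
  have hcontφ : L2Tendsto (fun k => φ (s k)) atTop (φ t) :=
    (h.cont t ht0).comp_tendsto (tendsto_nhdsWithin_iff.2
      ⟨hs, Eventually.of_forall fun k => hc.pos (hs0 k)⟩)
  set u : ℕ → ℝ := fun k => nn (fun x => φ (s k) x - φ t x) + C * (t - s k) * M with hu
  have hu0 : Tendsto u atTop (𝓝 0) := by
    have h1 : Tendsto (fun k => t - s k) atTop (𝓝 0) := by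
      simpa using (tendsto_const_nhds (x := t)).sub hs
    have := Tendsto.add hcontφ ((h1.const_mul C).mul_const M)
    simpa using this
  have hv := hu0.const_mul (B * (∑ j, κ j + 1))
  rw [mul_zero] at hv
  refine tendsto_of_tendsto_of_tendsto_of_le_of_le tendsto_const_nhds hv (fun k => nn_nonneg _)
    fun k => ?_
  have l1 := hc.memL2_mul ht hφt
  have l2 := hc.memL2_mul (hs0 k) (hφs k)
  set E : E3 → ℂ := fun x => (a t x : ℂ) * φ t x - (a (s k) x : ℂ) * φ (s k) x with hE
  have hEL : L2 E := l1.sub l2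
  have hEu : nn E ≤ u k := by
    obtain ⟨l3, b3⟩ := hc.nn_time_diff_le h (hs0 k) (hst k).le
    have l4 := hc.memL2_mul ht (hφt.sub (hφs k))
    have e : E = fun x => (a t x : ℂ) * (φ t x - φ (s k) x)
        + ((a t x - a (s k) x : ℝ) : ℂ) * φ (s k) x := by
      ext x; simp only [hE]; push_cast; ring
    rw [e]
    refine (nn_add_le l4 l3).trans (add_le_add ?_ b3)
    rw [nn_sub_comm]
    exact hc.nn_mul_le ht (hφt.sub (hφs k))
  have hD : (fun x => trunc n a φ t x - trunc n a φ (s k) x) = moll n E :=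
    funext fun x => (moll_sub n l1 l2 x).symm
  have hDt : IsTest (moll n E) := by
    rw [← hD]; exact (hc.isTest_trunc h n ht).sub (hc.isTest_trunc h n (hs0 k))
  rw [hD]
  refine (nn_gam_le hρ hb hcf hDt).trans ?_
  rw [mul_assoc]
  refine mul_le_mul_of_nonneg_left ?_ hB
  have hp : ∀ j, nn (partialDeriv j (moll n E)) ≤ κ j * u k := by
    intro j
    have : partialDeriv j (moll n E) = conv E (partialDeriv j (kappa n)) :=
      funext fun x => partialDeriv_conv hEL.locallyIntegrable (isTest_kappa n) j x
    rw [this]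
    exact (nn_conv_le hEL ((isTest_kappa n).partialDeriv j)).trans
      (mul_le_mul_of_nonneg_left hEu (integral_nonneg fun x => norm_nonneg _))
  rw [add_mul, one_mul, Finset.sum_mul]
  exact add_le_add (Finset.sum_le_sum fun j _ => hp j) ((nn_moll_le n hEL).trans hEu)

/-- The derivative bound at the level of difference quotients: expand the quadratic form by
`mreg_sub`, insert the equation tested with the cutoff at time `t`, and bound the interaction and
the quadratic remainder. -/
lemma increment_le (hc : CutoffFamily ρ N φ T₀ C β₀ a a') (h : SolutionCurve N φ v M)
    (hρ : IsBump ρ) (n : ℕ) {K : ℝ}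
    (hK : ∀ s t, T₀ ≤ s → s ≤ t →
      nn (fun x => trunc n a φ t x - trunc n a φ s x) ≤ K * (t - s))
    {s t : ℝ} (hs : T₀ ≤ s) (hst : s < t) :
    2 * (Complex.I * ((t - s)⁻¹ : ℝ) • ∫ τ in s..t, ip (φ τ) (Laplacian.laplacian
          fun x => (a t x : ℂ) * moll n (gam ρ (trunc n a φ t)) x)).re
      + 2 * ((t - s)⁻¹ * (ip (fun x => ((a t x - a s x : ℝ) : ℂ) * φ s x)
          (moll n (gam ρ (trunc n a φ t)))).re)
      - 2 * (C * s ^ (-β₀) * M * nn (moll n (gam ρ (trunc n a φ t))))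
      - K * nn (gam ρ (fun x => trunc n a φ t x - trunc n a φ s x))
    ≤ (t - s)⁻¹ * (mreg ρ n a φ t - mreg ρ n a φ s) := by
  have ht := hs.trans hst.le
  have hpos := sub_pos.2 hst
  have hw := hc.isTest_trunc h n ht
  have hz := hc.isTest_trunc h n hs
  have hζ := hw.gam hρ
  set ζ := gam ρ (trunc n a φ t) with hζd
  set D : E3 → ℂ := fun x => trunc n a φ t x - trunc n a φ s x with hD
  have hDt : IsTest D := hw.sub hz
  set η : E3 → ℂ := fun x => (a t x : ℂ) * moll n ζ x with hη
  have hηt : IsTest η := hc.isTest_mul_moll n ht hζ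
  have b := hc.norm_ip_sub_le h hηt (L2_moll n hζ.memLp) hs hst.le (fun x => rfl)
  have b' := (_root_.abs_le.1 ((Complex.abs_re_le_norm _).trans b)).1
  have e1 := hc.mreg_sub h hρ n hs ht
  have e2 : (fun x => gam ρ (trunc n a φ t) x - gam ρ (trunc n a φ s) x) = gam ρ D :=
    (gam_sub hw hz).symm
  rw [e2] at e1
  have e3 := congrArg Complex.re (hc.ip_trunc_sub h n hs ht hζ)
  have b3 := (le_abs_self _).trans ((Complex.abs_re_le_norm _).trans
    (norm_ip_le hDt.memLp (hDt.gam hρ).memLp))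
  have b4 := b3.trans (mul_le_mul_of_nonneg_right (hK s t hs hst.le) (nn_nonneg _))
  have e4 : (Complex.I * ((t - s)⁻¹ : ℝ) • ∫ τ in s..t, ip (φ τ) (Laplacian.laplacian η)).re
      = (t - s)⁻¹ * (Complex.I * ∫ τ in s..t, ip (φ τ) (Laplacian.laplacian η)).re := by
    rw [mul_smul_comm, Complex.real_smul, Complex.re_ofReal_mul]
  rw [e4]
  simp only [Complex.add_re, Complex.sub_re] at e3 b'
  rw [e1, e3, ← mul_le_mul_iff_of_pos_left hpos]
  have hcancel : ∀ y, (t - s) * ((t - s)⁻¹ * y) = y := fun y => mul_inv_cancel_left₀ hpos.ne' y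
  have : (t - s) * (2 * ((t - s)⁻¹ * (Complex.I * ∫ τ in s..t, ip (φ τ) (Laplacian.laplacian η)).re)
      + 2 * ((t - s)⁻¹ * (ip (fun x => ((a t x - a s x : ℝ) : ℂ) * φ s x) (moll n ζ)).re)
      - 2 * (C * s ^ (-β₀) * M * nn (moll n ζ)) - K * nn (gam ρ D))
      = 2 * (Complex.I * ∫ τ in s..t, ip (φ τ) (Laplacian.laplacian η)).re
        + 2 * (ip (fun x => ((a t x - a s x : ℝ) : ℂ) * φ s x) (moll n ζ)).re
        - 2 * (C * s ^ (-β₀) * M * nn (moll n ζ) * (t - s)) - K * (t - s) * nn (gam ρ D) := by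
    have h1 := hcancel (Complex.I * ∫ τ in s..t, ip (φ τ) (Laplacian.laplacian η)).re
    have h2 := hcancel (ip (fun x => ((a t x - a s x : ℝ) : ℂ) * φ s x) (moll n ζ)).re
    linear_combination 2 * h1 + 2 * h2
  rw [this, hcancel]
  linarith

/-- Lower bound for the derivative of the regularised observable. -/
lemma le_deriv_mreg (hc : CutoffFamily ρ N φ T₀ C β₀ a a') (h : SolutionCurve N φ v M)
    (hρ : IsBump ρ) {B : ℝ} (hb : ∀ j x, |bvec ρ j x| ≤ B) (hcf : ∀ x, |cfun ρ x| ≤ B)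
    (n : ℕ) {t m' : ℝ} (ht : T₀ < t) (hm : HasDerivAt (mreg ρ n a φ) m' t) :
    2 * (-Complex.I * ip (fun x => ∑ j, (2 * ((partialDeriv j (a t) x : ℝ) : ℂ) * v t j x
          + ((partialDeriv j (partialDeriv j (a t)) x : ℝ) : ℂ) * φ t x))
          (moll n (gam ρ (trunc n a φ t)))
        + ip (fun x => (a' t x : ℂ) * φ t x) (moll n (gam ρ (trunc n a φ t)))).re
      - 2 * (C * t ^ (-β₀) * M * (B * (3 * (M + C * M) + M))) ≤ m' := by
  obtain ⟨K, hK0, hK⟩ := hc.exists_lipschitz h n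
  have ht0 : 0 < t := lt_of_lt_of_le one_pos (hc.one_le.trans ht.le)
  -- The times approach `t` from the left, since the cutoff at `t` controls the interaction only at
  -- earlier times.
  set s : ℕ → ℝ := fun k => t - (t - T₀) / ((k : ℝ) + 1) with hsd
  have hst : ∀ k, s k < t := fun k => by
    have : 0 < (t - T₀) / ((k : ℝ) + 1) := div_pos (sub_pos.2 ht) (by positivity)
    simp only [hsd]; linarith
  have hs0 : ∀ k, T₀ ≤ s k := fun k => by
    have : (t - T₀) / ((k : ℝ) + 1) ≤ t - T₀ :=
      div_le_self (sub_pos.2 ht).le (by linarith [(Nat.cast_nonneg k : (0 : ℝ) ≤ k)])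
    simp only [hsd]; linarith
  have hs : Tendsto s atTop (𝓝 t) := by
    have := (tendsto_one_div_add_atTop_nhds_zero_nat (𝕜 := ℝ)).const_mul (t - T₀)
    have h2 := (tendsto_const_nhds (x := t)).sub this
    simp only [mul_zero, sub_zero, mul_one_div] at h2
    exact h2
  have hw := hc.isTest_trunc h n ht.le
  have hζ := hw.gam hρ
  set ζ := gam ρ (trunc n a φ t) with hζd
  set η : E3 → ℂ := fun x => (a t x : ℂ) * moll n ζ x with hη
  have hηt : IsTest η := hc.isTest_mul_moll n ht.le hζ
  have hmL := L2_moll n hζ.memLp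
  have t1 := tendsto_average ((h.continuousOn_ip (laplacian_test hηt).memLp).mono
    Ioi_subset_Ici_self) ht0 hs hst
  have t1' := ((Complex.continuous_re.tendsto _).comp (t1.const_mul Complex.I)).const_mul 2
  have t2 := (hc.tendsto_time_diff h ht.le hmL hs hs0 hst).const_mul 2
  have t3 := (((((hs.rpow_const (p := -β₀) (Or.inl ht0.ne')).const_mul C).mul_const M).mul_const
    (nn (moll n ζ)))).const_mul 2
  have t4 := (hc.tendsto_nn_gam_sub h hρ n ht.le hs hs0 hst).const_mul K
  rw [mul_zero] at t4
  have hs' : Tendsto s atTop (𝓝[≠] t) :=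
    tendsto_nhdsWithin_iff.2 ⟨hs, Eventually.of_forall fun k => (hst k).ne⟩
  have t5 : Tendsto (fun k => (t - s k)⁻¹ * (mreg ρ n a φ t - mreg ρ n a φ (s k))) atTop (𝓝 m') := by
    refine (hm.tendsto_slope.comp hs').congr fun k => ?_
    simp only [Function.comp, slope_def_field]
    rw [← neg_div_neg_eq, neg_sub, neg_sub, div_eq_inv_mul]
  have key := le_of_tendsto_of_tendsto (((t1'.add t2).sub t3).sub t4) t5
    (Eventually.of_forall fun k => hc.increment_le h hρ n hK (hs0 k) (hst k))
  refine le_trans ?_ key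
  have hz : nn (moll n ζ) ≤ B * (3 * (M + C * M) + M) :=
    (nn_moll_le n hζ.memLp).trans (hc.nn_gam_trunc_le h hρ hb hcf n ht.le)
  have hfac : 0 ≤ C * t ^ (-β₀) * M :=
    mul_nonneg (mul_nonneg hc.nonneg (Real.rpow_nonneg ht0.le _)) h.M_nonneg
  have hz' := mul_le_mul_of_nonneg_left hz hfac
  -- The only term with two derivatives on the truncated solution. It has a sign and is dropped, so
  -- it needs no bound uniform in `n`.
  have hcomm := commutator_nonneg hρ hw (fun x hx => hc.trunc_eq_zero n ht.le hx)
  have eL : Complex.I * ip (φ t) (Laplacian.laplacian η)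
      = -Complex.I * ip (fun x => ∑ j, (2 * ((partialDeriv j (a t) x : ℝ) : ℂ) * v t j x
          + ((partialDeriv j (partialDeriv j (a t)) x : ℝ) : ℂ) * φ t x)) (moll n ζ)
        + -Complex.I * ∑ j, ip (partialDeriv j (trunc n a φ t)) (partialDeriv j ζ) := by
    rw [h.ip_laplacian hηt ht0.le, hc.sum_ip_grad h n ht.le hζ]
    ring
  rw [eL, Complex.add_re]
  simp only [Complex.add_re]
  linarith

end CutoffFamily
end

/-! ### Smooth characteristic functions and the cutoffs built from them -/

section
variable {F : ℝ → ℝ}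

namespace IsSmoothChar

lemma nonneg (hF : IsSmoothChar F) (l : ℝ) : 0 ≤ F l := by
  rw [← hF.eq_zero (min l (1 / 2)) (min_le_right _ _)]
  exact hF.mono (min_le_left _ _)

lemma le_one (hF : IsSmoothChar F) (l : ℝ) : F l ≤ 1 := by
  rw [← hF.eq_one (max l 1) (le_max_right _ _)]
  exact hF.mono (le_max_left _ _)

lemma contDiff_deriv (hF : IsSmoothChar F) : ContDiff ℝ ∞ (deriv F) :=
  (contDiff_infty_iff_deriv.1 hF.smooth).2

lemma contDiff_deriv2 (hF : IsSmoothChar F) : ContDiff ℝ ∞ (deriv (deriv F)) :=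
  (contDiff_infty_iff_deriv.1 hF.contDiff_deriv).2

lemma deriv_nonneg (hF : IsSmoothChar F) (l : ℝ) : 0 ≤ deriv F l := hF.mono.deriv_nonneg

lemma deriv_eq_zero (hF : IsSmoothChar F) {l : ℝ} (hl : l < 1 / 2 ∨ 1 < l) : deriv F l = 0 := by
  rcases hl with h | h
  · refine deriv_eq_zero_of_eventually (c := 0) ?_
    filter_upwards [gt_mem_nhds h] with y hy using hF.eq_zero y hy.le
  · refine deriv_eq_zero_of_eventually (c := 1) ?_
    filter_upwards [lt_mem_nhds h] with y hy using hF.eq_one y hy.le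

end IsSmoothChar

lemma deriv_eq_zero_of_eq_zero {f : ℝ → ℝ} {a b : ℝ} (h : ∀ s, s < a ∨ b < s → f s = 0) {s : ℝ}
    (hs : s < a ∨ b < s) : deriv f s = 0 := by
  refine deriv_eq_zero_of_eventually (c := 0) ?_
  rcases hs with h' | h'
  · filter_upwards [gt_mem_nhds h'] with y hy using h y (Or.inl hy)
  · filter_upwards [lt_mem_nhds h'] with y hy using h y (Or.inr hy)

namespace IsSmoothChar

/-- A common bound for the first derivatives of `F` and of `chi`. -/
lemma exists_bounds (hF : IsSmoothChar F) : ∃ D, 0 ≤ D ∧ (∀ l, |deriv F l| ≤ D) ∧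
    (∀ l, |deriv (deriv F) l| ≤ D) ∧ (∀ l, |deriv chi l| ≤ D) ∧ ∀ l, |deriv (deriv chi) l| ≤ D := by
  have hχ := (contDiff_infty_iff_deriv.1 contDiff_chi).2
  have hχ2 := (contDiff_infty_iff_deriv.1 hχ).2
  obtain ⟨D1, h1, b1⟩ := exists_bound_of_eq_zero hF.contDiff_deriv.continuous fun s => hF.deriv_eq_zero
  obtain ⟨D2, h2, b2⟩ := exists_bound_of_eq_zero hF.contDiff_deriv2.continuous
    fun s => deriv_eq_zero_of_eq_zero fun s => hF.deriv_eq_zero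
  obtain ⟨D3, h3, b3⟩ := exists_bound_of_eq_zero hχ.continuous fun s => deriv_chi_eq_zero
  obtain ⟨D4, h4, b4⟩ := exists_bound_of_eq_zero hχ2.continuous
    fun s => deriv_eq_zero_of_eq_zero fun s => deriv_chi_eq_zero
  refine ⟨D1 + D2 + D3 + D4, by positivity, fun l => ?_, fun l => ?_, fun l => ?_, fun l => ?_⟩
  · linarith [b1 l]
  · linarith [b2 l]
  · linarith [b3 l]
  · linarith [b4 l]

end IsSmoothChar

/-! ### Radial profiles with an inner cutoff and an outer truncation. -/

/-- The radial profile `F(r / T) χ(r / S)`. -/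
def prof (F : ℝ → ℝ) (T S r : ℝ) : ℝ := F (r / T) * chi (r / S)

/-- The first derivative of `prof`. -/
def prof1 (F : ℝ → ℝ) (T S r : ℝ) : ℝ :=
  deriv F (r / T) / T * chi (r / S) + F (r / T) * (deriv chi (r / S) / S)

/-- The second derivative of `prof`. -/
def prof2 (F : ℝ → ℝ) (T S r : ℝ) : ℝ :=
  deriv (deriv F) (r / T) / T / T * chi (r / S)
    + 2 * (deriv F (r / T) / T * (deriv chi (r / S) / S))
    + F (r / T) * (deriv (deriv chi) (r / S) / S / S)

lemma hasDerivAt_div_comp {g : ℝ → ℝ} (hg : ContDiff ℝ ∞ g) (T r : ℝ) :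
    HasDerivAt (fun r => g (r / T)) (deriv g (r / T) / T) r := by
  have := (hg.differentiable (by simp) (r / T)).hasDerivAt.comp r ((hasDerivAt_id r).div_const T)
  rwa [mul_one_div] at this

lemma contDiff_prof (hF : ContDiff ℝ ∞ F) (T S : ℝ) : ContDiff ℝ ∞ (prof F T S) :=
  (hF.comp (contDiff_id.div_const T)).mul (contDiff_chi.comp (contDiff_id.div_const S))

lemma deriv_prof (hF : ContDiff ℝ ∞ F) (T S : ℝ) : deriv (prof F T S) = prof1 F T S :=
  funext fun r => ((hasDerivAt_div_comp hF T r).mul (hasDerivAt_div_comp contDiff_chi S r)).deriv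

lemma deriv_prof1 (hF : ContDiff ℝ ∞ F) (T S : ℝ) : deriv (prof1 F T S) = prof2 F T S := by
  ext r
  have hF1 := (contDiff_infty_iff_deriv.1 hF).2
  have hχ1 := (contDiff_infty_iff_deriv.1 contDiff_chi).2
  have := ((((hasDerivAt_div_comp hF1 T r).div_const T).mul
    (hasDerivAt_div_comp contDiff_chi S r))).add
    ((hasDerivAt_div_comp hF T r).mul ((hasDerivAt_div_comp hχ1 S r).div_const S))
  refine (this.deriv).trans ?_
  simp only [prof2]; ring

lemma prof_nonneg (hF : IsSmoothChar F) (T S r : ℝ) : 0 ≤ prof F T S r :=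
  mul_nonneg (hF.nonneg _) (chi_nonneg _)

lemma prof_le (hF : IsSmoothChar F) (T S r : ℝ) : prof F T S r ≤ F (r / T) :=
  mul_le_of_le_one_right (hF.nonneg _) (chi_le_one _)

lemma abs_div_le_of_one_le {x D T : ℝ} (h : |x| ≤ D) (hT : 1 ≤ T) : |x / T| ≤ D := by
  rw [abs_div, abs_of_pos (by linarith : (0 : ℝ) < T)]
  exact (div_le_self (abs_nonneg _) hT).trans h

lemma abs_mul_le_of_le_one {x y D : ℝ} (h : |x| ≤ D) (hy : |y| ≤ 1) : |x * y| ≤ D := by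
  rw [abs_mul]
  exact (mul_le_of_le_one_right (abs_nonneg _) hy).trans h

lemma abs_chi_le (s : ℝ) : |chi s| ≤ 1 := by rw [abs_of_nonneg (chi_nonneg s)]; exact chi_le_one s

lemma IsSmoothChar.abs_le (hF : IsSmoothChar F) (l : ℝ) : |F l| ≤ 1 := by
  rw [abs_of_nonneg (hF.nonneg l)]; exact hF.le_one l

/-- Differentiation only produces factors `1/T` and `1/S`, so the bounds are uniform over both
scales as soon as they are at least one. -/
lemma exists_prof_bounds (hF : IsSmoothChar F) : ∃ D, 0 ≤ D ∧ ∀ T S r, 1 ≤ T → 1 ≤ S →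
    |prof1 F T S r| ≤ D ∧ |prof2 F T S r| ≤ D := by
  obtain ⟨D, hD, h1, h2, h3, h4⟩ := hF.exists_bounds
  refine ⟨2 * D + 2 * D ^ 2, by positivity, fun T S r hT hS => ⟨?_, ?_⟩⟩
  · have a1 := abs_mul_le_of_le_one (abs_div_le_of_one_le (h1 (r / T)) hT) (abs_chi_le (r / S))
    have a2 := abs_mul_le_of_le_one (abs_div_le_of_one_le (h3 (r / S)) hS) (hF.abs_le (r / T))
    rw [mul_comm] at a2
    refine (abs_add_le _ _).trans ?_
    nlinarith
  · have a1 := abs_mul_le_of_le_one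
      (abs_div_le_of_one_le (abs_div_le_of_one_le (h2 (r / T)) hT) hT) (abs_chi_le (r / S))
    have a2 := abs_mul_le_of_le_one
      (abs_div_le_of_one_le (abs_div_le_of_one_le (h4 (r / S)) hS) hS) (hF.abs_le (r / T))
    rw [mul_comm] at a2
    have a3 : |2 * (deriv F (r / T) / T * (deriv chi (r / S) / S))| ≤ 2 * D ^ 2 := by
      rw [abs_mul, abs_mul, abs_two, pow_two]
      have e1 := abs_div_le_of_one_le (h1 (r / T)) hT
      have e2 := abs_div_le_of_one_le (h3 (r / S)) hS
      gcongr
    refine (abs_add_le _ _).trans ?_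
    have := abs_add_le (deriv (deriv F) (r / T) / T / T * chi (r / S))
      (2 * (deriv F (r / T) / T * (deriv chi (r / S) / S)))
    linarith

/-- The spatially truncated cutoff `F(⟨x⟩ / t^α) χ(⟨x⟩ / (n+1))`. -/
def cut (ρ : ℝ → ℝ) (α : ℝ) (F : ℝ → ℝ) (n : ℕ) (t : ℝ) (x : E3) : ℝ :=
  prof F (t ^ α) ((n : ℝ) + 1) (jap ρ x)

/-- The time derivative of `cut`. -/
def cutTime (ρ : ℝ → ℝ) (α : ℝ) (F : ℝ → ℝ) (n : ℕ) (t : ℝ) (x : E3) : ℝ :=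
  -(α / t) * (jap ρ x / t ^ α * deriv F (jap ρ x / t ^ α)) * chi (jap ρ x / ((n : ℝ) + 1))

variable {ρ : ℝ → ℝ} {α : ℝ}

lemma contDiff_cut (hρ : IsBump ρ) (hF : IsSmoothChar F) (n : ℕ) (t : ℝ) :
    ContDiff ℝ ∞ (cut ρ α F n t) :=
  (contDiff_prof hF.smooth _ _).comp (contDiff_jap hρ)

lemma partialDeriv_cut (hρ : IsBump ρ) (hF : IsSmoothChar F) (n : ℕ) (t : ℝ) (j : Fin 3) :
    partialDeriv j (cut ρ α F n t)
      = fun x => prof1 F (t ^ α) ((n : ℝ) + 1) (jap ρ x) * bvec ρ j x := by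
  ext x
  have := partialDeriv_comp_jap hρ
    ((contDiff_prof hF.smooth (t ^ α) ((n : ℝ) + 1)).differentiable (by simp)) j x
  rwa [deriv_prof hF.smooth] at this

lemma contDiff_prof1 (hF : ContDiff ℝ ∞ F) (T S : ℝ) : ContDiff ℝ ∞ (prof1 F T S) := by
  rw [← deriv_prof hF]; exact (contDiff_infty_iff_deriv.1 (contDiff_prof hF T S)).2

lemma partialDeriv_partialDeriv_cut (hρ : IsBump ρ) (hF : IsSmoothChar F) (n : ℕ) (t : ℝ)
    (j : Fin 3) (x : E3) : partialDeriv j (partialDeriv j (cut ρ α F n t)) x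
      = prof2 F (t ^ α) ((n : ℝ) + 1) (jap ρ x) * bvec ρ j x ^ 2
        + prof1 F (t ^ α) ((n : ℝ) + 1) (jap ρ x) * partialDeriv j (bvec ρ j) x := by
  have hd := (contDiff_prof1 hF.smooth (t ^ α) ((n : ℝ) + 1)).differentiable (by simp)
  have := partialDeriv_comp_jap hρ hd j x
  rw [deriv_prof1 hF.smooth] at this
  have hd' : Differentiable ℝ (fun y => prof1 F (t ^ α) ((n : ℝ) + 1) (jap ρ y)) :=
    ((contDiff_prof1 hF.smooth _ _).comp (contDiff_jap hρ)).differentiable (by simp)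
  rw [partialDeriv_cut hρ hF, partialDeriv_mul_real (hd' x)
    ((contDiff_bvec hρ j).differentiable (by simp) x)]
  rw [this]; ring

lemma hasDerivAt_cut (hF : IsSmoothChar F) (n : ℕ) {t : ℝ} (ht : 0 < t) (x : E3) :
    HasDerivAt (fun s => cut ρ α F n s x) (cutTime ρ α F n t x) t := by
  have hp : HasDerivAt (fun s : ℝ => jap ρ x / s ^ α) (-(α / t) * (jap ρ x / t ^ α)) t := by
    have h1 := Real.hasDerivAt_rpow_const (x := t) (p := -α) (Or.inl ht.ne')
    have h2 := (h1.const_mul (jap ρ x)).congr_of_eventuallyEq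
      (f₁ := fun s : ℝ => jap ρ x / s ^ α) ?_
    · refine h2.congr_deriv ?_
      rw [Real.rpow_sub_one ht.ne', Real.rpow_neg ht.le]
      field_simp
    · filter_upwards [lt_mem_nhds ht] with s hs
      rw [Real.rpow_neg hs.le, div_eq_mul_inv]
  have h := ((hF.smooth.differentiable (by simp) (jap ρ x / t ^ α)).hasDerivAt.comp t hp).mul_const
    (chi (jap ρ x / ((n : ℝ) + 1)))
  refine h.congr_deriv ?_
  rw [cutTime]; ring

/-- The derivative is supported in `[1/2, 1]`, where the additional factor is at most one. This
bounds the time derivative of the cutoff. -/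
lemma IsSmoothChar.abs_mul_deriv_le (hF : IsSmoothChar F) {D : ℝ} (hD : 0 ≤ D)
    (h : ∀ l, |deriv F l| ≤ D) (l : ℝ) : |l * deriv F l| ≤ D := by
  by_cases hl : l < 1 / 2 ∨ 1 < l
  · rw [hF.deriv_eq_zero hl]; simpa using hD
  · push Not at hl
    rw [mul_comm]
    exact abs_mul_le_of_le_one (h l) (by rw [_root_.abs_le]; constructor <;> linarith)

lemma jap_lt_of_norm_lt (hρ : IsBump ρ) {x : E3} {R : ℝ} (hR : 2 < R) (hx : ‖x‖ < R) :
    jap ρ x < R := by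
  rcases le_total ‖x‖ 2 with h | h
  · exact (jap_le_two hρ h).trans_lt hR
  · rwa [jap_eq_norm h]

lemma norm_ge_of_jap_ge (hρ : IsBump ρ) {x : E3} {R : ℝ} (hR : 2 < R) (hx : R ≤ jap ρ x) :
    R ≤ ‖x‖ := by
  by_contra! h
  exact absurd (jap_lt_of_norm_lt hρ hR h) (not_lt.2 hx)

/-- The cutoffs form a controlled family, with constants independent of the truncation. -/
lemma exists_cutoffFamily {N : ℝ → ℝ → ℝ → ℂ} {φ : ℝ → E3 → ℂ} (hρ : IsBump ρ)
    {α₀ : ℝ} {F₀ : ℝ → ℝ} (hα : 0 < α) (hα1 : α < 1) (hα₀ : 0 < α₀) (hF₀ : IsSmoothChar F₀)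
    (hF : IsSmoothChar F) (hN : InteractionDecay N φ α₀ F₀)
    (hαF : α₀ < α ∨ (α = α₀ ∧ F = F₀)) :
    ∃ T₀ C β₀ : ℝ, 1 < β₀ ∧ (∀ t, T₀ ≤ t → 8 ≤ t ^ α) ∧
      ∀ n, CutoffFamily ρ N φ T₀ C β₀ (cut ρ α F n) (cutTime ρ α F n) := by
  obtain ⟨β₀, C₀, hβ, hdec⟩ := hN
  obtain ⟨D, hD, h1, -, -, -⟩ := hF.exists_bounds
  obtain ⟨E, hE, hp⟩ := exists_prof_bounds hF
  obtain ⟨B, hB, hb, hcf, hbb⟩ := exists_coeff_bound hρ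
  -- After `T₀` two things hold: the cutoff lives where `⟨x⟩ = |x|`, and it is dominated by the
  -- cutoff for which decay of the interaction is assumed.
  obtain ⟨T₀, hT1, hT8, hdom⟩ : ∃ T₀ : ℝ, 1 ≤ T₀ ∧ (∀ t, T₀ ≤ t → 8 ≤ t ^ α) ∧
      ∀ s, T₀ ≤ s → ∀ x : E3, F (jap ρ x / s ^ α) ≤ F₀ (‖x‖ / s ^ α₀) := by
    have e1 := (tendsto_rpow_atTop hα).eventually_ge_atTop 8
    rcases hαF with h | ⟨rfl, rfl⟩
    -- The cutoff may start at `⟨x⟩ = s ^ α / 2`. Once `s ^ (α - α₀) ≥ 2`, this radius is at least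
    -- `s ^ α₀`, and `F₀` is already equal to one there.
    · have e2 := (tendsto_rpow_atTop (sub_pos.2 h)).eventually_ge_atTop 2
      obtain ⟨T₀, hT⟩ := eventually_atTop.1 ((e1.and e2).and (eventually_ge_atTop 1))
      refine ⟨T₀, (hT T₀ le_rfl).2, fun t ht => (hT t ht).1.1, fun s hs x => ?_⟩
      obtain ⟨⟨k1, k2⟩, k3⟩ := hT s hs
      have hs0 : 0 < s := by linarith
      rcases le_or_gt (jap ρ x / s ^ α) (1 / 2) with hl | hl
      · rw [hF.eq_zero _ hl]; exact hF₀.nonneg _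
      · rw [lt_div_iff₀ (by linarith)] at hl
        have hx := norm_ge_of_jap_ge hρ (by linarith) hl.le
        rw [hF₀.eq_one]
        · exact hF.le_one _
        · rw [le_div_iff₀ (Real.rpow_pos_of_pos hs0 _), one_mul]
          have : s ^ α = s ^ (α - α₀) * s ^ α₀ := by rw [← Real.rpow_add hs0]; ring_nf
          have h0 := Real.rpow_pos_of_pos hs0 α₀
          nlinarith
    -- With equal exponents and profiles, only the replacement of `⟨x⟩` by `|x|` on the support of
    -- the cutoff is needed.
    · obtain ⟨T₀, hT⟩ := eventually_atTop.1 (e1.and (eventually_ge_atTop 1))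
      refine ⟨T₀, (hT T₀ le_rfl).2, fun t ht => (hT t ht).1, fun s hs x => ?_⟩
      have k1 := (hT s hs).1
      rcases le_or_gt (jap ρ x / s ^ α) (1 / 2) with hl | hl
      · rw [hF.eq_zero _ hl]; exact hF.nonneg _
      · rw [lt_div_iff₀ (by linarith)] at hl
        have hx := norm_ge_of_jap_ge hρ (by linarith) hl.le
        rw [jap_eq_norm (by linarith)]
  set C := D + E + E * B + E * B ^ 2 + |C₀| with hC
  have hC0 : 0 ≤ C := by positivity
  have hEB : 0 ≤ E * B := by positivity
  have hEB2 : 0 ≤ E * B ^ 2 := by positivity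
  have hS : ∀ n : ℕ, (1 : ℝ) ≤ (n : ℝ) + 1 := fun n => by
    linarith [(Nat.cast_nonneg n : (0 : ℝ) ≤ n)]
  have hT1' : ∀ t, T₀ ≤ t → 1 ≤ t ^ α := fun t ht => by linarith [hT8 t ht]
  refine ⟨T₀, C, β₀, hβ, hT8, fun n => ?_⟩
  refine ⟨hT1, hC0, by linarith, fun t _ => contDiff_cut hρ hF n t, fun t ht x hx => ?_,
    ⟨2 * ((n : ℝ) + 1), fun t ht x hx => ?_⟩, fun t ht x => ?_, fun t ht j x => ?_,
    fun t ht j x => ?_, fun t ht x => hasDerivAt_cut hF n (by linarith) x, fun t ht x => ?_,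
    fun t ht => ?_, fun s t hs hst => ?_⟩
  -- From `t ^ α ≥ 8`, any point with `⟨x⟩ < 4` gives the argument of `F` a value below `1/2`.
  · have h8 := hT8 t ht
    have hj := jap_lt_of_norm_lt hρ (by norm_num) hx
    rw [cut, prof, hF.eq_zero, zero_mul]
    rw [div_le_iff₀ (by linarith)]; linarith
  · rw [cut, prof, chi_eq_zero, mul_zero]
    rw [le_div_iff₀ (by positivity)]; exact hx
  · rw [cut, abs_of_nonneg (prof_nonneg hF _ _ _)]
    exact (prof_le hF _ _ _).trans (hF.le_one _)
  · rw [partialDeriv_cut hρ hF, abs_mul]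
    have := mul_le_mul (hp (t ^ α) ((n : ℝ) + 1) (jap ρ x) (hT1' t ht) (hS n)).1 (hb j x)
      (abs_nonneg _) hE
    have := abs_nonneg C₀
    linarith
  · rw [partialDeriv_partialDeriv_cut hρ hF]
    have e1 := mul_le_mul (hp (t ^ α) ((n : ℝ) + 1) (jap ρ x) (hT1' t ht) (hS n)).1 (hbb j j x)
      (abs_nonneg _) hE
    have e2 := mul_le_mul (hp (t ^ α) ((n : ℝ) + 1) (jap ρ x) (hT1' t ht) (hS n)).2
      (pow_le_pow_left₀ (abs_nonneg _) (hb j x) 2) (by positivity) hE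
    refine (abs_add_le _ _).trans ?_
    rw [abs_mul, abs_mul, abs_pow]
    have := abs_nonneg C₀
    linarith
  · have ht1 : 1 ≤ t := hT1.trans ht
    have e1 := abs_mul_le_of_le_one (hF.abs_mul_deriv_le hD h1 (jap ρ x / t ^ α))
      (abs_chi_le (jap ρ x / ((n : ℝ) + 1)))
    have e2 : |-(α / t)| ≤ 1 := by
      rw [abs_neg, abs_of_nonneg (by positivity), div_le_one (by linarith)]; linarith
    have e3 := abs_mul_le_of_le_one e1 e2
    have : cutTime ρ α F n t x = (jap ρ x / t ^ α * deriv F (jap ρ x / t ^ α))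
      * chi (jap ρ x / ((n : ℝ) + 1)) * -(α / t) := by rw [cutTime]; ring
    rw [this]
    have := abs_nonneg C₀
    linarith
  · have hj := (contDiff_jap hρ).continuous
    have hd := hF.contDiff_deriv.continuous
    have hχ := contDiff_chi.continuous
    refine Continuous.measurable ?_
    unfold cutTime
    exact (continuous_const.mul ((hj.div_const _).mul (hd.comp (hj.div_const _)))).mul
      (hχ.comp (hj.div_const _))
  · have hs1 : 1 ≤ s := hT1.trans hs
    filter_upwards [hdec s hs1] with x hx
    have hpos := Real.rpow_nonneg (by linarith : (0 : ℝ) ≤ s) (-β₀)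
    refine le_trans ?_ (hx.trans (mul_le_mul_of_nonneg_right
      ((le_abs_self C₀).trans (by linarith)) hpos))
    rw [norm_mul, norm_mul, Complex.norm_real, Complex.norm_real]
    refine mul_le_mul_of_nonneg_right ?_ (norm_nonneg _)
    rw [cut, Real.norm_of_nonneg (prof_nonneg hF _ _ _), Real.norm_of_nonneg (hF₀.nonneg _)]
    refine (prof_le hF _ _ _).trans (le_trans ?_ (hdom s hs x))
    have h8 := hT8 s hs
    -- For positive `⟨x⟩` a later time decreases the argument of the monotone `F`. For nonpositive
    -- `⟨x⟩`, whose exclusion is not needed, `F` vanishes.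
    rcases le_or_gt (jap ρ x) 0 with hneg | hpos'
    · have : jap ρ x / t ^ α ≤ 0 := div_nonpos_of_nonpos_of_nonneg hneg
        (by linarith [hT1' t (hs.trans hst)])
      rw [hF.eq_zero _ (by linarith)]; exact hF.nonneg _
    · refine hF.mono (div_le_div_of_nonneg_left hpos'.le (by linarith) ?_)
      exact Real.rpow_le_rpow (by linarith) hst hα.le

end

/-! ### Global solutions are solution curves -/

section
variable {N : ℝ → ℝ → ℝ → ℂ} {φ₀ : E3 → ℂ} {φ : ℝ → E3 → ℂ}

lemma MemH1.hasWeakPartial {u : E3 → ℂ} (h : MemH1 u) (j : Fin 3) :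
    HasWeakPartial j u (weakPartial j u) := by
  obtain ⟨v, hv, _⟩ := h.2 j
  exact weakPartial_spec hv

lemma MemH1.memL2_weakPartial {u : E3 → ℂ} (h : MemH1 u) (j : Fin 3) : L2 (weakPartial j u) := by
  obtain ⟨v, hv, hL⟩ := h.2 j
  exact hL.ae_eq (weakPartial_ae_eq hv).symm

lemma nn_le_sqrt {u : E3 → ℂ} (hu : L2 u) {S : ℝ≥0∞} (hS : S < ⊤)
    (h : ∫⁻ x, ‖u x‖ₑ ^ 2 ≤ S) : nn u ≤ √ S.toReal := by
  refine Real.le_sqrt_of_sq_le ?_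
  rw [lintegral_enorm_sq hu] at h
  exact (ENNReal.ofReal_le_iff_le_toReal hS.ne).1 h

/-- Local integrability in space-time and Fubini on the compact product of the time interval with
the support of `η`. Without this, the time integrals could not be split at an intermediate time. -/
lemma IsGlobalSolution.intervalIntegrable_interaction (h : IsGlobalSolution N φ₀ φ) {η : E3 → ℂ}
    (hη : IsTest η) {a b : ℝ} (ha : 0 ≤ a) (hab : a ≤ b) :
    IntervalIntegrable (fun s => ∫ x, interaction N φ s x * η x) volume a b := by
  set K : Set E3 := tsupport η
  have hK : IsCompact (Icc a b ×ˢ K) := isCompact_Icc.prod hη.2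
  have h1 : IntegrableOn (fun p : ℝ × E3 => interaction N φ p.1 p.2) (Icc a b ×ˢ K) :=
    h.locInt.integrableOn_compact_subset
      (prod_mono (fun s hs => ha.trans hs.1) (subset_univ _)) hK
  have h2 : IntegrableOn (fun p : ℝ × E3 => interaction N φ p.1 p.2 * η p.2) (Icc a b ×ˢ K) :=
    h1.mul_continuousOn (hη.continuous.comp continuous_snd).continuousOn hK
  have h3 : IntegrableOn (fun p : ℝ × E3 => interaction N φ p.1 p.2 * η p.2)
      (Icc a b ×ˢ univ) := by
    refine h2.of_forall_sdiff_eq_zero (measurableSet_Icc.prod MeasurableSet.univ) fun p hp => ?_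
    have : p.2 ∉ K := fun hk => hp.2 ⟨hp.1.1, hk⟩
    rw [image_eq_zero_of_notMem_tsupport this, mul_zero]
  rw [IntegrableOn, Measure.volume_eq_prod, ← Measure.prod_restrict, Measure.restrict_univ] at h3
  have h4 := h3.integral_prod_left
  rw [intervalIntegrable_iff_integrableOn_Icc_of_le hab]
  exact h4

/-- A global solution with bounded `H¹` norm is a solution curve. -/
lemma IsGlobalSolution.exists_solutionCurve (h : IsGlobalSolution N φ₀ φ) (hb : GlobalH1Bound φ) :
    ∃ M, SolutionCurve N φ (fun t j => weakPartial j (φ t)) M := by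
  set S : ℝ≥0∞ := ⨆ t ∈ Ici (0 : ℝ), h1NormSq (φ t) with hS
  have hle : ∀ t, 0 ≤ t → h1NormSq (φ t) ≤ S := fun t ht =>
    le_iSup₂ (f := fun t (_ : t ∈ Ici (0 : ℝ)) => h1NormSq (φ t)) t ht
  have hcont : ∀ s, 0 ≤ s → L2Tendsto φ (𝓝[Ici 0] s) (φ s) := fun s hs =>
    (ENNReal.tendsto_toReal ENNReal.zero_ne_top).comp (h.continuous_L2 s hs)
  refine ⟨√ S.toReal, fun t ht => (h.memH1 t ht).1, fun t ht => ?_,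
    fun t ht j => (h.memH1 t ht).hasWeakPartial j, fun t ht j => (h.memH1 t ht).memL2_weakPartial j,
    fun t ht j => ?_, hcont, fun η hη s t hs hst => ?_⟩
  · exact nn_le_sqrt (h.memH1 t ht).1 hb (le_self_add.trans (hle t ht))
  · refine nn_le_sqrt ((h.memH1 t ht).memL2_weakPartial j) hb (le_trans ?_ (hle t ht))
    exact (Finset.single_le_sum (f := fun j => ∫⁻ x, ‖weakPartial j (φ t) x‖ₑ ^ 2)
      (fun _ _ => zero_le) (Finset.mem_univ j)).trans le_add_self
  · have ht := hs.trans hst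
    have e1 := h.equation η hη t ht
    have e2 := h.equation η hη s hs
    have hG : ContinuousOn (fun s => ∫ x, φ s x * Laplacian.laplacian η x) (Ici 0) := by
      have hl := laplacian_test hη
      intro s hs
      rw [ContinuousWithinAt, tendsto_iff_norm_sub_tendsto_zero]
      have hu := Tendsto.mul_const (nn (fun x => (starRingEnd ℂ) (Laplacian.laplacian η x)))
        (hcont s hs)
      rw [zero_mul] at hu
      refine tendsto_of_tendsto_of_tendsto_of_le_of_le' tendsto_const_nhds hu
        (Eventually.of_forall fun _ => norm_nonneg _) ?_
      filter_upwards [self_mem_nhdsWithin] with t ht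
      have e : ∀ u : E3 → ℂ, ∫ x, u x * Laplacian.laplacian η x
          = ip u (fun x => (starRingEnd ℂ) (Laplacian.laplacian η x)) := fun u => by
        simp only [ip, Complex.conj_conj]
      rw [e, e, ← ip_sub_left (h.memH1 t ht).1 (h.memH1 s hs).1 hl.conj.memLp]
      exact norm_ip_le ((h.memH1 t ht).1.sub (h.memH1 s hs).1) hl.conj.memLp
    have hGi : ∀ a b, 0 ≤ a → a ≤ b → IntervalIntegrable
        (fun s => ∫ x, φ s x * Laplacian.laplacian η x) volume a b := fun a b ha hab =>
      (hG.mono (by rw [uIcc_of_le hab]; exact fun s hs => ha.trans hs.1)).intervalIntegrable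
    -- The equation on `[s, t]` is the difference of the equations on `[0, t]` and `[0, s]`.
    rw [← intervalIntegral.integral_add_adjacent_intervals (hGi 0 s le_rfl hs) (hGi s t hs hst),
      ← intervalIntegral.integral_add_adjacent_intervals
        (h.intervalIntegrable_interaction hη le_rfl hs)
        (h.intervalIntegrable_interaction hη hs hst)] at e1
    linear_combination e1 - e2

end

/-! ### Removing the regularisation -/

section
variable {F : ℝ → ℝ} {ρ : ℝ → ℝ} {α : ℝ} {N : ℝ → ℝ → ℝ → ℂ} {φ : ℝ → E3 → ℂ}
  {v : ℝ → Fin 3 → E3 → ℂ} {M T₀ C β₀ : ℝ}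

/-- The function with `γ F(⟨x⟩/T) u = -i (γF u)`, where `v` is the gradient of `u`. -/
def gcut (ρ : ℝ → ℝ) (F : ℝ → ℝ) (T : ℝ) (u : E3 → ℂ) (v : Fin 3 → E3 → ℂ) (x : E3) : ℂ :=
  (F (jap ρ x / T) : ℂ) * qfun ρ u v x + ((deriv F (jap ρ x / T) / T : ℝ) : ℂ) * u x

lemma eventually_chi_eq (r : ℝ) : ∀ᶠ n : ℕ in atTop,
    chi (r / ((n : ℝ) + 1)) = 1 ∧ deriv chi (r / ((n : ℝ) + 1)) = 0 := by
  obtain ⟨m, hm⟩ := exists_nat_gt r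
  filter_upwards [eventually_ge_atTop m] with n hn
  have h : r / ((n : ℝ) + 1) < 1 := by
    have : (m : ℝ) ≤ n := by exact_mod_cast hn
    rw [div_lt_one (by positivity)]; linarith
  exact ⟨chi_eq_one h.le, deriv_chi_eq_zero (Or.inl h)⟩

lemma deriv2_chi_eq_zero {s : ℝ} (hs : s < 1 ∨ 2 < s) : deriv (deriv chi) s = 0 :=
  deriv_eq_zero_of_eq_zero (fun _ => deriv_chi_eq_zero) hs

lemma tendsto_prof (F : ℝ → ℝ) (T r : ℝ) :
    Tendsto (fun n : ℕ => prof F T ((n : ℝ) + 1) r) atTop (𝓝 (F (r / T))) := by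
  refine tendsto_const_nhds.congr' ?_
  filter_upwards [eventually_chi_eq r] with n hn
  rw [prof, hn.1, mul_one]

lemma tendsto_prof1 (F : ℝ → ℝ) (T r : ℝ) :
    Tendsto (fun n : ℕ => prof1 F T ((n : ℝ) + 1) r) atTop (𝓝 (deriv F (r / T) / T)) := by
  refine tendsto_const_nhds.congr' ?_
  filter_upwards [eventually_chi_eq r] with n hn
  rw [prof1, hn.1, hn.2]; simp

lemma tendsto_prof2 (F : ℝ → ℝ) (T r : ℝ) :
    Tendsto (fun n : ℕ => prof2 F T ((n : ℝ) + 1) r) atTop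
      (𝓝 (deriv (deriv F) (r / T) / T / T)) := by
  refine tendsto_const_nhds.congr' ?_
  obtain ⟨m, hm⟩ := exists_nat_gt r
  filter_upwards [eventually_chi_eq r, eventually_ge_atTop m] with n hn hn2
  have h : r / ((n : ℝ) + 1) < 1 := by
    have : (m : ℝ) ≤ n := by exact_mod_cast hn2
    rw [div_lt_one (by positivity)]; linarith
  rw [prof2, hn.1, hn.2, deriv2_chi_eq_zero (Or.inl h)]; simp

/-- On the region where a profile does not vanish, `∇⟨x⟩` is a unit vector. -/
lemma mul_sum_bvec_sq (hρ : IsBump ρ) {T : ℝ} (hT : 8 ≤ T) {f : ℝ → ℝ}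
    (hf : ∀ l, l < 1 / 2 → f l = 0) (x : E3) :
    f (jap ρ x / T) * ∑ j, bvec ρ j x ^ 2 = f (jap ρ x / T) := by
  rcases lt_or_ge (jap ρ x) 4 with h | h
  · rw [hf, zero_mul]
    rw [div_lt_iff₀ (by linarith)]; linarith
  · have := norm_ge_of_jap_ge hρ (by norm_num) h
    rw [sum_bvec_sq (by linarith), mul_one]

lemma prof_eq_zero (hF : IsSmoothChar F) {l : ℝ} (hl : l < 1 / 2) :
    F l = 0 ∧ deriv F l = 0 ∧ deriv (deriv F) l = 0 :=
  ⟨hF.eq_zero l hl.le, hF.deriv_eq_zero (Or.inl hl),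
    deriv_eq_zero_of_eq_zero (fun _ => hF.deriv_eq_zero) (Or.inl hl)⟩

lemma prof2_mul_sum_bvec_sq (hρ : IsBump ρ) (hF : IsSmoothChar F) {T : ℝ} (hT : 8 ≤ T) (S : ℝ)
    (x : E3) : prof2 F T S (jap ρ x) * ∑ j, bvec ρ j x ^ 2 = prof2 F T S (jap ρ x) := by
  have h1 := mul_sum_bvec_sq hρ hT (fun l hl => (prof_eq_zero hF hl).1) x
  have h2 := mul_sum_bvec_sq hρ hT (fun l hl => (prof_eq_zero hF hl).2.1) x
  have h3 := mul_sum_bvec_sq hρ hT (fun l hl => (prof_eq_zero hF hl).2.2) x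
  rw [prof2]
  linear_combination chi (jap ρ x / S) / T / T * h3
    + 2 / T * (deriv chi (jap ρ x / S) / S) * h2 + deriv (deriv chi) (jap ρ x / S) / S / S * h1

lemma L2_qfun (hρ : IsBump ρ) {u : E3 → ℂ} {w : Fin 3 → E3 → ℂ} (hu : L2 u)
    (hw : ∀ j, L2 (w j)) : L2 (qfun ρ u w) := by
  obtain ⟨B, _, hb, hcf, _⟩ := exists_coeff_bound hρ
  exact (L2.sum _ fun j => (hw j).real_mul_of_bound (contDiff_bvec hρ j).continuous.measurable
    (hb j)).add (hu.real_mul_of_bound (contDiff_cfun hρ).continuous.measurable hcf)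

lemma measurable_comp_jap (hρ : IsBump ρ) {f : ℝ → ℝ} (hf : Continuous f) (T : ℝ) :
    Measurable (fun x => f (jap ρ x / T)) :=
  (hf.comp ((contDiff_jap hρ).continuous.div_const T)).measurable

lemma L2_gcut (hρ : IsBump ρ) (hF : IsSmoothChar F) {T : ℝ} (hT : 1 ≤ T) {u : E3 → ℂ}
    {w : Fin 3 → E3 → ℂ} (hu : L2 u) (hw : ∀ j, L2 (w j)) : L2 (gcut ρ F T u w) := by
  obtain ⟨D, hD, h1, -⟩ := hF.exists_bounds
  refine ((L2_qfun hρ hu hw).real_mul_of_bound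
    (measurable_comp_jap hρ hF.smooth.continuous T) fun x => hF.abs_le _).add ?_
  exact hu.real_mul_of_bound ((measurable_comp_jap hρ hF.contDiff_deriv.continuous T).div_const T)
    fun x => abs_div_le_of_one_le (h1 _) hT

lemma tendsto_trunc (hρ : IsBump ρ) (hF : IsSmoothChar F)
    (hc : ∀ n, CutoffFamily ρ N φ T₀ C β₀ (cut ρ α F n) (cutTime ρ α F n))
    (h : SolutionCurve N φ v M) {t : ℝ} (ht : T₀ ≤ t) :
    L2Tendsto (fun n => trunc n (cut ρ α F n) φ t) atTop
      (fun x => (F (jap ρ x / t ^ α) : ℂ) * φ t x) ∧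
    ∀ j, L2Tendsto (fun n => partialDeriv j (trunc n (cut ρ α F n) φ t)) atTop
      (fun x => (F (jap ρ x / t ^ α) : ℂ) * v t j x
        + ((deriv F (jap ρ x / t ^ α) / t ^ α * bvec ρ j x : ℝ) : ℂ) * φ t x) := by
  have ht0 := (hc 0).pos ht
  refine moll_approx (C := 1 + C) (h.memL2 t ht0) (h.grad_memL2 t ht0) (h.weak t ht0)
    (a := fun n => cut ρ α F n t) (fun n => (hc n).smooth t ht) (fun n x => ?_) (fun n j x => ?_)
    (fun x => tendsto_prof F _ _) fun j x => ?_
  · exact ((hc n).abs_le t ht x).trans (by linarith [(hc 0).nonneg])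
  · exact ((hc n).partial_le t ht j x).trans (by linarith)
  · simp only [partialDeriv_cut hρ hF]
    exact (tendsto_prof1 F _ _).mul_const _

lemma tendsto_gam_trunc (hρ : IsBump ρ) (hF : IsSmoothChar F)
    (hc : ∀ n, CutoffFamily ρ N φ T₀ C β₀ (cut ρ α F n) (cutTime ρ α F n))
    (h : SolutionCurve N φ v M) (hT : ∀ t, T₀ ≤ t → 8 ≤ t ^ α) {t : ℝ} (ht : T₀ ≤ t) :
    L2Tendsto (fun n => gam ρ (trunc n (cut ρ α F n) φ t)) atTop
      (fun x => -Complex.I * gcut ρ F (t ^ α) (φ t) (v t) x) := by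
  have ht0 := (hc 0).pos ht
  obtain ⟨B, hB, hb, hcf, _⟩ := exists_coeff_bound hρ
  obtain ⟨D, hD, h1, -⟩ := hF.exists_bounds
  have hT8 := hT t ht
  obtain ⟨k1, k2⟩ := tendsto_trunc hρ hF hc h ht
  have hw := fun n => (hc n).isTest_trunc h n ht
  have hu := h.memL2 t ht0
  have hm1 := measurable_comp_jap hρ hF.smooth.continuous (t ^ α)
  have hm2 := measurable_comp_jap hρ hF.contDiff_deriv.continuous (t ^ α)
  have hg0 : L2 (fun x => (F (jap ρ x / t ^ α) : ℂ) * φ t x) :=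
    hu.real_mul_of_bound hm1 fun x => hF.abs_le _
  have hg : ∀ j, L2 (fun x => (F (jap ρ x / t ^ α) : ℂ) * v t j x
        + ((deriv F (jap ρ x / t ^ α) / t ^ α * bvec ρ j x : ℝ) : ℂ) * φ t x) := fun j => by
    refine ((h.grad_memL2 t ht0 j).real_mul_of_bound hm1 fun x => hF.abs_le _).add
      (hu.real_mul_of_bound (C := D * B) ((hm2.div_const _).mul
        (contDiff_bvec hρ j).continuous.measurable) fun x => ?_)
    rw [abs_mul]
    exact mul_le_mul (abs_div_le_of_one_le (h1 _) (by linarith)) (hb j x) (abs_nonneg _) hD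
  have nb : ∀ (f : E3 → ℝ), (∀ x, |f x| ≤ B) → ∀ x, ‖(f x : ℂ)‖ ≤ B := fun f hf x => by
    rw [Complex.norm_real]; exact hf x
  have hd := fun n j => ((hw n).partialDeriv j).memLp
  have s1 : ∀ j, L2Tendsto (fun n x => (bvec ρ j x : ℂ) * partialDeriv j (trunc n (cut ρ α F n) φ t) x)
      atTop (fun x => (bvec ρ j x : ℂ) * ((F (jap ρ x / t ^ α) : ℂ) * v t j x
        + ((deriv F (jap ρ x / t ^ α) / t ^ α * bvec ρ j x : ℝ) : ℂ) * φ t x)) := fun j =>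
    (k2 j).bdd_mul (C := B) (fun n => hd n j) (hg j) (nb _ (hb j))
  have l1 : ∀ j {f : E3 → ℂ}, L2 f → L2 (fun x => (bvec ρ j x : ℂ) * f x) := fun j f hf =>
    hf.real_mul_of_bound (contDiff_bvec hρ j).continuous.measurable (hb j)
  have l2 : ∀ {f : E3 → ℂ}, L2 f → L2 (fun x => (cfun ρ x : ℂ) * f x) := fun hf =>
    hf.real_mul_of_bound (contDiff_cfun hρ).continuous.measurable hcf
  have s2 := L2Tendsto.sum Finset.univ s1 (fun j n => l1 j (hd n j)) (fun j => l1 j (hg j))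
  have s3 := k1.bdd_mul (a := fun x => (cfun ρ x : ℂ)) (fun n => (hw n).memLp) hg0 (nb _ hcf)
  have s4 := s2.add s3 (fun n => L2.sum _ fun j => l1 j (hd n j)) (fun n => l2 (hw n).memLp)
    (L2.sum _ fun j => l1 j (hg j)) (l2 hg0)
  have s5 := s4.bdd_mul (a := fun _ => -Complex.I) (C := 1)
    (fun n => (L2.sum _ fun j => l1 j (hd n j)).add (l2 (hw n).memLp))
    ((L2.sum _ fun j => l1 j (hg j)).add (l2 hg0)) (fun x => by simp)
  refine s5.congr (Eventually.of_forall fun n => ae_eq_rfl) (Eventually.of_forall fun x => ?_)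
  -- The derivative of the cutoff enters through `∇⟨x⟩ · ∇F = (F'/T) |∇⟨x⟩|²`, and `|∇⟨x⟩| = 1` on
  -- the support of `F'`.
  have e := mul_sum_bvec_sq hρ hT8 (fun l hl => (prof_eq_zero hF hl).2.1) x
  have e' := congrArg (fun r : ℝ => ((r / t ^ α : ℝ) : ℂ)) e
  simp only [gcut, qfun, Fin.sum_univ_three] at e' ⊢
  push_cast at e' ⊢
  linear_combination -Complex.I * φ t x * e'

lemma tendsto_moll_gam (hρ : IsBump ρ) (hF : IsSmoothChar F)
    (hc : ∀ n, CutoffFamily ρ N φ T₀ C β₀ (cut ρ α F n) (cutTime ρ α F n))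
    (h : SolutionCurve N φ v M) (hT : ∀ t, T₀ ≤ t → 8 ≤ t ^ α) {t : ℝ} (ht : T₀ ≤ t) :
    L2Tendsto (fun n => moll n (gam ρ (trunc n (cut ρ α F n) φ t))) atTop
      (fun x => -Complex.I * gcut ρ F (t ^ α) (φ t) (v t) x) := by
  have ht0 := (hc 0).pos ht
  exact L2Tendsto_moll (fun n => (((hc n).isTest_trunc h n ht).gam hρ).memLp)
    ((L2_gcut hρ hF (by linarith [hT t ht]) (h.memL2 t ht0) (h.grad_memL2 t ht0)).smul _)
    (tendsto_gam_trunc hρ hF hc h hT ht)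

/-- The expectation of the observable. -/
def obs (ρ : ℝ → ℝ) (F : ℝ → ℝ) (T : ℝ) (u : E3 → ℂ) (w : Fin 3 → E3 → ℂ) : ℂ :=
  ip (fun x => (F (jap ρ x / T) : ℂ) * u x) (fun x => -Complex.I * gcut ρ F T u w x)

lemma tendsto_mreg (hρ : IsBump ρ) (hF : IsSmoothChar F)
    (hc : ∀ n, CutoffFamily ρ N φ T₀ C β₀ (cut ρ α F n) (cutTime ρ α F n))
    (h : SolutionCurve N φ v M) (hT : ∀ t, T₀ ≤ t → 8 ≤ t ^ α) {t : ℝ} (ht : T₀ ≤ t) : Tendsto (fun n => (mreg ρ n (cut ρ α F n) φ t : ℂ)) atTop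
    (𝓝 (obs ρ F (t ^ α) (φ t) (v t))) := by
  have ht0 := (hc 0).pos ht
  have hu := h.memL2 t ht0
  have hw := fun n => (hc n).isTest_trunc h n ht
  have := (tendsto_trunc hρ hF hc h ht).1.ip (tendsto_gam_trunc hρ hF hc h hT ht)
    (fun n => (hw n).memLp) (fun n => ((hw n).gam hρ).memLp)
    (hu.real_mul_of_bound (measurable_comp_jap hρ hF.smooth.continuous (t ^ α))
      fun x => hF.abs_le _)
    ((L2_gcut hρ hF (by linarith [hT t ht]) hu (h.grad_memL2 t ht0)).smul _)
  refine this.congr fun n => ?_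
  -- By symmetry of `γ` the regularised expectation is real, so taking its real part loses nothing.
  rw [mreg, Complex.conj_eq_iff_re.1]
  rw [ip_conj, ← ip_gam_comm hρ (hw n) (hw n)]

lemma tendsto_mreg_re (hρ : IsBump ρ) (hF : IsSmoothChar F)
    (hc : ∀ n, CutoffFamily ρ N φ T₀ C β₀ (cut ρ α F n) (cutTime ρ α F n))
    (h : SolutionCurve N φ v M) (hT : ∀ t, T₀ ≤ t → 8 ≤ t ^ α) {t : ℝ} (ht : T₀ ≤ t) : Tendsto (fun n => mreg ρ n (cut ρ α F n) φ t) atTop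
    (𝓝 (obs ρ F (t ^ α) (φ t) (v t)).re) :=
  Tendsto.comp (g := Complex.re) (f := fun n => ((mreg ρ n (cut ρ α F n) φ t : ℝ) : ℂ))
    (Complex.continuous_re.tendsto _) (tendsto_mreg hρ hF hc h hT ht)

/-- A limit of real numbers is real. -/
lemma obs_im (hρ : IsBump ρ) (hF : IsSmoothChar F)
    (hc : ∀ n, CutoffFamily ρ N φ T₀ C β₀ (cut ρ α F n) (cutTime ρ α F n))
    (h : SolutionCurve N φ v M) (hT : ∀ t, T₀ ≤ t → 8 ≤ t ^ α) {t : ℝ} (ht : T₀ ≤ t) : obs ρ F (t ^ α) (φ t) (v t) = ((obs ρ F (t ^ α) (φ t) (v t)).re : ℂ) := by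
  have h1 := tendsto_mreg hρ hF hc h hT ht
  exact tendsto_nhds_unique h1
    ((Complex.continuous_ofReal.tendsto _).comp (tendsto_mreg_re hρ hF hc h hT ht))

/-- The flux in the limit of vanishing regularisation. -/
def flux (ρ : ℝ → ℝ) (α : ℝ) (F : ℝ → ℝ) (t : ℝ) (u : E3 → ℂ) (w : Fin 3 → E3 → ℂ) : ℝ :=
  2 * (-Complex.I * ip (fun x => 2 * ((deriv F (jap ρ x / t ^ α) / t ^ α : ℝ) : ℂ) * qfun ρ u w x
        + ((deriv (deriv F) (jap ρ x / t ^ α) / t ^ α / t ^ α : ℝ) : ℂ) * u x)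
      (fun x => -Complex.I * gcut ρ F (t ^ α) u w x)
    + ip (fun x => ((-(α / t) * (jap ρ x / t ^ α * deriv F (jap ρ x / t ^ α)) : ℝ) : ℂ) * u x)
      (fun x => -Complex.I * gcut ρ F (t ^ α) u w x)).re

/-- For a radial cutoff `f(⟨x⟩)` the commutator `[Δ, f] φ` is `2 f' q + f'' φ`. Indeed `Δ⟨x⟩ = 2
cfun` combines with `2 f' ∇⟨x⟩ · ∇φ` into `2 f' q`, and `|∇⟨x⟩| = 1` on the support of `f''`. The
limit then only involves bounded multipliers that converge pointwise. -/
lemma tendsto_flux (hρ : IsBump ρ) (hF : IsSmoothChar F)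
    (hc : ∀ n, CutoffFamily ρ N φ T₀ C β₀ (cut ρ α F n) (cutTime ρ α F n))
    (h : SolutionCurve N φ v M) (hT : ∀ t, T₀ ≤ t → 8 ≤ t ^ α) {t : ℝ} (ht : T₀ ≤ t) : Tendsto (fun n => 2 * (-Complex.I * ip (fun x =>
        ∑ j, (2 * ((partialDeriv j (cut ρ α F n t) x : ℝ) : ℂ) * v t j x
          + ((partialDeriv j (partialDeriv j (cut ρ α F n t)) x : ℝ) : ℂ) * φ t x))
          (moll n (gam ρ (trunc n (cut ρ α F n) φ t)))
        + ip (fun x => (cutTime ρ α F n t x : ℂ) * φ t x)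
          (moll n (gam ρ (trunc n (cut ρ α F n) φ t)))).re) atTop
    (𝓝 (flux ρ α F t (φ t) (v t))) := by
  have ht0 := (hc 0).pos ht
  have hu := h.memL2 t ht0
  have hT8 := hT t ht
  have hT1 : 1 ≤ t ^ α := by linarith
  have hq := L2_qfun hρ hu (h.grad_memL2 t ht0)
  obtain ⟨D, hD, h1, h2, -⟩ := hF.exists_bounds
  obtain ⟨E, hE, hp⟩ := exists_prof_bounds hF
  have hS : ∀ n : ℕ, (1 : ℝ) ≤ (n : ℝ) + 1 := fun n => by
    linarith [(Nat.cast_nonneg n : (0 : ℝ) ≤ n)]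
  have hj := (contDiff_jap hρ).continuous.measurable
  have mea : ∀ {f : ℝ → ℝ}, Continuous f → Measurable (fun x => f (jap ρ x)) := fun hf =>
    hf.measurable.comp hj
  have c1 : ∀ n : ℕ, Continuous (prof1 F (t ^ α) ((n : ℝ) + 1)) := fun n =>
    (contDiff_prof1 hF.smooth _ _).continuous
  have c2 : ∀ n : ℕ, Continuous (prof2 F (t ^ α) ((n : ℝ) + 1)) := fun n => by
    rw [← deriv_prof1 hF.smooth]
    exact (contDiff_prof1 hF.smooth _ _).continuous_deriv (by simp)
  have toC : ∀ {f : E3 → ℝ}, Measurable f → AEStronglyMeasurable (fun x => (f x : ℂ)) volume :=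
    fun hf => (Complex.measurable_ofReal.comp hf).aestronglyMeasurable
  have p1 : L2Tendsto (fun (n : ℕ) x => ((prof1 F (t ^ α) ((n : ℝ) + 1) (jap ρ x) : ℝ) : ℂ)
      * (2 * qfun ρ (φ t) (v t) x)) atTop
      (fun x => ((deriv F (jap ρ x / t ^ α) / t ^ α : ℝ) : ℂ) * (2 * qfun ρ (φ t) (v t) x)) :=
    L2Tendsto.of_multiplier (C := E) (hq.smul 2) (fun n => toC (mea (c1 n)))
      (fun n x => by rw [Complex.norm_real]; exact (hp _ _ _ hT1 (hS n)).1)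
      fun x => (Complex.continuous_ofReal.tendsto _).comp (tendsto_prof1 F _ _)
  have p2 : L2Tendsto (fun (n : ℕ) x => ((prof2 F (t ^ α) ((n : ℝ) + 1) (jap ρ x) : ℝ) : ℂ)
      * φ t x) atTop
      (fun x => ((deriv (deriv F) (jap ρ x / t ^ α) / t ^ α / t ^ α : ℝ) : ℂ) * φ t x) :=
    L2Tendsto.of_multiplier (C := E) hu (fun n => toC (mea (c2 n)))
      (fun n x => by rw [Complex.norm_real]; exact (hp _ _ _ hT1 (hS n)).2)
      fun x => (Complex.continuous_ofReal.tendsto _).comp (tendsto_prof2 F _ _)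
  have m1 : Measurable (fun x => deriv F (jap ρ x / t ^ α) / t ^ α) :=
    (measurable_comp_jap hρ hF.contDiff_deriv.continuous (t ^ α)).div_const _
  have m2 : Measurable (fun x => deriv (deriv F) (jap ρ x / t ^ α) / t ^ α / t ^ α) :=
    ((measurable_comp_jap hρ hF.contDiff_deriv2.continuous (t ^ α)).div_const _).div_const _
  have lp1 := (hq.smul 2).real_mul_of_bound m1 fun x => abs_div_le_of_one_le (h1 _) hT1
  have lp2 := hu.real_mul_of_bound m2 fun x =>
    abs_div_le_of_one_le (abs_div_le_of_one_le (h2 _) hT1) hT1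
  have lq1 : ∀ n : ℕ, L2 (fun x => ((prof1 F (t ^ α) ((n : ℝ) + 1) (jap ρ x) : ℝ) : ℂ)
      * (2 * qfun ρ (φ t) (v t) x)) := fun n =>
    (hq.smul 2).real_mul_of_bound (mea (c1 n)) fun x => (hp _ _ _ hT1 (hS n)).1
  have lq2 : ∀ n : ℕ, L2 (fun x => ((prof2 F (t ^ α) ((n : ℝ) + 1) (jap ρ x) : ℝ) : ℂ)
      * φ t x) := fun n =>
    hu.real_mul_of_bound (mea (c2 n)) fun x => (hp _ _ _ hT1 (hS n)).2
  have p3 := p1.add p2 lq1 lq2 lp1 lp2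
  have ctime : ∀ n : ℕ, Measurable (cutTime ρ α F n t) := fun n => (hc n).time_meas t ht
  have limt : ∀ x, Tendsto (fun n => cutTime ρ α F n t x) atTop
      (𝓝 (-(α / t) * (jap ρ x / t ^ α * deriv F (jap ρ x / t ^ α)))) := fun x => by
    refine tendsto_const_nhds.congr' ?_
    filter_upwards [eventually_chi_eq (jap ρ x)] with n hn
    rw [cutTime, hn.1, mul_one]
  have p4 : L2Tendsto (fun n x => (cutTime ρ α F n t x : ℂ) * φ t x) atTop
      (fun x => ((-(α / t) * (jap ρ x / t ^ α * deriv F (jap ρ x / t ^ α)) : ℝ) : ℂ) * φ t x) :=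
    L2Tendsto.of_multiplier (C := C) hu (fun n => toC (ctime n))
      (fun n x => by rw [Complex.norm_real]; exact (hc n).time_le t ht x)
      fun x => (Complex.continuous_ofReal.tendsto _).comp (limt x)
  have lp4 : L2 (fun x => ((-(α / t) * (jap ρ x / t ^ α * deriv F (jap ρ x / t ^ α)) : ℝ) : ℂ)
      * φ t x) := by
    refine hu.real_mul_of_bound (C := C) (((hj.div_const _).mul
      (measurable_comp_jap hρ hF.contDiff_deriv.continuous (t ^ α))).const_mul _) fun x => ?_
    exact le_of_tendsto (limt x).abs (Eventually.of_forall fun n => (hc n).time_le t ht x)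
  have hg := tendsto_moll_gam hρ hF hc h hT ht
  have lg := (L2_gcut hρ hF hT1 hu (h.grad_memL2 t ht0)).smul (-Complex.I)
  have lm : ∀ n, L2 (moll n (gam ρ (trunc n (cut ρ α F n) φ t))) := fun n =>
    L2_moll n (((hc n).isTest_trunc h n ht).gam hρ).memLp
  have q1 := p3.ip hg (fun n => (lq1 n).add (lq2 n)) lm (lp1.add lp2) lg
  have q2 := p4.ip hg (fun n => (hc n).memL2_time ht hu) lm lp4 lg
  have q3 := ((Complex.continuous_re.tendsto _).comp ((q1.const_mul (-Complex.I)).add q2)).const_mul 2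
  have e0 : flux ρ α F t (φ t) (v t) = 2 * (-Complex.I * ip (fun x =>
      ((deriv F (jap ρ x / t ^ α) / t ^ α : ℝ) : ℂ) * (2 * qfun ρ (φ t) (v t) x)
        + ((deriv (deriv F) (jap ρ x / t ^ α) / t ^ α / t ^ α : ℝ) : ℂ) * φ t x)
      (fun x => -Complex.I * gcut ρ F (t ^ α) (φ t) (v t) x)
    + ip (fun x => ((-(α / t) * (jap ρ x / t ^ α * deriv F (jap ρ x / t ^ α)) : ℝ) : ℂ) * φ t x)
      (fun x => -Complex.I * gcut ρ F (t ^ α) (φ t) (v t) x)).re := by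
    rw [flux]
    congr 6; ext x; ring
  rw [e0]
  refine q3.congr fun n => ?_
  simp only [Function.comp]
  congr 6
  ext x
  have e1 := congrArg (fun r : ℝ => (r : ℂ)) (prof2_mul_sum_bvec_sq hρ hF hT8 ((n : ℝ) + 1) x)
  simp only [partialDeriv_partialDeriv_cut hρ hF]
  simp only [partialDeriv_cut hρ hF, qfun, cfun, Fin.sum_univ_three] at e1 ⊢
  push_cast at e1 ⊢
  linear_combination -φ t x * e1

end

/-! ### Positivity of the flux up to integrable errors -/

/-- The integrand of the flux at one point, with `a, d, e` the values of `F, F', F''` at `l =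
⟨x⟩/T`, `τ = α/t`, `y` the solution and `z = q`. The commutator with the cutoff yields four copies
of `T⁻¹ d a |z|²`. One of them completes the square with the term from the moving cutoff, leaving
three and an error `τ² l² d a T |y|²`. -/
lemma pointwise_flux {D a d e l τ t T : ℝ} {y z : ℂ} (ha : 0 ≤ a) (ha1 : a ≤ 1) (hd : 0 ≤ d)
    (hdD : d ≤ D) (hld : l ^ 2 * d ≤ D) (he : |e| ≤ D) (hτ0 : 0 ≤ τ) (hτ : τ * t ≤ 1) (ht : 0 < t)
    (hT : 0 < T) :
    3 * (T⁻¹ * (d * a * ‖z‖ ^ 2))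
      + 2 * (T⁻¹ ^ 2 * (y * (starRingEnd ℂ) (((2 * d ^ 2 + e * a : ℝ) : ℂ) * z)).re)
      - (2 * D ^ 2 + D) * (T⁻¹ ^ 3 + T / t ^ 2) * ‖y‖ ^ 2
    ≤ 2 * (-Complex.I * ((2 * ((d / T : ℝ) : ℂ) * z + ((e / T / T : ℝ) : ℂ) * y)
          * (starRingEnd ℂ) (-Complex.I * ((a : ℂ) * z + ((d / T : ℝ) : ℂ) * y)))
        + (((-τ * (l * d) : ℝ) : ℂ) * y)
          * (starRingEnd ℂ) (-Complex.I * ((a : ℂ) * z + ((d / T : ℝ) : ℂ) * y))).re := by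
  obtain ⟨y1, y2⟩ := y
  obtain ⟨z1, z2⟩ := z
  have hy : ‖(⟨y1, y2⟩ : ℂ)‖ ^ 2 = y1 ^ 2 + y2 ^ 2 := by
    rw [Complex.sq_norm, Complex.normSq_mk]; ring
  have hz : ‖(⟨z1, z2⟩ : ℂ)‖ ^ 2 = z1 ^ 2 + z2 ^ 2 := by
    rw [Complex.sq_norm, Complex.normSq_mk]; ring
  rw [hy, hz]
  have hD : 0 ≤ D := hd.trans hdD
  have e1 : -(D ^ 2) ≤ e * d := by
    have := abs_mul e d
    have h2 : |e * d| ≤ D * D := by rw [abs_mul, abs_of_nonneg hd]; gcongr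
    linarith [(abs_le.1 h2).1]
  have e2 : τ ^ 2 * (l ^ 2 * d) * a ≤ D * (1 / t ^ 2) := by
    have h1 : τ ^ 2 ≤ 1 / t ^ 2 := by
      rw [le_div_iff₀ (by positivity), ← mul_pow]
      exact pow_le_one₀ (by positivity) hτ
    have h2 : (l ^ 2 * d) * a ≤ D := (mul_le_of_le_one_right (by positivity) ha1).trans hld
    rw [mul_assoc, mul_comm D]
    exact mul_le_mul h1 h2 (by positivity) (by positivity)
  set Y := y1 ^ 2 + y2 ^ 2 with hY
  have hY0 : 0 ≤ Y := by positivity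
  -- The exact identity with the completed square displayed. The `|y|²` part of the moving-cutoff
  -- term has the purely imaginary coefficient `i` and does not contribute to the real part.
  have hid : 2 * (-Complex.I * ((2 * ((d / T : ℝ) : ℂ) * (⟨z1, z2⟩ : ℂ) + ((e / T / T : ℝ) : ℂ) * (⟨y1, y2⟩ : ℂ))
          * (starRingEnd ℂ) (-Complex.I * ((a : ℂ) * (⟨z1, z2⟩ : ℂ) + ((d / T : ℝ) : ℂ) * (⟨y1, y2⟩ : ℂ))))
        + (((-τ * (l * d) : ℝ) : ℂ) * (⟨y1, y2⟩ : ℂ))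
          * (starRingEnd ℂ) (-Complex.I * ((a : ℂ) * (⟨z1, z2⟩ : ℂ) + ((d / T : ℝ) : ℂ) * (⟨y1, y2⟩ : ℂ)))).re
      = 3 * (T⁻¹ * (d * a * (z1 ^ 2 + z2 ^ 2)))
      + 2 * (T⁻¹ ^ 2 * ((⟨y1, y2⟩ : ℂ) * (starRingEnd ℂ) (((2 * d ^ 2 + e * a : ℝ) : ℂ) * (⟨z1, z2⟩ : ℂ))).re)
      + 2 * (T⁻¹ ^ 3 * (e * d)) * Y
      + T⁻¹ * (d * a) * ((z1 + τ * l * T * y2) ^ 2 + (z2 - τ * l * T * y1) ^ 2)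
      - τ ^ 2 * (l ^ 2 * d) * a * T * Y := by
    simp [hY, pow_two]
    field_simp
    ring
  rw [hid]
  have hi : 0 < T⁻¹ := inv_pos.2 hT
  have f1 : T⁻¹ ^ 3 * (-(D ^ 2)) * Y ≤ T⁻¹ ^ 3 * (e * d) * Y := by gcongr
  have f2 : τ ^ 2 * (l ^ 2 * d) * a * T * Y ≤ D * (1 / t ^ 2) * T * Y := by gcongr
  have f3 : 0 ≤ T⁻¹ * (d * a) * ((z1 + τ * l * T * y2) ^ 2 + (z2 - τ * l * T * y1) ^ 2) := by
    positivity
  have f4 : 0 ≤ D * T⁻¹ ^ 3 * Y := by positivity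
  have f5 : 0 ≤ 2 * D ^ 2 * (T / t ^ 2) * Y := by positivity
  have f6 : D * (1 / t ^ 2) * T * Y = D * (T / t ^ 2) * Y := by ring
  linarith

/-- Integration by parts removes the gradient from a cross term. -/
lemma abs_cross_term_le {ρ : ℝ → ℝ} (hρ : IsBump ρ) {u : E3 → ℂ} {w : Fin 3 → E3 → ℂ} (hu : L2 u)
    (hw : ∀ j, L2 (w j)) (h : ∀ j, HasWeakPartial j u (w j)) {G : ℝ → ℝ} (hG : ContDiff ℝ ∞ G)
    {D : ℝ} (hGD : ∀ l, |G l| ≤ D) (hGD' : ∀ l, |deriv G l| ≤ D)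
    (hG0 : ∀ l, l < 1 / 2 → G l = 0) {T : ℝ} (hT : 8 ≤ T) :
    |2 * (ip u (fun x => (G (jap ρ x / T) : ℂ) * qfun ρ u w x)).re| ≤ D * T⁻¹ * nn u ^ 2 := by
  obtain ⟨B, hB, hb, hcf, hbb⟩ := exists_coeff_bound hρ
  have hD : 0 ≤ D := (abs_nonneg _).trans (hGD 0)
  have hT0 : 0 < T := by linarith
  have hGs : ContDiff ℝ ∞ (fun r => G (r / T)) := hG.comp (contDiff_id.div_const T)
  have hg : ContDiff ℝ ∞ (fun x => G (jap ρ x / T)) := hGs.comp (contDiff_jap hρ)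
  have hG0' : ∀ l, l < 1 / 2 → deriv G l = 0 := fun l hl => by
    refine deriv_eq_zero_of_eventually (c := 0) ?_
    filter_upwards [gt_mem_nhds hl] with y hy using hG0 y hy
  have hpg : ∀ j x, partialDeriv j (fun x => G (jap ρ x / T) * bvec ρ j x) x
      = deriv G (jap ρ x / T) / T * bvec ρ j x ^ 2
        + G (jap ρ x / T) * partialDeriv j (bvec ρ j) x := by
    intro j x
    have := partialDeriv_comp_jap hρ (hGs.differentiable (by simp)) j x
    rw [(hasDerivAt_div_comp hG T (jap ρ x)).deriv] at this
    rw [partialDeriv_mul_real (hg.differentiable (by simp) x)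
      ((contDiff_bvec hρ j).differentiable (by simp) x), this]
    ring
  have hdT : ∀ l, |deriv G l / T| ≤ D := fun l => abs_div_le_of_one_le (hGD' l) (by linarith)
  have b0 : ∀ j x, |G (jap ρ x / T) * bvec ρ j x| ≤ D * B + (D * B ^ 2 + D * B) := fun j x => by
    rw [abs_mul]
    have := mul_le_mul (hGD (jap ρ x / T)) (hb j x) (abs_nonneg _) hD
    have : 0 ≤ D * B ^ 2 + D * B := by positivity
    linarith
  have b1 : ∀ j x, |partialDeriv j (fun x => G (jap ρ x / T) * bvec ρ j x) x|
      ≤ D * B + (D * B ^ 2 + D * B) := fun j x => by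
    rw [hpg]
    refine (abs_add_le _ _).trans ?_
    rw [abs_mul, abs_mul, abs_pow]
    have e1 := mul_le_mul (hdT (jap ρ x / T)) (pow_le_pow_left₀ (abs_nonneg _) (hb j x) 2)
      (by positivity) hD
    have e2 := mul_le_mul (hGD (jap ρ x / T)) (hbb j j x) (abs_nonneg _) hD
    have : 0 ≤ D * B := by positivity
    linarith
  have hcs : ∀ j, ContDiff ℝ ∞ (fun x => G (jap ρ x / T) * bvec ρ j x) := fun j =>
    hg.mul (contDiff_bvec hρ j)
  -- Twice the real part of `ū ∂ⱼu` is the derivative of `|u|²`, so the gradient passes to the real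
  -- coefficient.
  have key : ∀ j, 2 * (ip u (fun x => ((G (jap ρ x / T) * bvec ρ j x : ℝ) : ℂ) * w j x)).re
      = -(ip u (fun x => ((partialDeriv j (fun x => G (jap ρ x / T) * bvec ρ j x) x : ℝ) : ℂ)
        * u x)).re := by
    intro j
    have e := congrArg Complex.re (ip_mul_gradient hρ hu hw h j (hcs j) (b0 j) (b1 j))
    have e2 : ip (w j) (fun x => ((G (jap ρ x / T) * bvec ρ j x : ℝ) : ℂ) * u x)
        = (starRingEnd ℂ) (ip u (fun x => ((G (jap ρ x / T) * bvec ρ j x : ℝ) : ℂ) * w j x)) := by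
      rw [ip_conj, ip_real_mul (fun x => G (jap ρ x / T) * bvec ρ j x)]
    rw [e2] at e
    simp only [Complex.add_re, Complex.conj_re, Complex.neg_re] at e
    linarith
  have lw : ∀ j, L2 (fun x => ((G (jap ρ x / T) * bvec ρ j x : ℝ) : ℂ) * w j x) := fun j =>
    (hw j).real_mul_of_bound (hcs j).continuous.measurable (b0 j)
  have lu : ∀ j, L2 (fun x => ((partialDeriv j (fun x => G (jap ρ x / T) * bvec ρ j x) x : ℝ) : ℂ)
      * u x) := fun j =>
    hu.real_mul_of_bound (contDiff_partialDeriv (hcs j) j).continuous.measurable (b1 j)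
  have lc : L2 (fun x => ((G (jap ρ x / T) * cfun ρ x : ℝ) : ℂ) * u x) := by
    refine hu.real_mul_of_bound (C := D * B)
      (hg.continuous.measurable.mul (contDiff_cfun hρ).continuous.measurable) fun x => ?_
    rw [abs_mul]; exact mul_le_mul (hGD _) (hcf x) (abs_nonneg _) hD
  have s1 : ip u (fun x => (G (jap ρ x / T) : ℂ) * qfun ρ u w x)
      = ∑ j, ip u (fun x => ((G (jap ρ x / T) * bvec ρ j x : ℝ) : ℂ) * w j x)
        + ip u (fun x => ((G (jap ρ x / T) * cfun ρ x : ℝ) : ℂ) * u x) := by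
    rw [← ip_sum_right _ lw hu, ← ip_add_right (L2.sum _ lw) lc hu]
    congr 1; ext x
    simp only [qfun, Fin.sum_univ_three]
    push_cast; ring
  have lG : L2 (fun x => ((deriv G (jap ρ x / T) / T : ℝ) : ℂ) * u x) :=
    hu.real_mul_of_bound ((measurable_comp_jap hρ
      (hG.continuous_deriv (by simp)) T).div_const T) fun x => hdT _
  have s2 : ∑ j, ip u (fun x =>
        ((partialDeriv j (fun x => G (jap ρ x / T) * bvec ρ j x) x : ℝ) : ℂ) * u x)
      = ip u (fun x => ((deriv G (jap ρ x / T) / T : ℝ) : ℂ) * u x)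
        + 2 * ip u (fun x => ((G (jap ρ x / T) * cfun ρ x : ℝ) : ℂ) * u x) := by
    have h2 : ip u (fun x => 2 * (((G (jap ρ x / T) * cfun ρ x : ℝ) : ℂ) * u x))
        = 2 * ip u (fun x => ((G (jap ρ x / T) * cfun ρ x : ℝ) : ℂ) * u x) := by
      rw [ip_smul_right, map_ofNat]
    rw [← h2, ← ip_sum_right _ lu hu, ← ip_add_right lG (lc.smul 2) hu]
    congr 1; ext x
    have e := congrArg (fun r : ℝ => (r : ℂ)) (mul_sum_bvec_sq hρ hT hG0' x)
    simp only [hpg, cfun, Fin.sum_univ_three] at e ⊢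
    push_cast at e ⊢
    linear_combination u x / T * e
  have s2' := congrArg Complex.re s2
  have s1' := congrArg Complex.re s1
  rw [Complex.re_sum] at s2'
  simp only [Complex.add_re, Complex.re_sum] at s1' s2'
  have hmul2 : (2 * ip u (fun x => ((G (jap ρ x / T) * cfun ρ x : ℝ) : ℂ) * u x)).re
      = 2 * (ip u (fun x => ((G (jap ρ x / T) * cfun ρ x : ℝ) : ℂ) * u x)).re := by simp
  have skey := Finset.sum_congr (rfl : (Finset.univ : Finset (Fin 3)) = Finset.univ)
    (fun j _ => key j)
  rw [← Finset.mul_sum, Finset.sum_neg_distrib] at skey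
  -- The divergence of `G ∇⟨x⟩` contains `2 G cfun`, which cancels the zeroth-order part of `q`.
  -- Only `G'/T` remains, and this is the gain of one power of `T`.
  have : 2 * (ip u (fun x => (G (jap ρ x / T) : ℂ) * qfun ρ u w x)).re
      = -(ip u (fun x => ((deriv G (jap ρ x / T) / T : ℝ) : ℂ) * u x)).re := by
    rw [s1']; linarith
  rw [this, abs_neg]
  refine (Complex.abs_re_le_norm _).trans ((norm_ip_le hu lG).trans ?_)
  have := nn_bdd_mul_le (a := fun x => ((deriv G (jap ρ x / T) / T : ℝ) : ℂ)) (C := D * T⁻¹) hu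
    fun x => by
      rw [Complex.norm_real, div_eq_mul_inv, norm_mul, Real.norm_of_nonneg (inv_pos.2 hT0).le]
      exact mul_le_mul_of_nonneg_right (hGD' _) (inv_pos.2 hT0).le
  calc nn u * _ ≤ nn u * (D * T⁻¹ * nn u) := mul_le_mul_of_nonneg_left this (nn_nonneg _)
    _ = _ := by ring

section
variable {F : ℝ → ℝ} {ρ : ℝ → ℝ} {α : ℝ}

/-- The density `(F F')(⟨x⟩/T) |q|²` of the propagation observable. -/
def dens (ρ : ℝ → ℝ) (F : ℝ → ℝ) (T : ℝ) (u : E3 → ℂ) (w : Fin 3 → E3 → ℂ) (x : E3) : ℝ :=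
  deriv F (jap ρ x / T) * F (jap ρ x / T) * ‖qfun ρ u w x‖ ^ 2

lemma integrable_dens (hρ : IsBump ρ) (hF : IsSmoothChar F) (T : ℝ) {u : E3 → ℂ}
    {w : Fin 3 → E3 → ℂ} (hu : L2 u) (hw : ∀ j, L2 (w j)) : Integrable (dens ρ F T u w) := by
  obtain ⟨D, hD, h1, -⟩ := hF.exists_bounds
  have hq := L2_qfun hρ hu hw
  refine (integrable_norm_sq hq).bdd_mul (c := D)
    ((measurable_comp_jap hρ hF.contDiff_deriv.continuous T).mul
      (measurable_comp_jap hρ hF.smooth.continuous T)).aestronglyMeasurable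
    (Eventually.of_forall fun x => ?_)
  exact abs_mul_le_of_le_one (h1 _) (hF.abs_le _)

/-- Integrates `pointwise_flux`. The cross term carries a prefactor `T⁻²`, and `abs_cross_term_le`
supplies the missing `T⁻¹`. The constant depends on `F` alone, not on the time or the state. -/
lemma flux_ge (hρ : IsBump ρ) (hF : IsSmoothChar F) (hα0 : 0 ≤ α) (hα1 : α ≤ 1) :
    ∃ K, 0 ≤ K ∧ ∀ (t : ℝ) (u : E3 → ℂ) (w : Fin 3 → E3 → ℂ), 1 ≤ t → 8 ≤ t ^ α → L2 u →
      (∀ j, L2 (w j)) → (∀ j, HasWeakPartial j u (w j)) →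
      3 * ((t ^ α)⁻¹ * ∫ x, dens ρ F (t ^ α) u w x)
        - K * ((t ^ α)⁻¹ ^ 3 + t ^ α / t ^ 2) * nn u ^ 2 ≤ flux ρ α F t u w := by
  obtain ⟨D, hD, h1, h2, -⟩ := hF.exists_bounds
  have hF1 := hF.contDiff_deriv
  have hF2 := hF.contDiff_deriv2
  -- The coefficient of the cross term: `2 F'²` from pairing `2F' q` with `F' u`, and `F'' F` from
  -- pairing `F'' u` with `F q`.
  set G : ℝ → ℝ := fun l => 2 * deriv F l ^ 2 + deriv (deriv F) l * F l with hG
  have hGs : ContDiff ℝ ∞ G := (contDiff_const.mul (hF1.pow 2)).add (hF2.mul hF.smooth)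
  have hG0 : ∀ s, s < 1 / 2 ∨ 1 < s → G s = 0 := fun s hs => by
    simp only [hG, hF.deriv_eq_zero hs, deriv_eq_zero_of_eq_zero (fun _ => hF.deriv_eq_zero) hs]
    ring
  obtain ⟨D1, hD1, k1⟩ := exists_bound_of_eq_zero hGs.continuous hG0
  obtain ⟨D2, hD2, k2⟩ := exists_bound_of_eq_zero (hGs.continuous_deriv (by simp))
    (fun s hs => deriv_eq_zero_of_eq_zero hG0 hs)
  refine ⟨(2 * D ^ 2 + D) + (D1 + D2), by positivity, fun t u w ht hT hu hw hweak => ?_⟩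
  set T := t ^ α with hTd
  have hT0 : 0 < T := by linarith
  have ht0 : 0 < t := by linarith
  have hq := L2_qfun hρ hu hw
  have hcross := abs_cross_term_le hρ hu hw hweak hGs (D := D1 + D2)
    (fun l => (k1 l).trans (by linarith)) (fun l => (k2 l).trans (by linarith))
    (fun l hl => hG0 l (Or.inl hl)) hT
  have lZ := (L2_gcut hρ hF (by linarith : (1 : ℝ) ≤ T) hu hw).smul (-Complex.I)
  have m1 := measurable_comp_jap hρ hF1.continuous T
  have m2 := measurable_comp_jap hρ hF2.continuous T
  have hj : Measurable (fun x => jap ρ x / T) := measurable_comp_jap hρ continuous_id T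
  have lP : L2 (fun x => 2 * ((deriv F (jap ρ x / T) / T : ℝ) : ℂ) * qfun ρ u w x
        + ((deriv (deriv F) (jap ρ x / T) / T / T : ℝ) : ℂ) * u x) := by
    have e1 := (hq.real_mul_of_bound (m1.div_const T)
      fun x => abs_div_le_of_one_le (h1 _) (by linarith)).smul 2
    have e2 := hu.real_mul_of_bound ((m2.div_const T).div_const T)
      fun x => abs_div_le_of_one_le (abs_div_le_of_one_le (h2 _) (by linarith)) (by linarith)
    simpa only [mul_assoc] using e1.add e2
  have hατ : α / t ≤ 1 := by rw [div_le_one ht0]; linarith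
  have lR : L2 (fun x => ((-(α / t) * (jap ρ x / T * deriv F (jap ρ x / T)) : ℝ) : ℂ) * u x) := by
    refine hu.real_mul_of_bound (C := D) ((hj.mul m1).const_mul _) fun x => ?_
    rw [mul_comm]
    refine abs_mul_le_of_le_one (hF.abs_mul_deriv_le hD h1 _) ?_
    rw [abs_neg, abs_of_nonneg (by positivity)]; exact hατ
  have i1 := ip_integrable lP lZ
  have i2 := ip_integrable lR lZ
  have i3 := (i1.const_mul (-Complex.I)).add i2
  have hflux : flux ρ α F t u w = ∫ x, 2 * (-Complex.I *
      ((2 * ((deriv F (jap ρ x / T) / T : ℝ) : ℂ) * qfun ρ u w x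
        + ((deriv (deriv F) (jap ρ x / T) / T / T : ℝ) : ℂ) * u x)
        * (starRingEnd ℂ) (-Complex.I * gcut ρ F T u w x))
      + (((-(α / t) * (jap ρ x / T * deriv F (jap ρ x / T)) : ℝ) : ℂ) * u x)
        * (starRingEnd ℂ) (-Complex.I * gcut ρ F T u w x)).re := by
    rw [flux, ip, ip, ← integral_const_mul, ← integral_add (i1.const_mul _) i2, integral_const_mul]
    congr 1
    exact (Complex.reCLM.integral_comp_comm i3).symm
  have hGm : L2 (fun x => (G (jap ρ x / T) : ℂ) * qfun ρ u w x) :=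
    hq.real_mul_of_bound (measurable_comp_jap hρ hGs.continuous T) fun x => k1 _
  have i4 := ip_integrable hu hGm
  have i5 : Integrable (fun x => (u x * (starRingEnd ℂ)
      ((G (jap ρ x / T) : ℂ) * qfun ρ u w x)).re) := i4.re
  have i6 := integrable_dens hρ hF T hu hw
  have i7 := integrable_norm_sq hu
  set L : E3 → ℝ := fun x => 3 * (T⁻¹ * dens ρ F T u w x) + 2 * (T⁻¹ ^ 2 * (u x * (starRingEnd ℂ)
      ((G (jap ρ x / T) : ℂ) * qfun ρ u w x)).re)
      - (2 * D ^ 2 + D) * (T⁻¹ ^ 3 + T / t ^ 2) * ‖u x‖ ^ 2 with hL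
  have j1 : Integrable (fun x => 3 * (T⁻¹ * dens ρ F T u w x)) := (i6.const_mul _).const_mul _
  have j2 : Integrable (fun x => 2 * (T⁻¹ ^ 2 * (u x * (starRingEnd ℂ)
      ((G (jap ρ x / T) : ℂ) * qfun ρ u w x)).re)) := (i5.const_mul _).const_mul _
  have j12 : Integrable (fun x => 3 * (T⁻¹ * dens ρ F T u w x) + 2 * (T⁻¹ ^ 2 * (u x *
      (starRingEnd ℂ) ((G (jap ρ x / T) : ℂ) * qfun ρ u w x)).re)) := j1.add j2
  have j3 : Integrable (fun x => (2 * D ^ 2 + D) * (T⁻¹ ^ 3 + T / t ^ 2) * ‖u x‖ ^ 2) :=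
    i7.const_mul _
  have hlow : ∫ x, L x
      = 3 * (T⁻¹ * ∫ x, dens ρ F T u w x)
        + 2 * (T⁻¹ ^ 2 * (ip u (fun x => (G (jap ρ x / T) : ℂ) * qfun ρ u w x)).re)
        - (2 * D ^ 2 + D) * (T⁻¹ ^ 3 + T / t ^ 2) * nn u ^ 2 := by
    rw [hL, integral_sub j12 j3, integral_add j1 j2]
    simp only [integral_const_mul]
    rw [nn_sq hu]
    congr 4
    exact Complex.reCLM.integral_comp_comm i4
  have hmono : ∫ x, L x ≤ flux ρ α F t u w := by
    rw [hflux]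
    refine integral_mono (j12.sub j3) (i3.re.const_mul 2) fun x => ?_
    refine pointwise_flux (hF.nonneg _) (hF.le_one _) (hF.deriv_nonneg _)
      ((le_abs_self _).trans (h1 _)) ?_ (h2 _) (by positivity) ?_ ht0 hT0
    · by_cases hl : jap ρ x / T < 1 / 2 ∨ 1 < jap ρ x / T
      · rw [hF.deriv_eq_zero hl, mul_zero]; exact hD
      · push Not at hl
        have := hF.deriv_nonneg (jap ρ x / T)
        refine (mul_le_of_le_one_left this ?_).trans ((le_abs_self _).trans (h1 _))
        exact pow_le_one₀ (by linarith) hl.2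
    · rw [div_mul_cancel₀ _ ht0.ne']; exact hα1
  rw [hlow] at hmono
  refine le_trans ?_ hmono
  have hcr := (abs_le.1 hcross).1
  have hi : 0 < T⁻¹ := inv_pos.2 hT0
  have := mul_le_mul_of_nonneg_left hcr (sq_nonneg T⁻¹)
  have hp : 0 ≤ (D1 + D2) * (T / t ^ 2) * nn u ^ 2 := by positivity
  linarith

end

/-! ### The propagation form and the expectation of the observable -/

/-- The derivative of a nonnegative function is controlled by its square root. -/
lemma sq_deriv_le {g : ℝ → ℝ} (hg : ContDiff ℝ ∞ g) (h0 : ∀ l, 0 ≤ g l) {C : ℝ} (hC : 0 < C)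
    (h2 : ∀ l, |deriv (deriv g) l| ≤ C) (x : ℝ) : deriv g x ^ 2 ≤ 4 * C * g x := by
  have hg1 := (contDiff_infty_iff_deriv.1 hg).2
  have hd : Differentiable ℝ g := hg.differentiable (by simp)
  have hd1 : Differentiable ℝ (deriv g) := hg1.differentiable (by simp)
  have hlip : ∀ y, |deriv g y - deriv g x| ≤ C * |y - x| := fun y =>
    convex_univ.norm_image_sub_le_of_norm_deriv_le (fun z _ => hd1 z) (fun z _ => h2 z)
      (mem_univ x) (mem_univ y)
  -- The mean value inequality for `g` minus its tangent line yields the coefficient `C` where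
  -- Taylor's formula would give `C/2`, hence the final constant `4C`.
  have key : ∀ h : ℝ, 0 ≤ g x + deriv g x * h + C * h ^ 2 := by
    intro h
    have hF : ∀ y, HasDerivAt (fun y => g y - deriv g x * y) (deriv g y - deriv g x) y := fun y => by
      have := (hd y).hasDerivAt.sub ((hasDerivAt_id y).const_mul (deriv g x))
      rwa [mul_one] at this
    have := (convex_uIcc x (x + h)).norm_image_sub_le_of_norm_hasDerivWithin_le
      (f := fun y => g y - deriv g x * y) (C := C * |h|) (fun y _ => (hF y).hasDerivWithinAt)
      (fun y hy => (hlip y).trans (mul_le_mul_of_nonneg_left ?_ hC.le)) left_mem_uIcc right_mem_uIcc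
    · simp only [Real.norm_eq_abs, add_sub_cancel_left] at this
      rw [mul_assoc, abs_mul_abs_self, ← pow_two] at this
      have h3 := (abs_le.1 this).2
      have h4 := h0 (x + h)
      linarith
    · have := abs_sub_left_of_mem_uIcc hy
      rwa [add_sub_cancel_left] at this
  -- The quadratic in `h` is evaluated at its minimum.
  have := key (-(deriv g x) / (2 * C))
  have e : g x + deriv g x * (-(deriv g x) / (2 * C)) + C * (-(deriv g x) / (2 * C)) ^ 2
      = g x - deriv g x ^ 2 / (4 * C) := by field_simp; ring
  rw [e, sub_nonneg, div_le_iff₀ (by positivity)] at this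
  linarith

/-- Square roots of smooth nonnegative functions of `⟨x⟩` are multipliers on `H¹`. -/
lemma isMultiplier_sqrt {ρ : ℝ → ℝ} (hρ : IsBump ρ) {g : ℝ → ℝ} (hg : ContDiff ℝ ∞ g)
    (h0 : ∀ l, 0 ≤ g l) {C : ℝ} (hC : 0 < C) (hgC : ∀ l, g l ≤ C)
    (h2 : ∀ l, |deriv (deriv g) l| ≤ C) {T : ℝ} (hT : 1 ≤ T) :
    IsMultiplier (fun x => √(g (jap ρ x / T)))
      (fun j x => deriv g (jap ρ x / T) / (2 * √(g (jap ρ x / T))) / T * bvec ρ j x) := by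
  obtain ⟨B, hB, hb, -⟩ := exists_coeff_bound hρ
  have hd1 : ∀ l, |deriv g l| ≤ 2 * √C * √(g l) := fun l => by
    rw [← Real.sqrt_sq (abs_nonneg (deriv g l)), sq_abs]
    refine (Real.sqrt_le_sqrt (sq_deriv_le hg h0 hC h2 l)).trans (le_of_eq ?_)
    rw [Real.sqrt_mul (by positivity), Real.sqrt_mul (by norm_num),
      show (4 : ℝ) = 2 ^ 2 by norm_num, Real.sqrt_sq (by norm_num)]
  set ε : ℕ → ℝ := fun n => 1 / ((n : ℝ) + 1) with hε
  have hε0 : ∀ n, 0 < ε n := fun n => by positivity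
  have hε1 : ∀ n, ε n ≤ 1 := fun n => by
    rw [hε, div_le_one (by positivity)]; linarith [(Nat.cast_nonneg n : (0 : ℝ) ≤ n)]
  have hεt : Tendsto ε atTop (𝓝 0) := tendsto_one_div_add_atTop_nhds_zero_nat
  have hpos : ∀ n l, 0 < g l + ε n ^ 2 := fun n l => add_pos_of_nonneg_of_pos (h0 l)
    (pow_pos (hε0 n) 2)
  -- `√g` need not be smooth at the zeros of `g`. Adding `ε²` under the root regularises it, and
  -- `sq_deriv_le` bounds the derivatives uniformly in `ε`.
  set S : ℕ → ℝ → ℝ := fun n l => √(g l + ε n ^ 2) - ε n with hS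
  have hSs : ∀ n, ContDiff ℝ ∞ (S n) := fun n =>
    ((hg.add contDiff_const).sqrt fun l => (hpos n l).ne').sub contDiff_const
  have hSd : ∀ n l, deriv (S n) l = deriv g l / (2 * √(g l + ε n ^ 2)) := fun n l =>
    ((((hg.differentiable (by simp) l).hasDerivAt.add_const _).sqrt (hpos n l).ne').sub_const _).deriv
  have hsmall : ∀ n l, √(g l) ≤ √(g l + ε n ^ 2) := fun n l =>
    Real.sqrt_le_sqrt (by linarith [sq_nonneg (ε n)])
  have hSdb : ∀ n l, |deriv (S n) l| ≤ √C := fun n l => by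
    rw [hSd, abs_div, abs_of_nonneg (by positivity : 0 ≤ 2 * √(g l + ε n ^ 2)),
      div_le_iff₀ (mul_pos two_pos (Real.sqrt_pos.2 (hpos n l)))]
    refine (hd1 l).trans ?_
    have := mul_le_mul_of_nonneg_left (hsmall n l) (Real.sqrt_nonneg C)
    linarith
  have hpart : ∀ n j x, partialDeriv j (fun x => S n (jap ρ x / T)) x
      = deriv (S n) (jap ρ x / T) / T * bvec ρ j x := fun n j x => by
    have := partialDeriv_comp_jap hρ (((hSs n).comp (contDiff_id.div_const T)).differentiable
      (by simp)) j x
    simp only [Function.comp_def, id] at this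
    rwa [(hasDerivAt_div_comp (hSs n) T (jap ρ x)).deriv] at this
  refine ⟨fun n x => S n (jap ρ x / T), √(C + 1) + √C * B, fun n =>
    ((hSs n).comp (contDiff_id.div_const T)).comp (contDiff_jap hρ), fun n x => ?_,
    fun n j x => ?_, fun x => ?_, fun j x => ?_⟩
  · have e1 : ε n ≤ √(g (jap ρ x / T) + ε n ^ 2) := by
      refine Real.le_sqrt_of_sq_le ?_; linarith [h0 (jap ρ x / T)]
    have e2 : √(g (jap ρ x / T) + ε n ^ 2) ≤ √(C + 1) :=
      Real.sqrt_le_sqrt (add_le_add (hgC _) (pow_le_one₀ (hε0 n).le (hε1 n)))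
    have e3 : 0 ≤ √C * B := by positivity
    rw [abs_of_nonneg (by simp only [hS]; linarith)]
    simp only [hS]
    linarith [hε0 n]
  · rw [hpart, abs_mul]
    have := mul_le_mul (abs_div_le_of_one_le (hSdb n (jap ρ x / T)) hT) (hb j x) (abs_nonneg _)
      (Real.sqrt_nonneg C)
    linarith [Real.sqrt_nonneg (C + 1)]
  · have hc : Continuous (fun e : ℝ => √(g (jap ρ x / T) + e ^ 2) - e) := by fun_prop
    have := (hc.tendsto 0).comp hεt
    rw [zero_pow two_ne_zero, add_zero, sub_zero] at this
    exact this
  · simp only [hpart, hSd]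
    refine Tendsto.mul_const _ (Tendsto.div_const ?_ T)
    -- At a zero of `g` the derivative of `g` vanishes too, so all approximate gradients are zero,
    -- in agreement with the convention `0 / 0 = 0` in the limit.
    rcases (h0 (jap ρ x / T)).eq_or_lt with h | h
    · have hz : deriv g (jap ρ x / T) = 0 := by
        have := hd1 (jap ρ x / T)
        rw [← h, Real.sqrt_zero, mul_zero] at this
        exact abs_eq_zero.1 (le_antisymm this (abs_nonneg _))
      simp [hz]
    · have hc : Tendsto (fun e : ℝ => 2 * √(g (jap ρ x / T) + e ^ 2)) (𝓝 0)
          (𝓝 (2 * √(g (jap ρ x / T) + 0 ^ 2))) :=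
        Continuous.tendsto (by fun_prop : Continuous fun e : ℝ => 2 * √(g (jap ρ x / T) + e ^ 2)) 0
      have := (hc.comp hεt)
      rw [zero_pow two_ne_zero, add_zero] at this
      exact tendsto_const_nhds.div this (by positivity)

section
variable {F : ℝ → ℝ} {ρ : ℝ → ℝ} {α : ℝ}

/-- `γ (√g u)` is `-i (√g q + (√g)' |∇⟨x⟩|² u / T)` with `g = F F'`. The square of the first term is
the density, and the second is `O(1/T)` because `√g` has a bounded derivative. -/
lemma propagationForm_le (hρ : IsBump ρ) (hF : IsSmoothChar F) :
    ∃ K, 0 ≤ K ∧ ∀ (t : ℝ) (u : E3 → ℂ) (w : Fin 3 → E3 → ℂ), 1 ≤ t ^ α → L2 u →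
      (∀ j, L2 (w j)) → (∀ j, HasWeakPartial j u (w j)) →
      propagationForm ρ α F t u
        ≤ ENNReal.ofReal (2 * (∫ x, dens ρ F (t ^ α) u w x) + K * (t ^ α)⁻¹ ^ 2 * nn u ^ 2) := by
  obtain ⟨B, hB, hb, -⟩ := exists_coeff_bound hρ
  set g : ℝ → ℝ := fun l => F l * deriv F l with hg
  have hgs : ContDiff ℝ ∞ g := hF.smooth.mul hF.contDiff_deriv
  have hg0 : ∀ l, 0 ≤ g l := fun l => mul_nonneg (hF.nonneg l) (hF.deriv_nonneg l)
  have hgz : ∀ s, s < 1 / 2 ∨ 1 < s → g s = 0 := fun s hs => by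
    simp only [hg, hF.deriv_eq_zero hs, mul_zero]
  have hg1 := (contDiff_infty_iff_deriv.1 hgs).2
  obtain ⟨D0, hD0, k0⟩ := exists_bound_of_eq_zero hgs.continuous hgz
  obtain ⟨D2, hD2, k2⟩ := exists_bound_of_eq_zero (hg1.continuous_deriv (by simp))
    (fun s hs => deriv_eq_zero_of_eq_zero (fun s hs => deriv_eq_zero_of_eq_zero hgz hs) hs)
  set C := D0 + D2 + 1 with hC
  have hC0 : 0 < C := by positivity
  have hd1 : ∀ l, |deriv g l / (2 * √(g l))| ≤ √C := fun l => by
    -- Where `g` vanishes, the quotient is `0` by the convention on division by zero.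
    rcases (hg0 l).eq_or_lt with h | h
    · rw [← h]; simp
    · have := sq_deriv_le hgs hg0 hC0 (fun l => (k2 l).trans (by linarith)) l
      rw [abs_div, abs_of_nonneg (by positivity : 0 ≤ 2 * √(g l)), div_le_iff₀ (by positivity)]
      refine abs_le_of_sq_le_sq ?_ (by positivity)
      rw [mul_pow, mul_pow, Real.sq_sqrt hC0.le, Real.sq_sqrt h.le]
      linarith
  refine ⟨2 * (3 * B ^ 2 * √C) ^ 2, by positivity, fun t u w hT hu hw hweak => ?_⟩
  set T := t ^ α with hTd
  have hT0 : 0 < T := by linarith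
  have hm := isMultiplier_sqrt hρ hgs hg0 hC0 (fun l => (le_abs_self _).trans ((k0 l).trans
    (by linarith))) (fun l => (k2 l).trans (by linarith)) hT
  have hae := gammaOp_mul hρ hweak hm
  have i1 := integrable_dens hρ hF T hu hw
  have i2 := integrable_norm_sq hu
  have hint : 2 * (∫ x, dens ρ F T u w x) + 2 * (3 * B ^ 2 * √C) ^ 2 * T⁻¹ ^ 2 * nn u ^ 2
      = ∫ x, (2 * dens ρ F T u w x + 2 * (3 * B ^ 2 * √C) ^ 2 * T⁻¹ ^ 2 * ‖u x‖ ^ 2) := by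
    rw [integral_add (i1.const_mul _) (i2.const_mul _), integral_const_mul, integral_const_mul,
      nn_sq hu]
  have hd0 : ∀ x, 0 ≤ dens ρ F T u w x := fun x =>
    mul_nonneg (mul_nonneg (hF.deriv_nonneg _) (hF.nonneg _)) (sq_nonneg _)
  have i3 : Integrable (fun x => 2 * dens ρ F T u w x
      + 2 * (3 * B ^ 2 * √C) ^ 2 * T⁻¹ ^ 2 * ‖u x‖ ^ 2) := (i1.const_mul _).add (i2.const_mul _)
  rw [hint, ofReal_integral_eq_lintegral_ofReal i3
    (Eventually.of_forall fun x => add_nonneg (mul_nonneg two_pos.le (hd0 x)) (by positivity))]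
  refine lintegral_mono_ae ?_
  filter_upwards [hae] with x hx
  change gammaOp ρ (cutoff ρ α (sqrtFF' F) t u) x = _ at hx
  rw [hx, ← ofReal_norm, ← ENNReal.ofReal_pow (norm_nonneg _)]
  refine ENNReal.ofReal_le_ofReal ?_
  rw [norm_mul, norm_neg, Complex.norm_I, one_mul]
  refine (pow_le_pow_left₀ (norm_nonneg _) (norm_add_le _ _) 2).trans ?_
  refine (add_sq_le).trans ?_
  rw [mul_add]
  refine add_le_add (le_of_eq ?_) ?_
  · rw [norm_mul, Complex.norm_real, mul_pow, Real.norm_of_nonneg (Real.sqrt_nonneg _),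
      Real.sq_sqrt (hg0 _), dens, hg]
    ring
  · rw [norm_mul, Complex.norm_real, mul_pow, mul_assoc, mul_assoc, ← mul_assoc (_ ^ 2 : ℝ)]
    refine mul_le_mul_of_nonneg_left (mul_le_mul_of_nonneg_right ?_ (sq_nonneg _)) two_pos.le
    rw [← mul_pow]
    refine pow_le_pow_left₀ (norm_nonneg _) ?_ 2
    have e : (∑ j, bvec ρ j x * (deriv g (jap ρ x / T) / (2 * √(g (jap ρ x / T))) / T * bvec ρ j x))
        = (deriv g (jap ρ x / T) / (2 * √(g (jap ρ x / T)))) * ∑ j, bvec ρ j x ^ 2 * T⁻¹ := by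
      rw [Finset.mul_sum]
      exact Finset.sum_congr rfl fun j _ => by ring
    rw [e, ← Finset.sum_mul, norm_mul, norm_mul, Real.norm_of_nonneg (inv_pos.2 hT0).le]
    have s : ‖∑ j, bvec ρ j x ^ 2‖ ≤ 3 * B ^ 2 := by
      refine (norm_sum_le _ _).trans ?_
      rw [Fin.sum_univ_three]
      have : ∀ j, ‖bvec ρ j x ^ 2‖ ≤ B ^ 2 := fun j => by
        rw [norm_pow]; exact pow_le_pow_left₀ (norm_nonneg _) (hb j x) 2
      linarith [this 0, this 1, this 2]
    calc _ ≤ √C * (3 * B ^ 2 * T⁻¹) := by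
            have h1 := hd1 (jap ρ x / T)
            rw [← Real.norm_eq_abs] at h1
            gcongr
      _ = _ := by ring

/-- The expectation of the observable in terms of the weak gradient. -/
lemma expectation_eq_obs (hρ : IsBump ρ) (hF : IsSmoothChar F) {t : ℝ} (hT : 8 ≤ t ^ α)
    {u : E3 → ℂ} {w : Fin 3 → E3 → ℂ} (hweak : ∀ j, HasWeakPartial j u (w j)) :
    expectation (observable ρ α F t) u = obs ρ F (t ^ α) u w := by
  obtain ⟨B, hB, hb, -⟩ := exists_coeff_bound hρ
  obtain ⟨D, hD, h1, -⟩ := hF.exists_bounds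
  have hs : ContDiff ℝ ∞ (fun r => F (r / t ^ α)) := hF.smooth.comp (contDiff_id.div_const _)
  have hp : ∀ j x, partialDeriv j (fun x => F (jap ρ x / t ^ α)) x
      = deriv F (jap ρ x / t ^ α) / t ^ α * bvec ρ j x := fun j x => by
    have := partialDeriv_comp_jap hρ (hs.differentiable (by simp)) j x
    rwa [(hasDerivAt_div_comp hF.smooth (t ^ α) (jap ρ x)).deriv] at this
  have hm : IsMultiplier (fun x => F (jap ρ x / t ^ α)) _ :=
    IsMultiplier.of_contDiff (C := 1 + D * B) (hs.comp (contDiff_jap hρ))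
      (fun x => (hF.abs_le _).trans (by linarith [mul_nonneg hD hB])) fun j x => by
        rw [hp, abs_mul]
        have := mul_le_mul (abs_div_le_of_one_le (h1 (jap ρ x / t ^ α))
          (by linarith : 1 ≤ t ^ α)) (hb j x) (abs_nonneg _) hD
        linarith
  have hae := gammaOp_mul hρ hweak hm
  have hae' : gammaOp ρ (cutoff ρ α F t u) =ᵐ[volume]
      fun x => -Complex.I * gcut ρ F (t ^ α) u w x := by
    filter_upwards [hae] with x hx
    change gammaOp ρ (cutoff ρ α F t u) x = _ at hx
    rw [hx, gcut]
    have e := mul_sum_bvec_sq hρ hT (fun l hl => (prof_eq_zero hF hl).2.1) x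
    have e2 : ∑ j, bvec ρ j x * partialDeriv j (fun x => F (jap ρ x / t ^ α)) x
        = deriv F (jap ρ x / t ^ α) / t ^ α := by
      rw [← e, mul_div_right_comm, Finset.mul_sum]
      exact Finset.sum_congr rfl fun j _ => by rw [hp]; ring
    rw [e2]
  rw [obs, ip_real_mul (fun x => F (jap ρ x / t ^ α))]
  refine integral_congr_ae ?_
  filter_upwards [hae'] with x hx
  rw [observable, cutoff, hx]

end

/-! ### Integrating the differential inequality -/

/-- Fatou's lemma for increments of Lipschitz functions. -/
lemma lintegral_le_of_liminf_deriv {m : ℕ → ℝ → ℝ} {a b H : ℝ} (hab : a ≤ b) {K : ℕ → NNReal}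
    (hL : ∀ n, LipschitzOnWith (K n) (m n) (Icc a b)) {ψ : ℝ → ℝ}
    (hψ : ∀ t ∈ Ioc a b, (∀ n, DifferentiableAt ℝ (m n) t) → (∀ n, 0 ≤ deriv (m n) t + H) ∧
      ENNReal.ofReal (ψ t + H) ≤ liminf (fun n => ENNReal.ofReal (deriv (m n) t + H)) atTop)
    {Ba Bb : ℝ} (ha : Tendsto (fun n => m n a) atTop (𝓝 Ba))
    (hb : Tendsto (fun n => m n b) atTop (𝓝 Bb)) :
    0 ≤ Bb - Ba + H * (b - a) ∧
      ∫⁻ t in Ioc a b, ENNReal.ofReal (ψ t + H) ≤ ENNReal.ofReal (Bb - Ba + H * (b - a)) := by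
  -- Absolute continuity gives both a derivative almost everywhere and the recovery of increments by
  -- integrating it.
  have hac : ∀ n, AbsolutelyContinuousOnInterval (m n) a b := fun n =>
    LipschitzOnWith.absolutelyContinuousOnInterval (K := K n) (by rw [uIcc_of_le hab]; exact hL n)
  have hdiff : ∀ᵐ t, t ∈ Ioc a b → ∀ n, DifferentiableAt ℝ (m n) t := by
    have := ae_all_iff.2 fun n => (hac n).ae_differentiableAt
    filter_upwards [this] with t ht hmem n
    exact ht n (by rw [uIcc_of_le hab]; exact Ioc_subset_Icc_self hmem)
  have hψ' : ∀ᵐ t ∂(volume.restrict (Ioc a b)), (∀ n, 0 ≤ deriv (m n) t + H) ∧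
      ENNReal.ofReal (ψ t + H) ≤ liminf (fun n => ENNReal.ofReal (deriv (m n) t + H)) atTop := by
    rw [ae_restrict_iff' measurableSet_Ioc]
    filter_upwards [hdiff] with t ht hmem using hψ t hmem (ht hmem)
  have hint : ∀ n, IntegrableOn (fun t => deriv (m n) t + H) (Ioc a b) := fun n =>
    ((intervalIntegrable_iff_integrableOn_Ioc_of_le hab).1
      ((hac n).intervalIntegrable_deriv.add intervalIntegrable_const))
  have hval : ∀ n, ∫ t in Ioc a b, (deriv (m n) t + H) = m n b - m n a + H * (b - a) := fun n => by
    rw [← intervalIntegral.integral_of_le hab, intervalIntegral.integral_add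
      (hac n).intervalIntegrable_deriv intervalIntegrable_const, (hac n).integral_deriv_eq_sub]
    simp [mul_comm]
  have hlim : Tendsto (fun n => m n b - m n a + H * (b - a)) atTop (𝓝 (Bb - Ba + H * (b - a))) :=
    (hb.sub ha).add_const _
  refine ⟨ge_of_tendsto' hlim fun n => ?_, ?_⟩
  · rw [← hval n]
    refine integral_nonneg_of_ae ?_
    filter_upwards [hψ'] with t ht using ht.1 n
  -- The common lower bound `-H` makes the shifted derivatives nonnegative, as Fatou's lemma
  -- requires. Measurability is used only for those derivatives, not for `ψ`.
  · calc ∫⁻ t in Ioc a b, ENNReal.ofReal (ψ t + H)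
        ≤ ∫⁻ t in Ioc a b, liminf (fun n => ENNReal.ofReal (deriv (m n) t + H)) atTop := by
          refine lintegral_mono_ae ?_
          filter_upwards [hψ'] with t ht using ht.2
      _ ≤ liminf (fun n => ∫⁻ t in Ioc a b, ENNReal.ofReal (deriv (m n) t + H)) atTop :=
          lintegral_liminf_le fun n => ((measurable_deriv _).add_const H).ennreal_ofReal
      _ = liminf (fun n => ENNReal.ofReal (m n b - m n a + H * (b - a))) atTop := by
          refine congrArg (fun f => liminf f atTop) (funext fun n => ?_)
          rw [← hval n, ofReal_integral_eq_lintegral_ofReal (hint n)]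
          filter_upwards [hψ'] with t ht using ht.1 n
      _ = _ := ((ENNReal.continuous_ofReal.tendsto _).comp hlim).liminf_eq

/-- The integral of the error term. -/
lemma lintegral_rpow_error {K δ a b : ℝ} (hK : 0 ≤ K) (hδ : 0 < δ) (ha : 0 < a) (hab : a ≤ b) :
    ∫⁻ t in Ioc a b, ENNReal.ofReal (K * t ^ (-(1 + δ)))
      = ENNReal.ofReal (K / δ * a ^ (-δ) - K / δ * b ^ (-δ)) := by
  have h0 : (0 : ℝ) ∉ uIcc a b := by
    rw [uIcc_of_le hab]; exact fun h => absurd h.1 (not_le.2 ha)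
  have hi : IntervalIntegrable (fun t : ℝ => K * t ^ (-(1 + δ))) volume a b :=
    (intervalIntegral.intervalIntegrable_rpow (Or.inr h0)).const_mul K
  rw [← ofReal_integral_eq_lintegral_ofReal
    ((intervalIntegrable_iff_integrableOn_Ioc_of_le hab).1 hi), ← intervalIntegral.integral_of_le hab,
    intervalIntegral.integral_const_mul, integral_rpow (Or.inr ⟨by linarith, h0⟩)]
  · congr 1
    rw [show -(1 + δ) + 1 = -δ by ring]
    field_simp
    ring
  · filter_upwards [ae_restrict_mem measurableSet_Ioc] with t ht
    exact mul_nonneg hK (Real.rpow_nonneg (ha.trans ht.1).le _)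

/-- A nonnegative density dominated by the increments of a bounded function, up to an integrable
error. -/
lemma increment_of_lintegral {X : ℝ → ℝ} {B : ℝ → ℝ} {K δ H a b : ℝ} (hK : 0 ≤ K) (hδ : 0 < δ)
    (hH : 0 ≤ H) (ha : 0 < a) (hab : a ≤ b) (hX : ∀ t ∈ Ioc a b, 0 ≤ X t)
    (h : 0 ≤ B b - B a + H * (b - a) ∧
      ∫⁻ t in Ioc a b, ENNReal.ofReal ((X t - K * t ^ (-(1 + δ))) + H)
        ≤ ENNReal.ofReal (B b - B a + H * (b - a))) :
    B a - K / δ * a ^ (-δ) ≤ B b - K / δ * b ^ (-δ) ∧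
      ∫⁻ t in Ioc a b, ENNReal.ofReal (X t)
        ≤ ENNReal.ofReal ((B b - K / δ * b ^ (-δ)) - (B a - K / δ * a ^ (-δ))) := by
  obtain ⟨h1, h2⟩ := h
  have hE := lintegral_rpow_error hK hδ ha hab
  set E := K / δ * a ^ (-δ) - K / δ * b ^ (-δ) with hEd
  have hE0 : 0 ≤ E := by
    have := Real.rpow_le_rpow_of_nonpos ha hab (neg_nonpos.2 hδ.le)
    have := mul_le_mul_of_nonneg_left this (div_nonneg hK hδ.le)
    linarith
  have hHb : 0 ≤ H * (b - a) := mul_nonneg hH (sub_nonneg.2 hab)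
  have hme : Measurable fun t : ℝ => ENNReal.ofReal (K * t ^ (-(1 + δ))) := by fun_prop
  -- The shift `H` and the power error are added back on both sides. Additivity of the lower
  -- integral only uses that these two summands are measurable; the density `X` need not be.
  have key : (∫⁻ t in Ioc a b, ENNReal.ofReal (X t)) + ENNReal.ofReal (H * (b - a))
      ≤ ENNReal.ofReal (B b - B a + H * (b - a) + E) := by
    have e1 : ENNReal.ofReal (H * (b - a)) = ∫⁻ _ in Ioc a b, ENNReal.ofReal H := by
      rw [lintegral_const, Measure.restrict_apply_univ, Real.volume_Ioc, ENNReal.ofReal_mul hH]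
    rw [e1, ← lintegral_add_right _ measurable_const, ENNReal.ofReal_add h1 hE0, ← hE]
    refine le_trans ?_ (add_le_add h2 le_rfl)
    rw [← lintegral_add_right _ hme]
    refine setLIntegral_mono' measurableSet_Ioc fun t ht => ?_
    rw [← ENNReal.ofReal_add (hX t ht) hH]
    refine le_trans (ENNReal.ofReal_le_ofReal (le_of_eq ?_)) ENNReal.ofReal_add_le
    ring
  have hmono : 0 ≤ B b - B a + E := by
    have := (le_add_self).trans key
    rw [ENNReal.ofReal_le_ofReal_iff (by linarith)] at this
    linarith
  refine ⟨by linarith, ?_⟩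
  rw [show B b - B a + H * (b - a) + E = (B b - B a + E) + H * (b - a) by ring,
    ENNReal.ofReal_add hmono hHb, ENNReal.add_le_add_iff_right ENNReal.ofReal_ne_top] at key
  refine key.trans (ENNReal.ofReal_le_ofReal (le_of_eq ?_))
  rw [hEd]; ring

/-- Convergence and finiteness from the increment inequality. -/
lemma tendsto_and_lintegral_lt_top {X : ℝ → ℝ} {B : ℝ → ℝ} {K δ T R : ℝ} (hK : 0 ≤ K) (hδ : 0 < δ)
    (hT : 1 ≤ T) (hB : ∀ t, T ≤ t → |B t| ≤ R)
    (h : ∀ a b, T ≤ a → a ≤ b → B a - K / δ * a ^ (-δ) ≤ B b - K / δ * b ^ (-δ) ∧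
      ∫⁻ t in Ioc a b, ENNReal.ofReal (X t)
        ≤ ENNReal.ofReal ((B b - K / δ * b ^ (-δ)) - (B a - K / δ * a ^ (-δ)))) :
    (∃ L, Tendsto B atTop (𝓝 L)) ∧ ∫⁻ t in Ioi T, ENNReal.ofReal (X t) < ⊤ := by
  have hKδ : 0 ≤ K / δ := div_nonneg hK hδ.le
  have hpow : ∀ t, T ≤ t → 0 ≤ K / δ * t ^ (-δ) ∧ K / δ * t ^ (-δ) ≤ K / δ := fun t ht => by
    refine ⟨mul_nonneg hKδ (Real.rpow_nonneg (by linarith) _), mul_le_of_le_one_right hKδ ?_⟩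
    exact Real.rpow_le_one_of_one_le_of_nonpos (hT.trans ht) (neg_nonpos.2 hδ.le)
  constructor
  -- Freezing the function below `T` makes it monotone on the whole line. It is bounded above, so it
  -- converges, and the subtracted power tends to zero.
  · set Φ : ℝ → ℝ := fun t => B (max T t) - K / δ * (max T t) ^ (-δ) with hΦ
    have hmono : Monotone Φ := fun s t hst =>
      (h _ _ (le_max_left T s) (max_le_max le_rfl hst)).1
    have hbdd : BddAbove (range Φ) := ⟨R, by
      rintro _ ⟨t, rfl⟩
      have h1 := (hpow _ (le_max_left T t)).1
      have h2 := (abs_le.1 (hB _ (le_max_left T t))).2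
      simp only [hΦ]; linarith⟩
    have hlim := tendsto_atTop_ciSup hmono hbdd
    have hdec : Tendsto (fun t : ℝ => K / δ * t ^ (-δ)) atTop (𝓝 (K / δ * 0)) :=
      (tendsto_rpow_neg_atTop hδ).const_mul _
    refine ⟨_, (hlim.add hdec).congr' ?_⟩
    filter_upwards [eventually_ge_atTop T] with t ht
    simp only [hΦ, max_eq_right ht]; ring
  · have hU : Ioi T = ⋃ n : ℕ, Ioc T (T + n) := by
      ext t
      simp only [mem_Ioi, mem_iUnion, mem_Ioc]
      refine ⟨fun ht => ?_, fun ⟨n, hn⟩ => hn.1⟩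
      obtain ⟨n, hn⟩ := exists_nat_ge (t - T)
      exact ⟨n, ht, by linarith⟩
    have hdir : Directed (· ⊆ ·) fun n : ℕ => Ioc T (T + n) :=
      Monotone.directed_le fun m n hmn => Ioc_subset_Ioc_right (by
        have : (m : ℝ) ≤ n := by exact_mod_cast hmn
        linarith)
    rw [hU, setLIntegral_iUnion_of_directed _ hdir]
    refine lt_of_le_of_lt (iSup_le fun n => ?_) (ENNReal.ofReal_lt_top (r := 2 * R + 2 * (K / δ)))
    have hTn : T ≤ T + n := by linarith [(Nat.cast_nonneg n : (0 : ℝ) ≤ n)]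
    refine (h T (T + n) le_rfl hTn).2.trans (ENNReal.ofReal_le_ofReal ?_)
    have h1 := hpow _ hTn
    have h2 := hpow T le_rfl
    have h3 := abs_le.1 (hB _ hTn)
    have h4 := abs_le.1 (hB T le_rfl)
    linarith [h3.2, h4.1]

/-! ### The differential inequality for the regularised observables. -/

section
variable {F : ℝ → ℝ} {ρ : ℝ → ℝ} {α : ℝ} {N : ℝ → ℝ → ℝ → ℂ} {φ : ℝ → E3 → ℂ}
  {v : ℝ → Fin 3 → E3 → ℂ} {M T₀ C β₀ : ℝ}

lemma neg_norm_add_norm_le_re (z w : ℂ) : -(‖z‖ + ‖w‖) ≤ (-Complex.I * z + w).re := by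
  have h1 := (abs_le.1 ((Complex.abs_re_le_norm _).trans (norm_add_le (-Complex.I * z) w))).1
  rwa [norm_mul, norm_neg, Complex.norm_I, one_mul] at h1

/-- The differential inequality for the regularised observables, in the limit. -/
lemma exists_liminf_deriv_ge (hρ : IsBump ρ) (hF : IsSmoothChar F) (hα : α ∈ Ioo (1 / 3 : ℝ) 1)
    (hβ : 1 < β₀) (hT : ∀ t, T₀ ≤ t → 8 ≤ t ^ α)
    (hc : ∀ n, CutoffFamily ρ N φ T₀ C β₀ (cut ρ α F n) (cutTime ρ α F n))
    (h : SolutionCurve N φ v M) :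
    ∃ K δ H : ℝ, 0 ≤ K ∧ 0 < δ ∧ 0 ≤ H ∧ ∀ t, T₀ < t →
      (∀ n, DifferentiableAt ℝ (mreg ρ n (cut ρ α F n) φ) t) →
      (∀ n, 0 ≤ deriv (mreg ρ n (cut ρ α F n) φ) t + H) ∧
      ENNReal.ofReal ((3 * ((t ^ α)⁻¹ * ∫ x, dens ρ F (t ^ α) (φ t) (v t) x)
          - K * t ^ (-(1 + δ))) + H)
        ≤ liminf (fun n => ENNReal.ofReal (deriv (mreg ρ n (cut ρ α F n) φ) t + H)) atTop := by
  obtain ⟨B, hB, hb, hcf, _⟩ := exists_coeff_bound hρ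
  obtain ⟨K₀, hK₀, hflux⟩ := flux_ge (α := α) hρ hF (by linarith [hα.1]) hα.2.le
  have hM := h.M_nonneg
  have hC := (hc 0).nonneg
  have hT1 := (hc 0).one_le
  set M₁ := B * (3 * (M + C * M) + M) with hM₁
  have hM₁0 : 0 ≤ M₁ := by positivity
  -- The three rates `t ^ (-β₀)`, `t ^ (-3α)` and `t ^ (α - 2)` are all at most `t ^ (-(1 + δ))` for
  -- `t ≥ 1`.
  set δ := min (β₀ - 1) (min (3 * α - 1) (1 - α)) with hδd
  have hδ : 0 < δ := lt_min (by linarith) (lt_min (by linarith [hα.1]) (by linarith [hα.2]))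
  have hδ1 : δ ≤ β₀ - 1 := min_le_left _ _
  have hδ2 : δ ≤ 3 * α - 1 := (min_le_right _ _).trans (min_le_left _ _)
  have hδ3 : δ ≤ 1 - α := (min_le_right _ _).trans (min_le_right _ _)
  refine ⟨2 * K₀ * M ^ 2 + 2 * (C * M * M₁), δ, 2 * ((9 * C * M) * M₁ + C * M * M₁)
    + 2 * (C * M * M₁), by positivity, hδ, by positivity, fun t ht hd => ?_⟩
  have ht1 : 1 ≤ t := hT1.trans ht.le
  have ht0 : 0 < t := by linarith
  have hu := h.memL2 t ht0.le
  have hv := h.grad_memL2 t ht0.le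
  set ℓ : ℕ → ℝ := fun n => 2 * (-Complex.I * ip (fun x =>
        ∑ j, (2 * ((partialDeriv j (cut ρ α F n t) x : ℝ) : ℂ) * v t j x
          + ((partialDeriv j (partialDeriv j (cut ρ α F n t)) x : ℝ) : ℂ) * φ t x))
          (moll n (gam ρ (trunc n (cut ρ α F n) φ t)))
        + ip (fun x => (cutTime ρ α F n t x : ℂ) * φ t x)
          (moll n (gam ρ (trunc n (cut ρ α F n) φ t)))).re with hℓ
  have hβt : t ^ (-β₀) ≤ t ^ (-(1 + δ)) :=
    Real.rpow_le_rpow_of_exponent_le ht1 (by linarith)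
  have hβ1 : t ^ (-β₀) ≤ 1 := Real.rpow_le_one_of_one_le_of_nonpos ht1 (by linarith)
  have hder : ∀ n, ℓ n - 2 * (C * t ^ (-β₀) * M * M₁) ≤ deriv (mreg ρ n (cut ρ α F n) φ) t :=
    fun n => (hc n).le_deriv_mreg h hρ hb hcf n ht (hd n).hasDerivAt
  have hCM : 0 ≤ C * M * M₁ := by positivity
  have herr : 2 * (C * t ^ (-β₀) * M * M₁) ≤ 2 * (C * M * M₁) := by
    have := mul_le_mul_of_nonneg_left hβ1 hCM
    linarith
  -- A crude lower bound, uniform in `n` and in time, which supplies the constant `H` for Fatou's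
  -- lemma. It cancels later and need not be integrable in time.
  have hlow : ∀ n, -(2 * ((9 * C * M) * M₁ + C * M * M₁)) ≤ ℓ n := by
    intro n
    have lJ := L2_moll n (((hc n).isTest_trunc h n ht.le).gam hρ).memLp
    have bJ := (nn_moll_le n (((hc n).isTest_trunc h n ht.le).gam hρ).memLp).trans
      ((hc n).nn_gam_trunc_le h hρ hb hcf n ht.le)
    have l1 : ∀ j, L2 (fun x => ((partialDeriv j (cut ρ α F n t) x : ℝ) : ℂ) * v t j x) := fun j =>
      (hc n).memL2_partial ht.le (hv j) j
    have l2 : ∀ j, L2 (fun x =>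
        ((partialDeriv j (partialDeriv j (cut ρ α F n t)) x : ℝ) : ℂ) * φ t x) := fun j =>
      hu.real_mul_of_bound (contDiff_partialDeriv (contDiff_partialDeriv
        ((hc n).smooth t ht.le) j) j).continuous.measurable ((hc n).partial2_le t ht.le j)
    have l3 : ∀ j, L2 (fun x => 2 * ((partialDeriv j (cut ρ α F n t) x : ℝ) : ℂ) * v t j x
          + ((partialDeriv j (partialDeriv j (cut ρ α F n t)) x : ℝ) : ℂ) * φ t x) := fun j => by
      simpa only [mul_assoc] using ((l1 j).smul 2).add (l2 j)
    have b3 : ∀ j, nn (fun x => 2 * ((partialDeriv j (cut ρ α F n t) x : ℝ) : ℂ) * v t j x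
          + ((partialDeriv j (partialDeriv j (cut ρ α F n t)) x : ℝ) : ℂ) * φ t x) ≤ 3 * C * M := by
      intro j
      have e := nn_add_le ((l1 j).smul 2) (l2 j)
      simp only [← mul_assoc] at e
      refine e.trans ?_
      have e1 : nn (fun x => 2 * ((partialDeriv j (cut ρ α F n t) x : ℝ) : ℂ) * v t j x)
          ≤ 2 * (C * M) := by
        have := nn_smul 2 (f := fun x => ((partialDeriv j (cut ρ α F n t) x : ℝ) : ℂ) * v t j x)
        simp only [← mul_assoc] at this
        rw [this, Complex.norm_ofNat]
        exact mul_le_mul_of_nonneg_left (((hc n).nn_partial_le ht.le (hv j) j).trans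
          (mul_le_mul_of_nonneg_left (h.grad_nn_le t ht0.le j) hC)) two_pos.le
      have e2 : nn (fun x => ((partialDeriv j (partialDeriv j (cut ρ α F n t)) x : ℝ) : ℂ) * φ t x)
          ≤ C * M := (nn_bdd_mul_le hu fun x => by
            rw [Complex.norm_real]; exact (hc n).partial2_le t ht.le j x).trans
          (mul_le_mul_of_nonneg_left (h.nn_le t ht0.le) hC)
      linarith
    have lP := L2.sum Finset.univ l3
    have bP := (nn_sum_le Finset.univ l3).trans (Finset.sum_le_sum fun j _ => b3 j)
    simp only [Finset.sum_const, Finset.card_univ, Fintype.card_fin, nsmul_eq_mul] at bP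
    have lR := (hc n).memL2_time ht.le hu
    have bR : nn (fun x => (cutTime ρ α F n t x : ℂ) * φ t x) ≤ C * M :=
      (nn_bdd_mul_le hu fun x => by
        rw [Complex.norm_real]; exact (hc n).time_le t ht.le x).trans
      (mul_le_mul_of_nonneg_left (h.nn_le t ht0.le) hC)
    have c1 := (norm_ip_le lP lJ).trans (mul_le_mul bP bJ (nn_nonneg _) (by positivity))
    have c2 := (norm_ip_le lR lJ).trans (mul_le_mul bR bJ (nn_nonneg _) (by positivity))
    have c3 := neg_norm_add_norm_le_re (ip (fun x =>
        ∑ j, (2 * ((partialDeriv j (cut ρ α F n t) x : ℝ) : ℂ) * v t j x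
          + ((partialDeriv j (partialDeriv j (cut ρ α F n t)) x : ℝ) : ℂ) * φ t x))
          (moll n (gam ρ (trunc n (cut ρ α F n) φ t))))
      (ip (fun x => (cutTime ρ α F n t x : ℂ) * φ t x)
          (moll n (gam ρ (trunc n (cut ρ α F n) φ t))))
    rw [← hM₁] at c1 c2
    push_cast at c1
    simp only [hℓ]
    linarith
  have hlim : Tendsto ℓ atTop (𝓝 (flux ρ α F t (φ t) (v t))) :=
    tendsto_flux hρ hF hc h hT ht.le
  refine ⟨fun n => by linarith [hlow n, hder n], ?_⟩
  set H := 2 * ((9 * C * M) * M₁ + C * M * M₁) + 2 * (C * M * M₁) with hH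
  have hlim' : Tendsto (fun n => ENNReal.ofReal (ℓ n - 2 * (C * t ^ (-β₀) * M * M₁) + H)) atTop
      (𝓝 (ENNReal.ofReal (flux ρ α F t (φ t) (v t) - 2 * (C * t ^ (-β₀) * M * M₁) + H))) :=
    (ENNReal.continuous_ofReal.tendsto _).comp ((hlim.sub_const _).add_const _)
  refine le_trans ?_ (le_trans hlim'.liminf_eq.ge (liminf_le_liminf
    (Eventually.of_forall fun n => ENNReal.ofReal_le_ofReal (by linarith [hder n]))))
  refine ENNReal.ofReal_le_ofReal ?_
  have hfl := hflux t (φ t) (v t) ht1 (hT t ht.le) hu hv (h.weak t ht0.le)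
  have r1 : (t ^ α)⁻¹ ^ 3 ≤ t ^ (-(1 + δ)) := by
    rw [← Real.rpow_neg ht0.le, ← Real.rpow_natCast, ← Real.rpow_mul ht0.le]
    exact Real.rpow_le_rpow_of_exponent_le ht1 (by push_cast; linarith)
  have r2 : t ^ α / t ^ 2 ≤ t ^ (-(1 + δ)) := by
    rw [← Real.rpow_natCast, ← Real.rpow_sub ht0]
    exact Real.rpow_le_rpow_of_exponent_le ht1 (by push_cast; linarith)
  have r0 : 0 ≤ t ^ (-(1 + δ)) := Real.rpow_nonneg ht0.le _
  have hnn : nn (φ t) ^ 2 ≤ M ^ 2 := pow_le_pow_left₀ (nn_nonneg _) (h.nn_le t ht0.le) 2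
  have r3 : K₀ * ((t ^ α)⁻¹ ^ 3 + t ^ α / t ^ 2) * nn (φ t) ^ 2
      ≤ K₀ * (t ^ (-(1 + δ)) + t ^ (-(1 + δ))) * M ^ 2 := by gcongr
  have r4 := mul_le_mul_of_nonneg_left hβt hCM
  linarith

end

/-! ### The propagation estimate along a solution curve -/

section
variable {F : ℝ → ℝ} {ρ : ℝ → ℝ} {α : ℝ} {N : ℝ → ℝ → ℝ → ℂ} {φ : ℝ → E3 → ℂ}
  {v : ℝ → Fin 3 → E3 → ℂ} {M T₀ C β₀ : ℝ}

lemma dens_nonneg (hF : IsSmoothChar F) (T : ℝ) (u : E3 → ℂ) (w : Fin 3 → E3 → ℂ) (x : E3) :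
    0 ≤ dens ρ F T u w x :=
  mul_nonneg (mul_nonneg (hF.deriv_nonneg _) (hF.nonneg _)) (sq_nonneg _)

lemma nn_qfun_le (hρ : IsBump ρ) {B : ℝ} (hb : ∀ j x, |bvec ρ j x| ≤ B)
    (hcf : ∀ x, |cfun ρ x| ≤ B) {u : E3 → ℂ} {w : Fin 3 → E3 → ℂ} (hu : L2 u)
    (hw : ∀ j, L2 (w j)) (huM : nn u ≤ M) (hwM : ∀ j, nn (w j) ≤ M) :
    nn (qfun ρ u w) ≤ 4 * (B * M) := by
  have hB : 0 ≤ B := (abs_nonneg _).trans (hcf 0)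
  have l1 : ∀ j, L2 (fun x => (bvec ρ j x : ℂ) * w j x) := fun j =>
    (hw j).real_mul_of_bound (contDiff_bvec hρ j).continuous.measurable (hb j)
  have l2 := hu.real_mul_of_bound (contDiff_cfun hρ).continuous.measurable hcf
  have b1 : ∀ j, nn (fun x => (bvec ρ j x : ℂ) * w j x) ≤ B * M := fun j =>
    (nn_bdd_mul_le (hw j) fun x => by rw [Complex.norm_real]; exact hb j x).trans
      (mul_le_mul_of_nonneg_left (hwM j) hB)
  have b2 : nn (fun x => (cfun ρ x : ℂ) * u x) ≤ B * M :=
    (nn_bdd_mul_le hu fun x => by rw [Complex.norm_real]; exact hcf x).trans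
      (mul_le_mul_of_nonneg_left huM hB)
  have e1 := nn_add_le (L2.sum Finset.univ l1) l2
  have e2 := (nn_sum_le Finset.univ l1).trans (Finset.sum_le_sum fun j _ => b1 j)
  simp only [Finset.sum_const, Finset.card_univ, Fintype.card_fin, nsmul_eq_mul] at e2
  push_cast at e2
  exact e1.trans (by linarith)

/-- Uniform in time and scale. It handles the bounded initial time interval, where the propagation
estimate is not yet available. -/
lemma exists_integral_dens_le (hρ : IsBump ρ) (hF : IsSmoothChar F) (h : SolutionCurve N φ v M) :
    ∃ Q, ∀ T t, 0 ≤ t → ∫ x, dens ρ F T (φ t) (v t) x ≤ Q := by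
  obtain ⟨B, hB, hb, hcf, _⟩ := exists_coeff_bound hρ
  obtain ⟨D, hD, h1, -⟩ := hF.exists_bounds
  refine ⟨D * (4 * (B * M)) ^ 2, fun T t ht => ?_⟩
  have hu := h.memL2 t ht
  have hv := h.grad_memL2 t ht
  have hq := L2_qfun hρ hu hv
  calc ∫ x, dens ρ F T (φ t) (v t) x ≤ ∫ x, D * ‖qfun ρ (φ t) (v t) x‖ ^ 2 := by
        refine integral_mono (integrable_dens hρ hF T hu hv) ((integrable_norm_sq hq).const_mul D)
          fun x => mul_le_mul_of_nonneg_right ?_ (sq_nonneg _)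
        exact (le_abs_self _).trans (abs_mul_le_of_le_one (h1 _) (hF.abs_le _))
    _ = D * nn (qfun ρ (φ t) (v t)) ^ 2 := by rw [integral_const_mul, nn_sq hq]
    _ ≤ _ := mul_le_mul_of_nonneg_left (pow_le_pow_left₀ (nn_nonneg _)
        (nn_qfun_le hρ hb hcf hu hv (h.nn_le t ht) (h.grad_nn_le t ht)) 2) hD

/-- Convergence of the observable, and integrability of the density of the propagation form. -/
lemma propagation_estimate (hρ : IsBump ρ) (hF : IsSmoothChar F) (hα : α ∈ Ioo (1 / 3 : ℝ) 1)
    (hβ : 1 < β₀) (hT : ∀ t, T₀ ≤ t → 8 ≤ t ^ α)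
    (hc : ∀ n, CutoffFamily ρ N φ T₀ C β₀ (cut ρ α F n) (cutTime ρ α F n))
    (h : SolutionCurve N φ v M) :
    (∃ L, Tendsto (fun t => (obs ρ F (t ^ α) (φ t) (v t)).re) atTop (𝓝 L)) ∧
      ∫⁻ t in Ioi (T₀ + 1),
        ENNReal.ofReal (3 * ((t ^ α)⁻¹ * ∫ x, dens ρ F (t ^ α) (φ t) (v t) x)) < ⊤ := by
  obtain ⟨B, hB, hb, hcf, _⟩ := exists_coeff_bound hρ
  obtain ⟨K, δ, H, hK, hδ, hH, hmain⟩ := exists_liminf_deriv_ge hρ hF hα hβ hT hc h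
  have hT1 := (hc 0).one_le
  have hM := h.M_nonneg
  choose L hL using fun n => (hc n).lipschitz_mreg h hρ n
  refine tendsto_and_lintegral_lt_top (R := M * (B * (3 * (M + C * M) + M))) hK hδ
    (by linarith) (fun t ht => ?_) fun a b ha hab => ?_
  · have ht' : T₀ ≤ t := by linarith
    refine le_of_tendsto (tendsto_mreg_re hρ hF hc h hT ht').abs (Eventually.of_forall fun n => ?_)
    have hw := (hc n).isTest_trunc h n ht'
    have hu := h.memL2 t ((hc 0).pos ht')
    refine (Complex.abs_re_le_norm _).trans ((norm_ip_le hw.memLp (hw.gam hρ).memLp).trans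
      (mul_le_mul ?_ ((hc n).nn_gam_trunc_le h hρ hb hcf n ht') (nn_nonneg _) hM))
    exact (nn_moll_le n ((hc n).memL2_mul ht' hu)).trans
      (((hc n).nn_mul_le ht' hu).trans (h.nn_le t ((hc 0).pos ht')))
  · refine increment_of_lintegral (B := fun t => (obs ρ F (t ^ α) (φ t) (v t)).re)
      (X := fun t => 3 * ((t ^ α)⁻¹ * ∫ x, dens ρ F (t ^ α) (φ t) (v t) x)) hK hδ hH
      (by linarith) hab (fun t ht => ?_) ?_
    · have : 0 ≤ t ^ α := Real.rpow_nonneg (by linarith [ht.1]) _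
      exact mul_nonneg (by norm_num) (mul_nonneg (inv_nonneg.2 this)
        (integral_nonneg fun x => dens_nonneg hF _ _ _ x))
    · exact lintegral_le_of_liminf_deriv hab
        (fun n => (hL n).mono fun s hs => by simp only [mem_Ici]; linarith [hs.1])
        (fun t ht hd => hmain t (by linarith [ht.1]) hd)
        (tendsto_mreg_re hρ hF hc h hT (by linarith))
        (tendsto_mreg_re hρ hF hc h hT (by linarith))

/-- On `[1, T]` the integrand is bounded. Beyond `T` it is at most the integrable density plus a
multiple of `t ^ (-3α)`, with `3α > 1`. -/
lemma lintegral_propagationForm_lt_top (hρ : IsBump ρ) (hF : IsSmoothChar F)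
    (hα : α ∈ Ioo (1 / 3 : ℝ) 1) (h : SolutionCurve N φ v M) {T : ℝ} (hT : 1 ≤ T)
    (hint : ∫⁻ t in Ioi T,
      ENNReal.ofReal (3 * ((t ^ α)⁻¹ * ∫ x, dens ρ F (t ^ α) (φ t) (v t) x)) < ⊤) :
    ∫⁻ t in Ici (1 : ℝ), ENNReal.ofReal (t ^ (-α)) * propagationForm ρ α F t (φ t) < ⊤ := by
  obtain ⟨K, hK, hform⟩ := propagationForm_le (α := α) hρ hF
  obtain ⟨Q, hQ⟩ := exists_integral_dens_le hρ hF h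
  have hα0 : 0 ≤ α := by linarith [hα.1]
  have hM := h.M_nonneg
  have hbase : ∀ t : ℝ, 1 ≤ t →
      ENNReal.ofReal (t ^ (-α)) * propagationForm ρ α F t (φ t) ≤ ENNReal.ofReal
        (t ^ (-α) * (2 * (∫ x, dens ρ F (t ^ α) (φ t) (v t) x) + K * (t ^ α)⁻¹ ^ 2 * M ^ 2)) := by
    intro t ht
    have ht0 : 0 ≤ t := by linarith
    rw [ENNReal.ofReal_mul (Real.rpow_nonneg ht0 _)]
    refine mul_le_mul_right ((hform t (φ t) (v t) (Real.one_le_rpow ht hα0) (h.memL2 t ht0)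
      (h.grad_memL2 t ht0) (h.weak t ht0)).trans (ENNReal.ofReal_le_ofReal ?_)) _
    have := pow_le_pow_left₀ (nn_nonneg _) (h.nn_le t ht0) 2
    gcongr
  have hsub : Ici (1 : ℝ) ⊆ Icc 1 T ∪ Ioi T := fun t ht => by
    rcases le_or_gt t T with h' | h'
    · exact Or.inl ⟨ht, h'⟩
    · exact Or.inr h'
  refine lt_of_le_of_lt ((lintegral_mono_set hsub).trans (lintegral_union_le _ _ _))
    (ENNReal.add_lt_top.2 ⟨?_, ?_⟩)
  · refine lt_of_le_of_lt (setLIntegral_mono' measurableSet_Icc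
      (g := fun _ => ENNReal.ofReal (2 * Q + K * M ^ 2)) fun t ht => ?_) ?_
    · refine (hbase t ht.1).trans (ENNReal.ofReal_le_ofReal ?_)
      have ht0 : 0 ≤ t := by linarith [ht.1]
      have e1 : t ^ (-α) ≤ 1 := Real.rpow_le_one_of_one_le_of_nonpos ht.1 (by linarith)
      have e2 : (t ^ α)⁻¹ ^ 2 ≤ 1 :=
        pow_le_one₀ (inv_nonneg.2 (Real.rpow_nonneg ht0 _)) (inv_le_one_of_one_le₀ (Real.one_le_rpow ht.1 hα0))
      have e3 : 0 ≤ ∫ x, dens ρ F (t ^ α) (φ t) (v t) x :=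
        integral_nonneg fun x => dens_nonneg hF _ _ _ x
      have e4 := hQ (t ^ α) t ht0
      refine (mul_le_of_le_one_left (by positivity) e1).trans ?_
      have e5 : K * (t ^ α)⁻¹ ^ 2 * M ^ 2 ≤ K * 1 * M ^ 2 := by gcongr
      linarith
    · rw [lintegral_const, Measure.restrict_apply_univ, Real.volume_Icc]
      exact ENNReal.mul_lt_top ENNReal.ofReal_lt_top ENNReal.ofReal_lt_top
  · have hmeas : Measurable fun t : ℝ => ENNReal.ofReal (K * M ^ 2 * t ^ (-(3 * α))) := by fun_prop
    refine lt_of_le_of_lt (setLIntegral_mono' measurableSet_Ioi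
      (g := fun t => ENNReal.ofReal (3 * ((t ^ α)⁻¹ * ∫ x, dens ρ F (t ^ α) (φ t) (v t) x))
        + ENNReal.ofReal (K * M ^ 2 * t ^ (-(3 * α)))) fun t ht => ?_) ?_
    · have ht1 : 1 ≤ t := hT.trans ht.le
      have ht0 : 0 ≤ t := by linarith
      refine (hbase t ht1).trans (le_trans (ENNReal.ofReal_le_ofReal ?_) ENNReal.ofReal_add_le)
      have e3 : 0 ≤ ∫ x, dens ρ F (t ^ α) (φ t) (v t) x :=
        integral_nonneg fun x => dens_nonneg hF _ _ _ x
      have e0 : t ^ (-(3 * α)) = (t ^ α)⁻¹ ^ 3 := by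
        rw [← Real.rpow_neg ht0, ← Real.rpow_natCast, ← Real.rpow_mul ht0]
        congr 1; push_cast; ring
      have e6 : 0 ≤ (t ^ α)⁻¹ := inv_nonneg.2 (Real.rpow_nonneg ht0 _)
      rw [e0, Real.rpow_neg ht0]
      have := mul_nonneg e6 e3
      linarith
    · rw [lintegral_add_right _ hmeas]
      refine ENNReal.add_lt_top.2 ⟨hint, ?_⟩
      have : IntegrableOn (fun t : ℝ => K * M ^ 2 * t ^ (-(3 * α))) (Ioi T) :=
        (integrableOn_Ioi_rpow_of_lt (by linarith [hα.1]) (by linarith)).const_mul _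
      exact this.lintegral_lt_top

end

end NLSGamma
end

/-! ### Assembly of the theorem. -/

theorem mainTheorem3
    (ρ : ℝ → ℝ) (hρ : NLSGamma.IsBump ρ)
    (N : ℝ → ℝ → ℝ → ℂ) (φ₀ : NLSGamma.E3 → ℂ) (φ : ℝ → NLSGamma.E3 → ℂ)
    (hφ : NLSGamma.IsGlobalSolution N φ₀ φ)
    (hH1 : NLSGamma.GlobalH1Bound φ)
    (α₀ : ℝ) (hα₀ : α₀ ∈ Set.Ioo (1 / 3 : ℝ) 1)
    (F₀ : ℝ → ℝ) (hF₀ : NLSGamma.IsSmoothChar F₀)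
    (hH2 : NLSGamma.InteractionDecay N φ α₀ F₀)
    (α : ℝ) (hα : α ∈ Set.Ioo (1 / 3 : ℝ) 1)
    (F : ℝ → ℝ) (hF : NLSGamma.IsSmoothChar F)
    (hαF : α₀ < α ∨ (α = α₀ ∧ F = F₀)) :
    (∃ Γ : ℝ, Filter.Tendsto
        (fun T : ℝ => NLSGamma.expectation (NLSGamma.observable ρ α F T) (φ T))
        Filter.atTop (nhds (Γ : ℂ))) ∧
      (∫⁻ t in Set.Ici (1 : ℝ),
        ENNReal.ofReal (t ^ (-α)) * NLSGamma.propagationForm ρ α F t (φ t)) < ⊤ := by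
  obtain ⟨M, h⟩ := hφ.exists_solutionCurve hH1
  obtain ⟨T₀, C, β₀, hβ, hT, hc⟩ := NLSGamma.exists_cutoffFamily hρ (by linarith [hα.1]) hα.2
    (by linarith [hα₀.1]) hF₀ hF hH2 hαF
  obtain ⟨⟨Γ, hΓ⟩, hint⟩ := NLSGamma.propagation_estimate hρ hF hα hβ hT hc h
  have hT1 := (hc 0).one_le
  refine ⟨⟨Γ, ((Complex.continuous_ofReal.tendsto _).comp hΓ).congr' ?_⟩,
    NLSGamma.lintegral_propagationForm_lt_top hρ hF hα h (by linarith) hint⟩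
  filter_upwards [eventually_ge_atTop T₀] with t ht
  rw [NLSGamma.expectation_eq_obs hρ hF (hT t ht) (h.weak t ((hc 0).pos ht))]
  exact (NLSGamma.obs_im hρ hF hc h hT ht).symm
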